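/- Let $K$ be a number field with absolute Galois group $G_K=\mathrm{Gal}(\overline K/K)$, let $E/K$ be an elliptic curve and let $p$ be an odd prime. Let $\bar\rho_{E,p}\colon G_K\to \mathrm{GL}_2(\mathbb F_p)$ be the representation given by the action of $G_K$ on $E[p]$ in a basis of $E[p]$, and let $\mathbb P\bar\rho_{E,p}$ denote its composition with $\mathrm{GL}_2(\mathbb F_p)\to \mathrm{PGL}_2(\mathbb F_p)$. Assume condition (S): the image of $\bar\rho_{E,p}$ is not contained in a (split or non-split) Cartan subgroup of $\mathrm{GL}_2(\mathbb F_p)$. A twist of $E$ is an elliptic curve $E'/K$ isomorphic to $E$ over $\overline K$; it is non-trivial if it is not isomorphic to $E$ over $K$. Two elliptic curves $E,E'$ over $K$ are $p$-congruent if $E[p]\cong E'[p]$ as $G_K$-modules. If $E$ has the short Weierstrass form $Y^2=X^3+aX+b$ and $d\in K^*$, then $E^d$ is the quadratic twist $Y^2=X^3+ad^2X+bd^3$; if $j(E)=1728$, so that $b=0$, the quartic twist of $E$ by $u\in K^*$ is $Y^2=X^3+auX$. $D_n$ is the dihedral group of order $2n$. 1) Assume further that $j(E)\neq 0$ if $p=3$.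 If $E$ is $p$-congruent to a non-trivial twist of $E$, then the image of $\bar\rho_{E,p}$ is contained in the normaliser of a Cartan subgroup of $\mathrm{GL}_2(\mathbb F_p)$ but not in the Cartan subgroup itself, and $\mathbb P\bar\rho_{E,p}(G_K)\cong D_n$ for some $n\ge 2$. 2) Conversely, suppose that the image of $\bar\rho_{E,p}$ is absolutely irreducible and contained in the normaliser of a Cartan subgroup $C$ of $\mathrm{GL}_2(\mathbb F_p)$ but not in $C$ itself. Then $\bar\rho_{E,p}^{-1}(C)$ is the absolute Galois group of a quadratic extension $K(\sqrt d)$ of $K$. Up to $K$-isomorphism there is exactly one non-trivial twist $E'$ of $E$ that becomes isomorphic to $E$ over $K(\sqrt d)$; it is $E^d$, unless $j(E)=1728$ and $d=-1$ modulo squares in $K^*$, in which case it is the quartic twist of $E$ by $-4$. Moreover $E[p]\cong E'[p]$ as $G_K$-modules. 3) In the situation of 2), consider the non-trivial twists of $E$ that become isomorphic to $E$ over some quadratic extension of $K$ and are $p$-congruent to $E$. If the order of $\mathbb P\bar\rho_{E,p}(G_K)$ is not $4$, then $E'$ is the only one up to $K$-isomorphism, and $K(\sqrt d)$ is the only quadratic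 extension of $K$ from which such a twist arises. If the order of $\mathbb P\bar\rho_{E,p}(G_K)$ is $4$, then such twists arise from exactly three quadratic extensions of $K$; up to $K$-isomorphism there are exactly three such twists if $j(E)\ne 1728$, and exactly two if $j(E)=1728$. -/

import Mathlib

open WeierstrassCurve

namespace TwistCongruence

section Torsion

variable {K : Type*} [Field K]

open scoped Classical in
/-- The group `E[p]` of `p`-torsion points of `E` over a fixed algebraic closure of `K`. -/
def Torsion (E : WeierstrassCurve K) (p : ℕ) : Type _ :=
  AddSubgroup.torsionBy (E.baseChange (AlgebraicClosure K)).toAffine.Point (p : ℤ)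

open scoped Classical in
noncomputable instance (E : WeierstrassCurve K) (p : ℕ) : AddCommGroup (Torsion E p) :=
  inferInstanceAs (AddCommGroup
    (AddSubgroup.torsionBy (E.baseChange (AlgebraicClosure K)).toAffine.Point (p : ℤ)))

open scoped Classical in
noncomputable instance (E : WeierstrassCurve K) (p : ℕ) : Module (ZMod p) (Torsion E p) :=
  AddCommGroup.zmodModule (G := Torsion E p)
    (fun x => AddSubgroup.torsionBy.nsmul
      (A := (E.baseChange (AlgebraicClosure K)).toAffine.Point) x)

open scoped Classical in
/-- The coordinatewise action of `σ` in the absolute Galois group of `K` on `E[p]`. -/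
noncomputable def galoisMap (E : WeierstrassCurve K) (p : ℕ)
    (σ : AlgebraicClosure K ≃ₐ[K] AlgebraicClosure K) : Torsion E p →+ Torsion E p :=
  ((Affine.Point.map (W' := E.toAffine) (σ : AlgebraicClosure K →ₐ[K] AlgebraicClosure K)).comp
    (AddSubgroup.torsionBy (E.baseChange (AlgebraicClosure K)).toAffine.Point
      (p : ℤ)).subtype).codRestrict
    (AddSubgroup.torsionBy (E.baseChange (AlgebraicClosure K)).toAffine.Point (p : ℤ))
    (fun x => AddSubgroup.torsionBy.nsmul_iff.mpr (by
      rw [← map_nsmul, AddSubgroup.torsionBy.nsmul, map_zero]))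

/-- The `𝔽_p`-linear representation of the absolute Galois group of `K` on `E[p]`. -/
noncomputable def galoisRep (E : WeierstrassCurve K) (p : ℕ) :
    Representation (ZMod p) (AlgebraicClosure K ≃ₐ[K] AlgebraicClosure K) (Torsion E p) where
  toFun σ := (galoisMap E p σ).toZModLinearMap p
  map_one' := by
    ext x
    apply Subtype.ext
    rcases x with ⟨_ | _, hx⟩ <;> rfl
  map_mul' σ τ := by
    ext x
    apply Subtype.ext
    rcases x with ⟨_ | _, hx⟩ <;> rfl

/-- The mod `p` Galois representation `ρ̄_{E,p} : G_K → GL₂(𝔽_p)`, written in the basis `b`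
of `E[p]`. -/
noncomputable def rhoBar (E : WeierstrassCurve K) (p : ℕ)
    (b : Module.Basis (Fin 2) (ZMod p) (Torsion E p)) :
    (AlgebraicClosure K ≃ₐ[K] AlgebraicClosure K) →* GL (Fin 2) (ZMod p) :=
  ((LinearMap.toMatrixAlgEquiv b : _ →* Matrix (Fin 2) (Fin 2) (ZMod p)).comp
    (galoisRep E p)).toHomUnits

/-- `E` and `E'` are `p`-congruent: `E[p]` and `E'[p]` are isomorphic as `G_K`-modules. -/
def Congruent (p : ℕ) (E E' : WeierstrassCurve K) : Prop :=
  ∃ φ : Torsion E p ≃+ Torsion E' p,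
    ∀ (σ : AlgebraicClosure K ≃ₐ[K] AlgebraicClosure K) (P : Torsion E p),
      φ (galoisRep E p σ P) = galoisRep E' p σ (φ P)

end Torsion

section Twists

variable {K : Type*} [Field K]

/-- `E` and `E'` become isomorphic over the extension `L` of `K`. -/
def IsoOver (L : Type*) [Field L] [Algebra K L] (E E' : WeierstrassCurve K) : Prop :=
  ∃ c : VariableChange L, c • E.baseChange L = E'.baseChange L

/-- `E'` is a non-trivial twist of `E` that becomes isomorphic to `E` over `L`. -/
def IsTwistOver (L : Type*) [Field L] [Algebra K L] (E E' : WeierstrassCurve K) : Prop :=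
  IsoOver L E E' ∧ ¬ IsoOver K E E'

/-- `E'` is a (non-trivial) twist of `E`. -/
def IsTwist (E E' : WeierstrassCurve K) : Prop :=
  IsTwistOver (AlgebraicClosure K) E E'

/-- The field `K(√d)`, inside the fixed algebraic closure of `K`. -/
noncomputable def adjoinSqrt (d : K) : IntermediateField K (AlgebraicClosure K) :=
  IntermediateField.adjoin K {x | x ^ 2 = algebraMap K (AlgebraicClosure K) d}

/-- The quadratic twist `E^d`, as `Y² = X³ + a d² X + b d³`, where `Y² = X³ + a X + b` with
`a = -c₄/48` and `b = -c₆/864` is the short Weierstrass form of `E`. -/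
noncomputable def quadraticTwist (E : WeierstrassCurve K) (d : K) : WeierstrassCurve K :=
  ⟨0, 0, 0, -E.c₄ / 48 * d ^ 2, -E.c₆ / 864 * d ^ 3⟩

/-- The quartic twist by `u`, as `Y² = X³ + a u X`, of a curve `E` with `j(E) = 1728`, whose short
Weierstrass form is `Y² = X³ + a X` with `a = -c₄/48`. -/
noncomputable def quarticTwist (E : WeierstrassCurve K) (u : K) : WeierstrassCurve K :=
  ⟨0, 0, 0, -E.c₄ / 48 * u, 0⟩

open scoped Classical in
/-- The twist of `E` attached to the quadratic extension `K(√d)`: the quartic twist by `-4` if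
`j(E) = 1728` and `d = -1` modulo squares, and the quadratic twist `E^d` otherwise. -/
noncomputable def attachedTwist (E : WeierstrassCurve K) [E.IsElliptic] (d : K) :
    WeierstrassCurve K :=
  if E.j = 1728 ∧ IsSquare (-d) then quarticTwist E (-4) else quadraticTwist E d

/-- The quadratic extensions `L` of `K` such that some non-trivial twist of `E` that becomes
isomorphic to `E` over `L` is `p`-congruent to `E`. -/
def congruenceFields (p : ℕ) (E : WeierstrassCurve K) :
    Set (IntermediateField K (AlgebraicClosure K)) :=
  {L | Module.finrank K L = 2 ∧ ∃ E' : WeierstrassCurve K, IsTwistOver L E E' ∧ Congruent p E E'}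

/-- The non-trivial twists of `E` that become isomorphic to `E` over some quadratic extension of
`K` and are `p`-congruent to `E`. -/
def congruentTwists (p : ℕ) (E : WeierstrassCurve K) : Set (WeierstrassCurve K) :=
  {E' | (∃ L : IntermediateField K (AlgebraicClosure K),
    Module.finrank K L = 2 ∧ IsTwistOver L E E') ∧ Congruent p E E'}

/-- The set of `K`-isomorphism classes of members of `congruentTwists p E`. -/
def congruentTwistClasses (p : ℕ) (E : WeierstrassCurve K) :
    Set (MulAction.orbitRel.Quotient (VariableChange K) (WeierstrassCurve K)) :=
  (fun E' => Quotient.mk _ E') '' congruentTwists p E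

end Twists

section Matrices

variable {p : ℕ} [Fact p.Prime]

/-- `C` is conjugate to the group of diagonal matrices. -/
def IsSplitCartan (C : Subgroup (GL (Fin 2) (ZMod p))) : Prop :=
  ∃ g : GL (Fin 2) (ZMod p), ∀ x, x ∈ C ↔
    (g⁻¹ * x * g).val 0 1 = 0 ∧ (g⁻¹ * x * g).val 1 0 = 0

/-- `C` is conjugate to the group of matrices `!![a, ε c; c, a]`, where `ε` is a non-square; these
are the matrices of the multiplications by the elements `a + c √ε` of `𝔽_{p²}ˣ` (`p` odd). -/
def IsNonsplitCartan (C : Subgroup (GL (Fin 2) (ZMod p))) : Prop :=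
  ∃ (g : GL (Fin 2) (ZMod p)) (ε : ZMod p), ¬ IsSquare ε ∧ ∀ x, x ∈ C ↔
    (g⁻¹ * x * g).val 0 0 = (g⁻¹ * x * g).val 1 1 ∧
      (g⁻¹ * x * g).val 0 1 = ε * (g⁻¹ * x * g).val 1 0

/-- Cartan subgroups of `GL₂(𝔽_p)`, for `p` odd. -/
def IsCartan (C : Subgroup (GL (Fin 2) (ZMod p))) : Prop :=
  IsSplitCartan C ∨ IsNonsplitCartan C

/-- Condition (S) for the image `G` of a mod `p` representation: `G` is not contained in a Cartan
subgroup. -/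
def ConditionS (G : Subgroup (GL (Fin 2) (ZMod p))) : Prop :=
  ∀ C : Subgroup (GL (Fin 2) (ZMod p)), IsCartan C → ¬ G ≤ C

/-- `G` acts irreducibly on the plane over an algebraic closure of `𝔽_p`. -/
def AbsolutelyIrreducible (G : Subgroup (GL (Fin 2) (ZMod p))) : Prop :=
  ∀ W : Submodule (AlgebraicClosure (ZMod p)) (Fin 2 → AlgebraicClosure (ZMod p)),
    (∀ g ∈ G, ∀ v ∈ W,
      (g.val.map (algebraMap (ZMod p) (AlgebraicClosure (ZMod p)))).mulVec v ∈ W) →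
    W = ⊥ ∨ W = ⊤

/-- The image of `G` in `PGL₂(𝔽_p)`. -/
def projImage (G : Subgroup (GL (Fin 2) (ZMod p))) :
    Subgroup (Matrix.ProjGenLinGroup (Fin 2) (ZMod p)) :=
  G.map Matrix.ProjGenLinGroup.mk

end Matrices

/-- The quadratic extension of `K` cut out by the subgroup `C` of `GL₂(𝔽_p)` is `K(√d)`: `d` is not
a square in `K` and the preimage of `C` under `ρ̄_{E,p}` is the absolute Galois group of `K(√d)`. -/
def CutsOut {K : Type*} [Field K] (E : WeierstrassCurve K) (p : ℕ)
    (b : Module.Basis (Fin 2) (ZMod p) (Torsion E p)) (C : Subgroup (GL (Fin 2) (ZMod p)))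
    (d : K) : Prop :=
  ¬ IsSquare d ∧ C.comap (rhoBar E p b) = (adjoinSqrt d).fixingSubgroup

end TwistCongruence

/-! In characteristic zero an isomorphism of Weierstrass curves is, in short coordinates, `(X, Y) ↦
(u²X, u³Y)`, so it is recorded by one number `u` with `c₄' = u⁴c₄` and `c₆' = u⁶c₆`
(`exists_smul_eq_iff_exists_scaling`). A twist is such a `u` in the algebraic closure, and its
cocycle `ζ_σ = u⁻¹σ(u)` takes values in the automorphisms of `E`. Write `M(ζ)` for the matrix of `ζ`
on `E[p]`. A congruence is an invertible `A` with `A ρ(σ) = M(ζ_σ) ρ(σ) A` for all `σ`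
(`congruent_iff_of_scaling`), and the question becomes one about `GL₂(𝔽_p)`.

Cartan subgroups are the centralisers of invertible trace-zero matrices `γ`, and their normalisers
consist of the matrices that commute or anticommute with `γ` (`Traceless.signCommutes_iff`). An
image inside such a normaliser therefore carries a sign character, non-trivial by (S), whose kernel
cuts out a quadratic field.

A non-trivial congruent twist produces `γ` (`exists_traceless_of_isTwist`). If some `M(ζ_σ)` is not
scalar, its trace-zero part works, because Galois sends `ζ` to `ζ` or `ζ⁻¹`. If all are scalar, they
are `±1` by determinants, and `γ = A` works. The projective image is dihedral because the
centraliser of `γ` has cyclic image and anticommuting elements act on it by inversion.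

Conversely, `K(√d)` splits only one non-trivial twist (`isoOver_attachedTwist_of_isTwistOver`). For
the quadratic twist the cocycle is the sign character, so `A = γ` is a congruence. For the quartic
twist by `-4 = (1+i)⁴`, the automorphism-like map `1 - i` followed by scaling by `1 + i` is a
2-isogeny over `K`, which is bijective on `p`-torsion (`congruent_attachedTwist`).

For uniqueness, two trace-zero matrices that do not commute have only scalars in common in their
centralisers, so two different sign characters embed the projective image in a group of order 4.
When the order is 4 there are three characters, whose product is trivial, hence three fields. If `j
= 1728`, one of the fields is `K(√-1)`, and the quadratic twists from the other two coincide. -/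

namespace TwistCongruence

/-! ### Isomorphisms of Weierstrass curves as scalings of the short form -/

section Scaling

variable {F : Type*} [Field F]

/-- The `X`-coordinate in the short Weierstrass form of `W`. -/
def shortX (W : WeierstrassCurve F) (x : F) : F := x + W.b₂ / 12

/-- The `Y`-coordinate in the short Weierstrass form of `W`. -/
def shortY (W : WeierstrassCurve F) (x y : F) : F := y + (W.a₁ * x + W.a₃) / 2

lemma shortX_injective (W : WeierstrassCurve F) : Function.Injective (shortX W) :=
  fun _ _ h => add_right_cancel h

lemma shortY_injective (W : WeierstrassCurve F) (x : F) : Function.Injective (shortY W x) :=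
  fun _ _ h => add_right_cancel h

/-- `u ≠ 0` scales the short Weierstrass form of `W` to that of `W'`. -/
structure Scaling (W W' : WeierstrassCurve F) (u : F) : Prop where
  ne_zero : u ≠ 0
  c₄_eq : W'.c₄ = u ^ 4 * W.c₄
  c₆_eq : W'.c₆ = u ^ 6 * W.c₆

lemma Scaling.one (W : WeierstrassCurve F) : Scaling W W 1 := ⟨one_ne_zero, by ring, by ring⟩

lemma Scaling.neg {W W' : WeierstrassCurve F} {u : F} (h : Scaling W W' u) : Scaling W W' (-u) :=
  ⟨neg_ne_zero.mpr h.1, by rw [h.2]; ring, by rw [h.3]; ring⟩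

lemma Scaling.mul {W W' W'' : WeierstrassCurve F} {u v : F} (h : Scaling W W' u)
    (h' : Scaling W' W'' v) : Scaling W W'' (v * u) :=
  ⟨mul_ne_zero h'.1 h.1, by rw [h'.2, h.2]; ring, by rw [h'.3, h.3]; ring⟩

lemma Scaling.inv {W W' : WeierstrassCurve F} {u : F} (h : Scaling W W' u) :
    Scaling W' W u⁻¹ := by
  have := h.1
  exact ⟨inv_ne_zero h.1, by rw [h.2]; field_simp, by rw [h.3]; field_simp⟩

variable [CharZero F]

lemma equation_iff_short (W : WeierstrassCurve F) (x y : F) :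
    W.toAffine.Equation x y ↔
      shortY W x y ^ 2 = shortX W x ^ 3 - W.c₄ / 48 * shortX W x - W.c₆ / 864 := by
  rw [Affine.equation_iff', ← sub_eq_zero (b := _ - _)]
  simp only [shortX, shortY, c₄, c₆, b₂, b₄, b₆]
  constructor <;> intro h <;> linear_combination h

lemma nonsingular_iff_short (W : WeierstrassCurve F) (x y : F) :
    W.toAffine.Nonsingular x y ↔ W.toAffine.Equation x y ∧
      (3 * shortX W x ^ 2 - W.c₄ / 48 ≠ 0 ∨ shortY W x y ≠ 0) := by
  rw [Affine.nonsingular_iff', and_congr_right_iff]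
  intro _
  have h₁ : W.toAffine.a₁ * y - (3 * x ^ 2 + 2 * W.toAffine.a₂ * x + W.toAffine.a₄) =
      W.a₁ * shortY W x y - (3 * shortX W x ^ 2 - W.c₄ / 48) := by
    simp only [shortX, shortY, c₄, b₂, b₄]; ring
  have h₂ : 2 * y + W.toAffine.a₁ * x + W.toAffine.a₃ = 2 * shortY W x y := by
    simp only [shortY]; ring
  rw [h₁, h₂]
  by_cases h : shortY W x y = 0
  · rw [h, mul_zero, zero_sub, neg_ne_zero]
    simp
  · simp [h]

lemma shortY_negY (W : WeierstrassCurve F) (x y : F) :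
    shortY W x (W.toAffine.negY x y) = -shortY W x y := by
  simp only [shortY, Affine.negY]; ring

lemma eq_negY_iff (W : WeierstrassCurve F) (x y₁ y₂ : F) :
    y₁ = W.toAffine.negY x y₂ ↔ shortY W x y₁ = -shortY W x y₂ := by
  rw [← shortY_negY, (shortY_injective W x).eq_iff]

/-- Completing the square turns a slope `l` into `l + a₁/2`; with this shift the addition formulas
are those of the short form. -/
lemma shortX_addX (W : WeierstrassCurve F) (x₁ x₂ l : F) :
    shortX W (W.toAffine.addX x₁ x₂ l) =
      (l + W.a₁ / 2) ^ 2 - shortX W x₁ - shortX W x₂ := by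
  simp only [shortX, Affine.addX, b₂]; ring

lemma shortY_addY (W : WeierstrassCurve F) (x₁ x₂ y₁ l : F) :
    shortY W (W.toAffine.addX x₁ x₂ l) (W.toAffine.addY x₁ x₂ y₁ l) =
      -((l + W.a₁ / 2) * (shortX W (W.toAffine.addX x₁ x₂ l) - shortX W x₁) +
        shortY W x₁ y₁) := by
  simp only [shortX, shortY, Affine.addY, Affine.negY, Affine.negAddY]; ring

lemma slope_short_of_ne [DecidableEq F] (W : WeierstrassCurve F) {x₁ x₂ : F} (y₁ y₂ : F)
    (h : x₁ ≠ x₂) :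
    W.toAffine.slope x₁ x₂ y₁ y₂ + W.a₁ / 2 =
      (shortY W x₁ y₁ - shortY W x₂ y₂) / (shortX W x₁ - shortX W x₂) := by
  have h' : x₁ - x₂ ≠ 0 := sub_ne_zero.mpr h
  have h'' : shortX W x₁ - shortX W x₂ = x₁ - x₂ := by simp only [shortX]; ring
  rw [Affine.slope_of_X_ne h, h'', eq_div_iff h', add_mul, div_mul_cancel₀ _ h']
  simp only [shortY]; ring

lemma slope_short_of_eq [DecidableEq F] (W : WeierstrassCurve F) {x y₁ y₂ : F}
    (h₁ : W.toAffine.Equation x y₁) (h₂ : W.toAffine.Equation x y₂)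
    (h : y₁ ≠ W.toAffine.negY x y₂) :
    W.toAffine.slope x x y₁ y₂ + W.a₁ / 2 =
      (3 * shortX W x ^ 2 - W.c₄ / 48) / (2 * shortY W x y₁) := by
  have hy : y₁ = y₂ := Affine.Y_eq_of_Y_ne h₁ h₂ rfl h
  subst hy
  have h' : 2 * shortY W x y₁ ≠ 0 := by
    intro h0
    apply h
    rw [eq_negY_iff]
    linear_combination h0
  have h'' : y₁ - W.toAffine.negY x y₁ = 2 * shortY W x y₁ := by
    simp only [shortY, Affine.negY]; ring
  rw [Affine.slope_of_Y_ne rfl h, h'', eq_div_iff h', add_mul, div_mul_cancel₀ _ h']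
  simp only [shortX, shortY, c₄, b₂, b₄]; ring

/-- Since 2 and 3 are invertible, `s`, `r`, `t` can be solved for so as to match `a₁`, `a₂`, `a₃`.
Then `c₄` and `c₆`, in which `a₄` and `a₆` occur with coefficients `-48` and `-864`, force the rest.
-/
lemma exists_smul_eq_iff_exists_scaling (W W' : WeierstrassCurve F) :
    (∃ c : VariableChange F, c • W = W') ↔ ∃ u, Scaling W W' u := by
  constructor
  · rintro ⟨c, rfl⟩
    exact ⟨(c.u⁻¹ : Fˣ), Units.ne_zero _, variableChange_c₄ W c, variableChange_c₆ W c⟩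
  · rintro ⟨u, h⟩
    have hu := h.1
    have h4 := h.2
    have h6 := h.3
    simp only [c₄, c₆, b₂, b₄, b₆] at h4 h6
    set s := (W'.a₁ / u - W.a₁) / 2 with hs
    set r := (W'.a₂ / u ^ 2 - W.a₂ + s * W.a₁ + s ^ 2) / 3 with hr
    set t := (W'.a₃ / u ^ 3 - W.a₃ - r * W.a₁) / 2 with ht
    have e1 : W'.a₁ = u * (W.a₁ + 2 * s) := by rw [hs]; field_simp; ring
    have e2 : W'.a₂ = u ^ 2 * (W.a₂ - s * W.a₁ + 3 * r - s ^ 2) := by rw [hr]; field_simp; ring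
    have e3 : W'.a₃ = u ^ 3 * (W.a₃ + r * W.a₁ + 2 * t) := by rw [ht]; field_simp; ring
    have e4 : W'.a₄ = u ^ 4 * (W.a₄ - s * W.a₃ + 2 * r * W.a₂ - (t + r * s) * W.a₁ + 3 * r ^ 2
      - 2 * s * t) := by
      rw [e1, e2, e3] at h4
      linear_combination (-1 / 48) * h4
    -- The inverse appears because a change of variables with unit `c.u` multiplies `c₄` by `c.u⁻⁴`.
    refine ⟨⟨(Units.mk0 u hu)⁻¹, r, s, t⟩, ?_⟩
    rw [variableChange_def]
    simp only [inv_inv, Units.val_mk0]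
    ext
    · exact e1.symm
    · exact e2.symm
    · exact e3.symm
    · exact e4.symm
    · rw [e1, e2, e3, e4] at h6
      dsimp only
      linear_combination (1 / 864) * h6

/-- The image of an `X`-coordinate under the isomorphism given by `Scaling W W' u`. -/
def scaleX (W W' : WeierstrassCurve F) (u x : F) : F := u ^ 2 * shortX W x - W'.b₂ / 12

/-- The image of a `Y`-coordinate under the isomorphism given by `Scaling W W' u`. -/
def scaleY (W W' : WeierstrassCurve F) (u x y : F) : F :=
  u ^ 3 * shortY W x y - (W'.a₁ * scaleX W W' u x + W'.a₃) / 2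

lemma shortX_scaleX (W W' : WeierstrassCurve F) (u x : F) :
    shortX W' (scaleX W W' u x) = u ^ 2 * shortX W x := by
  simp only [shortX, scaleX]; ring

lemma shortY_scaleY (W W' : WeierstrassCurve F) (u x y : F) :
    shortY W' (scaleX W W' u x) (scaleY W W' u x y) = u ^ 3 * shortY W x y := by
  simp only [shortY, scaleY]; ring

namespace Scaling

variable {W W' : WeierstrassCurve F} {u : F}

lemma scaleX_injective (h : Scaling W W' u) : Function.Injective (scaleX W W' u) := by
  intro x y hxy
  have := congrArg (shortX W') hxy
  rw [shortX_scaleX, shortX_scaleX] at this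
  exact shortX_injective W (mul_left_cancel₀ (pow_ne_zero 2 h.1) this)

lemma equation_iff (h : Scaling W W' u) (x y : F) :
    W'.toAffine.Equation (scaleX W W' u x) (scaleY W W' u x y) ↔ W.toAffine.Equation x y := by
  rw [equation_iff_short, equation_iff_short, shortX_scaleX, shortY_scaleY, h.2, h.3,
    ← (mul_right_injective₀ (pow_ne_zero 6 h.1)).eq_iff (a := shortY W x y ^ 2)]
  constructor <;> intro h <;> linear_combination h

lemma nonsingular (h : Scaling W W' u) {x y : F} (hxy : W.toAffine.Nonsingular x y) :
    W'.toAffine.Nonsingular (scaleX W W' u x) (scaleY W W' u x y) := by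
  rw [nonsingular_iff_short, h.equation_iff, shortX_scaleX, shortY_scaleY, h.2]
  rw [nonsingular_iff_short] at hxy
  refine ⟨hxy.1, hxy.2.imp (fun h' h0 => h' ?_) (mul_ne_zero (pow_ne_zero 3 h.1))⟩
  refine (mul_eq_zero.mp ?_).resolve_left (pow_ne_zero 4 h.1)
  linear_combination h0

lemma eq_negY_iff (h : Scaling W W' u) (x y₁ y₂ : F) :
    scaleY W W' u x y₁ = W'.toAffine.negY (scaleX W W' u x) (scaleY W W' u x y₂) ↔
      y₁ = W.toAffine.negY x y₂ := by
  rw [TwistCongruence.eq_negY_iff, TwistCongruence.eq_negY_iff, shortY_scaleY, shortY_scaleY,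
    ← mul_neg, (mul_right_injective₀ (pow_ne_zero 3 h.1)).eq_iff]

lemma slope [DecidableEq F] (h : Scaling W W' u) {x₁ x₂ y₁ y₂ : F}
    (h₁ : W.toAffine.Equation x₁ y₁) (h₂ : W.toAffine.Equation x₂ y₂)
    (hxy : ¬ (x₁ = x₂ ∧ y₁ = W.toAffine.negY x₂ y₂)) :
    W'.toAffine.slope (scaleX W W' u x₁) (scaleX W W' u x₂) (scaleY W W' u x₁ y₁)
      (scaleY W W' u x₂ y₂) + W'.a₁ / 2 = u * (W.toAffine.slope x₁ x₂ y₁ y₂ + W.a₁ / 2) := by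
  by_cases hx : x₁ = x₂
  · subst hx
    have hy : y₁ ≠ W.toAffine.negY x₁ y₂ := fun hy => hxy ⟨rfl, hy⟩
    rw [slope_short_of_eq W h₁ h₂ hy, slope_short_of_eq W' ((h.equation_iff _ _).mpr h₁)
      ((h.equation_iff _ _).mpr h₂) (by rwa [Ne, h.eq_negY_iff]), shortX_scaleX, shortY_scaleY, h.2]
    field_simp
  · have hx' : shortX W x₁ - shortX W x₂ ≠ 0 :=
      sub_ne_zero.mpr ((shortX_injective W).ne hx)
    rw [slope_short_of_ne W _ _ hx, slope_short_of_ne W' _ _ (h.scaleX_injective.ne hx),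
      shortX_scaleX, shortX_scaleX, shortY_scaleY, shortY_scaleY, ← mul_sub, ← mul_sub]
    field_simp

/-- The homomorphism on points given by a scaling. -/
noncomputable def pointHom [DecidableEq F] (h : Scaling W W' u) :
    W.toAffine.Point →+ W'.toAffine.Point where
  toFun P := match P with
    | 0 => 0
    | .some _ _ hP => .some _ _ (h.nonsingular hP)
  map_zero' := rfl
  map_add' := by
    rintro (_ | ⟨x₁, y₁, h₁⟩) (_ | ⟨x₂, y₂, h₂⟩)
    any_goals rfl
    by_cases hxy : x₁ = x₂ ∧ y₁ = W.toAffine.negY x₂ y₂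
    · obtain ⟨rfl, hy⟩ := hxy
      rw [Affine.Point.add_of_Y_eq rfl hy]
      exact (Affine.Point.add_of_Y_eq rfl ((h.eq_negY_iff _ _ _).mpr hy)).symm
    · have hxy' : ¬ (scaleX W W' u x₁ = scaleX W W' u x₂ ∧
          scaleY W W' u x₁ y₁ = W'.toAffine.negY (scaleX W W' u x₂) (scaleY W W' u x₂ y₂)) := by
        rintro ⟨h1, h2⟩
        obtain rfl := h.scaleX_injective h1
        exact hxy ⟨rfl, (h.eq_negY_iff _ _ _).mp h2⟩
      rw [Affine.Point.add_some hxy]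
      refine Eq.trans ?_ (Affine.Point.add_some hxy').symm
      have hX : scaleX W W' u (W.toAffine.addX x₁ x₂ (W.toAffine.slope x₁ x₂ y₁ y₂)) =
          W'.toAffine.addX (scaleX W W' u x₁) (scaleX W W' u x₂) (W'.toAffine.slope
            (scaleX W W' u x₁) (scaleX W W' u x₂) (scaleY W W' u x₁ y₁)
            (scaleY W W' u x₂ y₂)) := by
        apply shortX_injective W'
        rw [shortX_scaleX, shortX_addX, shortX_addX, h.slope h₁.1 h₂.1 hxy, shortX_scaleX,
          shortX_scaleX]
        ring
      have hY : scaleY W W' u (W.toAffine.addX x₁ x₂ (W.toAffine.slope x₁ x₂ y₁ y₂))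
          (W.toAffine.addY x₁ x₂ y₁ (W.toAffine.slope x₁ x₂ y₁ y₂)) =
          W'.toAffine.addY (scaleX W W' u x₁) (scaleX W W' u x₂) (scaleY W W' u x₁ y₁)
            (W'.toAffine.slope (scaleX W W' u x₁) (scaleX W W' u x₂) (scaleY W W' u x₁ y₁)
            (scaleY W W' u x₂ y₂)) := by
        apply shortY_injective W'
          (scaleX W W' u (W.toAffine.addX x₁ x₂ (W.toAffine.slope x₁ x₂ y₁ y₂)))
        rw [shortY_scaleY, shortY_addY, hX, shortY_addY, ← hX, h.slope h₁.1 h₂.1 hxy,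
          shortX_scaleX, shortX_scaleX, shortY_scaleY]
        ring
      exact (Affine.Point.some.injEq ..).mpr ⟨hX, hY⟩

lemma pointHom_pointHom [DecidableEq F] {W'' : WeierstrassCurve F} {v w : F} (h : Scaling W W' u)
    (h' : Scaling W' W'' v) (h'' : Scaling W W'' w) (hw : v * u = w) (P : W.toAffine.Point) :
    h'.pointHom (h.pointHom P) = h''.pointHom P := by
  subst hw
  rcases P with _ | ⟨x, y, hP⟩
  · rfl
  · have hX : scaleX W' W'' v (scaleX W W' u x) = scaleX W W'' (v * u) x := by
      apply shortX_injective W''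
      rw [shortX_scaleX, shortX_scaleX, shortX_scaleX]; ring
    refine (Affine.Point.some.injEq ..).mpr ⟨hX, ?_⟩
    apply shortY_injective W'' (scaleX W' W'' v (scaleX W W' u x))
    rw [shortY_scaleY, shortY_scaleY, hX, shortY_scaleY]; ring

lemma pointHom_one [DecidableEq F] (h : Scaling W W 1) (P : W.toAffine.Point) :
    h.pointHom P = P := by
  rcases P with _ | ⟨x, y, hP⟩
  · rfl
  · have hX : scaleX W W 1 x = x := by
      apply shortX_injective W
      rw [shortX_scaleX]; ring
    refine (Affine.Point.some.injEq ..).mpr ⟨hX, ?_⟩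
    apply shortY_injective W (scaleX W W 1 x)
    rw [shortY_scaleY, hX]; ring

lemma pointHom_neg_one [DecidableEq F] (h : Scaling W W (-1)) (P : W.toAffine.Point) :
    h.pointHom P = -P := by
  rcases P with _ | ⟨x, y, hP⟩
  · rfl
  · have hX : scaleX W W (-1) x = x := by
      apply shortX_injective W
      rw [shortX_scaleX]; ring
    refine (Affine.Point.some.injEq ..).mpr ⟨hX, ?_⟩
    apply shortY_injective W (scaleX W W (-1) x)
    rw [shortY_scaleY, hX, shortY_negY]; ring

end Scaling

end Scaling

/-! ### Scalings on `p`-torsion, the twisting cocycle and congruences as matrices -/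

section TorsionScaling

variable {K : Type*} [Field K] [CharZero K]

local notation "Ω" => AlgebraicClosure K

omit [CharZero K] in
lemma baseChange_c₄ (L : Type*) [Field L] [Algebra K L] (E : WeierstrassCurve K) :
    (E.baseChange L).c₄ = algebraMap K L E.c₄ := map_c₄ _ _

omit [CharZero K] in
lemma baseChange_c₆ (L : Type*) [Field L] [Algebra K L] (E : WeierstrassCurve K) :
    (E.baseChange L).c₆ = algebraMap K L E.c₆ := map_c₆ _ _

omit [CharZero K] in
lemma baseChange_b₂ (L : Type*) [Field L] [Algebra K L] (E : WeierstrassCurve K) :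
    (E.baseChange L).b₂ = algebraMap K L E.b₂ := map_b₂ _ _

omit [CharZero K] in
lemma Scaling.galois {E E' : WeierstrassCurve K} {u : Ω}
    (h : Scaling (E.baseChange Ω) (E'.baseChange Ω) u) (σ : Ω ≃ₐ[K] Ω) :
    Scaling (E.baseChange Ω) (E'.baseChange Ω) (σ u) := by
  refine ⟨by simpa using h.1, ?_, ?_⟩
  · have := congrArg σ h.2
    simpa only [baseChange_c₄, map_mul, map_pow, AlgEquiv.commutes] using this
  · have := congrArg σ h.3
    simpa only [baseChange_c₆, map_mul, map_pow, AlgEquiv.commutes] using this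

-- The base field is left free: besides the base field of the twist problem it is later taken to be
-- `ℚ`, with an automorphism that need not fix the number field.
omit [CharZero K] in
lemma Scaling.map_pointHom {F : Type*} [Field F] [DecidableEq F] [CharZero F] [Algebra K F]
    {E E' : WeierstrassCurve K} {u v : F} (h : Scaling (E.baseChange F) (E'.baseChange F) u)
    (τ : F ≃ₐ[K] F) (h' : Scaling (E.baseChange F) (E'.baseChange F) v) (hv : τ u = v)
    (P : (E.baseChange F).toAffine.Point) :
    Affine.Point.map (W' := E'.toAffine) (τ : F →ₐ[K] F) (h.pointHom P) =
      h'.pointHom (Affine.Point.map (W' := E.toAffine) (τ : F →ₐ[K] F) P) := by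
  subst hv
  rcases P with _ | ⟨x, y, hP⟩
  · rfl
  · refine (Affine.Point.some.injEq ..).mpr ?_
    have e₁ : τ 12 = 12 := map_ofNat τ 12
    have e₂ : τ 2 = 2 := map_ofNat τ 2
    simp [scaleX, scaleY, shortX, shortY, baseChange_b₂, e₁, e₂]

open scoped Classical in
/-- The homomorphism on `p`-torsion given by a scaling over the algebraic closure. -/
noncomputable def torsionHom (p : ℕ) {E E' : WeierstrassCurve K} {u : Ω}
    (h : Scaling (E.baseChange Ω) (E'.baseChange Ω) u) : Torsion E p →+ Torsion E' p :=
  (h.pointHom.comp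
    (AddSubgroup.torsionBy (E.baseChange Ω).toAffine.Point (p : ℤ)).subtype).codRestrict
    (AddSubgroup.torsionBy (E'.baseChange Ω).toAffine.Point (p : ℤ))
    (fun x => AddSubgroup.torsionBy.nsmul_iff.mpr (by
      rw [← map_nsmul, AddSubgroup.torsionBy.nsmul, map_zero]))

variable {p : ℕ} {E E' E'' : WeierstrassCurve K} {u v w : AlgebraicClosure K}

open scoped Classical in
lemma torsionHom_torsionHom (h : Scaling (E.baseChange Ω) (E'.baseChange Ω) u)
    (h' : Scaling (E'.baseChange Ω) (E''.baseChange Ω) v)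
    (h'' : Scaling (E.baseChange Ω) (E''.baseChange Ω) w) (hw : v * u = w) (P : Torsion E p) :
    torsionHom p h' (torsionHom p h P) = torsionHom p h'' P :=
  Subtype.ext (h.pointHom_pointHom h' h'' hw P.1)

open scoped Classical in
lemma torsionHom_one (h : Scaling (E.baseChange Ω) (E.baseChange Ω) u) (hu : u = 1)
    (P : Torsion E p) : torsionHom p h P = P := by
  subst hu
  exact Subtype.ext (h.pointHom_one P.1)

open scoped Classical in
lemma torsionHom_neg_one (h : Scaling (E.baseChange Ω) (E.baseChange Ω) u) (hu : u = -1)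
    (P : Torsion E p) : torsionHom p h P = -P := by
  subst hu
  exact Subtype.ext (h.pointHom_neg_one P.1)

open scoped Classical in
lemma galoisRep_torsionHom (h : Scaling (E.baseChange Ω) (E'.baseChange Ω) u)
    (σ : Ω ≃ₐ[K] Ω) (P : Torsion E p) :
    galoisRep E' p σ (torsionHom p h P) = torsionHom p (h.galois σ) (galoisRep E p σ P) :=
  Subtype.ext (h.map_pointHom σ (h.galois σ) rfl P.1)

/-- The isomorphism on `p`-torsion given by a scaling over the algebraic closure. -/
noncomputable def torsionEquiv (p : ℕ) (h : Scaling (E.baseChange Ω) (E'.baseChange Ω) u) :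
    Torsion E p ≃+ Torsion E' p where
  __ := torsionHom p h
  invFun := torsionHom p h.inv
  left_inv P := by
    have hu := h.1
    refine (torsionHom_torsionHom h h.inv (Scaling.one _) (by field_simp) P).trans ?_
    exact torsionHom_one _ rfl P
  right_inv P := by
    have hu := h.1
    refine (torsionHom_torsionHom h.inv h (Scaling.one _) (by field_simp) P).trans ?_
    exact torsionHom_one _ rfl P

lemma torsionEquiv_apply (h : Scaling (E.baseChange Ω) (E'.baseChange Ω) u) (P : Torsion E p) :
    torsionEquiv p h P = torsionHom p h P := rfl

-- This automorphism of `E` measures how far the isomorphism `u` is from commuting with `σ`.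
omit [CharZero K] in
lemma Scaling.cocycle (h : Scaling (E.baseChange Ω) (E'.baseChange Ω) u) (σ : Ω ≃ₐ[K] Ω) :
    Scaling (E.baseChange Ω) (E.baseChange Ω) (u⁻¹ * σ u) :=
  (h.galois σ).mul h.inv

variable [Fact p.Prime]

/-- The matrix in the basis `b` of the automorphism of `E[p]` given by a scaling of `E`. -/
noncomputable def autMatrix (b : Module.Basis (Fin 2) (ZMod p) (Torsion E p))
    (h : Scaling (E.baseChange Ω) (E.baseChange Ω) u) : Matrix (Fin 2) (Fin 2) (ZMod p) :=
  LinearMap.toMatrixAlgEquiv b ((torsionHom p h).toZModLinearMap p)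

variable (b : Module.Basis (Fin 2) (ZMod p) (Torsion E p))

omit [CharZero K] in
lemma val_rhoBar (σ : Ω ≃ₐ[K] Ω) :
    (rhoBar E p b σ).val = LinearMap.toMatrixAlgEquiv b (galoisRep E p σ) := rfl

lemma autMatrix_mul (h : Scaling (E.baseChange Ω) (E.baseChange Ω) u)
    (h' : Scaling (E.baseChange Ω) (E.baseChange Ω) v)
    (h'' : Scaling (E.baseChange Ω) (E.baseChange Ω) w) (hw : v * u = w) :
    autMatrix b h' * autMatrix b h = autMatrix b h'' := by
  rw [autMatrix, autMatrix, autMatrix, ← map_mul]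
  congr 1
  ext P : 1
  exact torsionHom_torsionHom h h' h'' hw P

lemma autMatrix_one (h : Scaling (E.baseChange Ω) (E.baseChange Ω) u) (hu : u = 1) :
    autMatrix b h = 1 := by
  rw [autMatrix, ← map_one (LinearMap.toMatrixAlgEquiv b)]
  congr 1
  ext P : 1
  exact torsionHom_one h hu P

lemma autMatrix_neg_one (h : Scaling (E.baseChange Ω) (E.baseChange Ω) u) (hu : u = -1) :
    autMatrix b h = -1 := by
  rw [autMatrix, ← map_one (LinearMap.toMatrixAlgEquiv b), ← map_neg]
  congr 1
  ext P : 1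
  exact torsionHom_neg_one h hu P

lemma rhoBar_mul_autMatrix (h : Scaling (E.baseChange Ω) (E.baseChange Ω) u)
    (h' : Scaling (E.baseChange Ω) (E.baseChange Ω) v) (σ : Ω ≃ₐ[K] Ω) (hv : σ u = v) :
    (rhoBar E p b σ).val * autMatrix b h = autMatrix b h' * (rhoBar E p b σ).val := by
  subst hv
  rw [autMatrix, autMatrix, val_rhoBar, ← map_mul, ← map_mul]
  congr 1
  ext P : 1
  exact galoisRep_torsionHom h σ P

/-- Pulled back to `E[p]` along the scaling, the Galois action of `E'` is that of `E` multiplied by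
the cocycle. The matrix `A` is the congruence read through this identification. -/
lemma congruent_iff_of_scaling (h : Scaling (E.baseChange Ω) (E'.baseChange Ω) u) :
    Congruent p E E' ↔ ∃ A : GL (Fin 2) (ZMod p), ∀ σ : Ω ≃ₐ[K] Ω,
      A.val * (rhoBar E p b σ).val =
        autMatrix b (h.cocycle σ) * ((rhoBar E p b σ).val * A.val) := by
  have key (σ : Ω ≃ₐ[K] Ω) (P : Torsion E p) :
      (torsionEquiv p h).symm (galoisRep E' p σ (torsionEquiv p h P)) =
        torsionHom p (h.cocycle σ) (galoisRep E p σ P) := by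
    rw [torsionEquiv_apply, galoisRep_torsionHom]
    exact torsionHom_torsionHom _ _ _ rfl _
  constructor
  · rintro ⟨φ, hφ⟩
    let α : Torsion E p ≃+ Torsion E p := φ.trans (torsionEquiv p h).symm
    have hα (σ : Ω ≃ₐ[K] Ω) (P : Torsion E p) :
        α (galoisRep E p σ P) = torsionHom p (h.cocycle σ) (galoisRep E p σ (α P)) := by
      rw [← key]
      simp [α, hφ]
    let l : Torsion E p →ₗ[ZMod p] Torsion E p := α.toAddMonoidHom.toZModLinearMap p
    let l' : Torsion E p →ₗ[ZMod p] Torsion E p := α.symm.toAddMonoidHom.toZModLinearMap p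
    have h1 : l * l' = 1 := by
      ext P : 1
      exact α.apply_symm_apply P
    have h2 : l' * l = 1 := by
      ext P : 1
      exact α.symm_apply_apply P
    refine ⟨⟨LinearMap.toMatrixAlgEquiv b l, LinearMap.toMatrixAlgEquiv b l',
      by rw [← map_mul, h1, map_one], by rw [← map_mul, h2, map_one]⟩, fun σ => ?_⟩
    change LinearMap.toMatrixAlgEquiv b l * _ = _ * (_ * LinearMap.toMatrixAlgEquiv b l)
    rw [autMatrix, val_rhoBar, ← map_mul, ← map_mul, ← map_mul]
    congr 1
    ext P : 1
    exact hα σ P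
  · rintro ⟨A, hA⟩
    let f := (LinearMap.toMatrixAlgEquiv b).symm
    let α : Torsion E p ≃+ Torsion E p :=
      { toFun := f A.val
        invFun := f A.inv
        left_inv := fun P => by
          change (f A.inv * f A.val) P = P
          rw [← map_mul, A.inv_val, map_one]; rfl
        right_inv := fun P => by
          change (f A.val * f A.inv) P = P
          rw [← map_mul, A.val_inv, map_one]; rfl
        map_add' := map_add _ }
    refine ⟨α.trans (torsionEquiv p h), fun σ P => ?_⟩
    have h1 : f A.val * galoisRep E p σ =
        (torsionHom p (h.cocycle σ)).toZModLinearMap p * (galoisRep E p σ * f A.val) := by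
      apply (LinearMap.toMatrixAlgEquiv b).injective
      simp only [map_mul]
      simp only [f, AlgEquiv.apply_symm_apply]
      exact hA σ
    have h2 : α (galoisRep E p σ P) =
        torsionHom p (h.cocycle σ) (galoisRep E p σ (α P)) := LinearMap.congr_fun h1 P
    rw [← key] at h2
    rw [AddEquiv.trans_apply, AddEquiv.trans_apply, h2, AddEquiv.apply_symm_apply]

end TorsionScaling

/-! ### Invertible trace-zero matrices: commuting and anticommuting -/

section TracelessMatrices

variable {F : Type*} [Field F]

/-- Invertible `2 × 2`-matrices of trace zero. -/
structure Traceless (γ : Matrix (Fin 2) (Fin 2) F) : Prop where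
  trace_eq : γ 1 1 = -γ 0 0
  det_ne : γ.det ≠ 0

/-- Every element of `G` commutes or anticommutes with `γ`. -/
def SignCommutes (G : Subgroup (GL (Fin 2) F)) (γ : Matrix (Fin 2) (Fin 2) F) : Prop :=
  ∀ g ∈ G, g.val * γ = γ * g.val ∨ g.val * γ = -(γ * g.val)

omit [Field F] in
lemma matrix_eq_iff (x y : Matrix (Fin 2) (Fin 2) F) :
    x = y ↔ (x 0 0 = y 0 0 ∧ x 0 1 = y 0 1) ∧ x 1 0 = y 1 0 ∧ x 1 1 = y 1 1 := by
  simp [← Matrix.ext_iff, Fin.forall_fin_two]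

lemma matrix_mul_self (x : Matrix (Fin 2) (Fin 2) F) :
    x * x = (x 0 0 + x 1 1) • x - x.det • (1 : Matrix (Fin 2) (Fin 2) F) := by
  simp only [matrix_eq_iff, Matrix.mul_apply, Fin.sum_univ_two, Matrix.det_fin_two,
    Matrix.sub_apply, Matrix.smul_apply, smul_eq_mul, Matrix.one_apply]
  refine ⟨⟨?_, ?_⟩, ?_, ?_⟩ <;> simp <;> ring

namespace Traceless

variable {γ : Matrix (Fin 2) (Fin 2) F}

lemma mul_self (hγ : Traceless γ) : γ * γ = -γ.det • (1 : Matrix (Fin 2) (Fin 2) F) := by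
  rw [matrix_mul_self, hγ.1]; simp

lemma isUnit (hγ : Traceless γ) : IsUnit γ :=
  (Matrix.isUnit_iff_isUnit_det γ).mpr hγ.2.isUnit

lemma det_eq (hγ : Traceless γ) : γ.det = -(γ 0 0 ^ 2 + γ 0 1 * γ 1 0) := by
  rw [Matrix.det_fin_two, hγ.1]; ring

lemma smul (hγ : Traceless γ) {c : F} (hc : c ≠ 0) : Traceless (c • γ) := by
  refine ⟨by simp [hγ.1], ?_⟩
  rw [Matrix.det_smul]
  exact mul_ne_zero (pow_ne_zero _ hc) hγ.2

lemma commute_iff (h2 : (2 : F) ≠ 0) (hγ : Traceless γ) (x : Matrix (Fin 2) (Fin 2) F) :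
    x * γ = γ * x ↔ ∃ a b : F, x = a • 1 + b • γ := by
  constructor
  · intro h
    have hd : γ 0 0 ^ 2 + γ 0 1 * γ 1 0 ≠ 0 := fun h0 => hγ.2 (by rw [hγ.det_eq, h0, neg_zero])
    have h11 := hγ.1
    simp only [matrix_eq_iff, Matrix.mul_apply, Fin.sum_univ_two] at h
    obtain ⟨⟨h₁, h₂⟩, h₃, h₄⟩ := h
    rw [h11] at h₂ h₃ h₄
    have hd' : 2 * (γ 0 0 ^ 2 + γ 0 1 * γ 1 0) ≠ 0 := mul_ne_zero h2 hd
    -- The coefficients are `α = tr(x)/2` and `β = tr(xγ)/tr(γ²)`.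
    obtain ⟨α, hα⟩ : ∃ α, α * 2 = x 0 0 + x 1 1 := ⟨_, div_mul_cancel₀ _ h2⟩
    obtain ⟨β, hβ⟩ : ∃ β, β * (2 * (γ 0 0 ^ 2 + γ 0 1 * γ 1 0)) =
        x 0 0 * γ 0 0 + x 0 1 * γ 1 0 + x 1 0 * γ 0 1 - x 1 1 * γ 0 0 :=
      ⟨_, div_mul_cancel₀ _ hd'⟩
    refine ⟨α, β, ?_⟩
    simp only [matrix_eq_iff, Matrix.add_apply, Matrix.smul_apply, smul_eq_mul, h11]
    refine ⟨⟨?_, ?_⟩, ?_, ?_⟩ <;> simp <;> apply mul_left_cancel₀ hd'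
    · linear_combination -γ 0 1 * h₃ - γ 0 0 * h₁ - γ 0 0 * hβ -
        (γ 0 0 ^ 2 + γ 0 1 * γ 1 0) * hα
    · linear_combination -γ 0 0 * h₂ + γ 0 1 * h₁ - γ 0 1 * hβ
    · linear_combination γ 0 0 * h₃ - γ 1 0 * h₁ - γ 1 0 * hβ
    · linear_combination γ 0 0 * h₁ + γ 0 1 * h₃ + γ 0 0 * hβ -
        (γ 0 0 ^ 2 + γ 0 1 * γ 1 0) * hα
  · rintro ⟨a, b, rfl⟩
    simp [add_mul, mul_add]

lemma not_commute_of_anticommute (h2 : (2 : F) ≠ 0) (hγ : Traceless γ) {g : GL (Fin 2) F}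
    (h : g.val * γ = -(γ * g.val)) : g.val * γ ≠ γ * g.val := by
  intro h'
  rw [h'] at h
  have h0 : (2 : F) • (γ * g.val) = 0 := by
    rw [two_smul]; nth_rewrite 1 [h]; simp
  have h3 := (smul_eq_zero.mp h0).resolve_left h2
  exact (hγ.isUnit.mul g.isUnit).ne_zero h3

/-- Conjugation by `γ` negates `g`, hence also its trace, while preserving it. -/
lemma traceless_of_anticommute (h2 : (2 : F) ≠ 0) (hγ : Traceless γ) {g : GL (Fin 2) F}
    (h : g.val * γ = -(γ * g.val)) : Traceless g.val := by
  refine ⟨?_, ((Matrix.isUnit_iff_isUnit_det _).mp g.isUnit).ne_zero⟩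
  have hd : γ 0 0 ^ 2 + γ 0 1 * γ 1 0 ≠ 0 := fun h0 => hγ.2 (by rw [hγ.det_eq, h0, neg_zero])
  simp only [matrix_eq_iff, Matrix.mul_apply, Fin.sum_univ_two, Matrix.neg_apply] at h
  obtain ⟨⟨h₁, h₂⟩, h₃, h₄⟩ := h
  rw [hγ.1] at h₂ h₃ h₄
  have : (γ 0 0 ^ 2 + γ 0 1 * γ 1 0) * (2 * (g.val 1 1 + g.val 0 0)) = 0 := by
    linear_combination γ 0 0 * h₁ - γ 0 0 * h₄ + γ 0 1 * h₃ + γ 1 0 * h₂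
  have h3 := (mul_eq_zero.mp ((mul_eq_zero.mp this).resolve_left hd)).resolve_left h2
  linear_combination h3

end Traceless

/-- Anticommuting with `A` implies commuting with `A² = tr(A)A - det(A)`. If `tr(A) ≠ 0`, then `g`
would commute with `A` as well, giving `2Ag = 0`. -/
lemma traceless_of_anticommute_right (h2 : (2 : F) ≠ 0)
    {A g : GL (Fin 2) F} (h : g.val * A.val = -(A.val * g.val)) : Traceless A.val := by
  refine ⟨?_, ((Matrix.isUnit_iff_isUnit_det _).mp A.isUnit).ne_zero⟩
  by_contra ht
  have ht' : A.val 0 0 + A.val 1 1 ≠ 0 := fun h0 => ht (by linear_combination h0)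
  have h1 : g.val * (A.val * A.val) = (A.val * A.val) * g.val := by
    rw [← mul_assoc, h, neg_mul, mul_assoc, h, mul_neg, neg_neg, mul_assoc]
  rw [matrix_mul_self, mul_sub, sub_mul, mul_smul_comm, mul_smul_comm, smul_mul_assoc,
    smul_mul_assoc, mul_one, one_mul, sub_left_inj] at h1
  have h3 := smul_right_injective _ ht' h1
  rw [h3] at h
  have h0 : (2 : F) • (A.val * g.val) = 0 := by
    rw [two_smul]; nth_rewrite 1 [h]; simp
  exact (A.isUnit.mul g.isUnit).ne_zero ((smul_eq_zero.mp h0).resolve_left h2)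

end TracelessMatrices
-- Cartan subgroups as centralisers, and their normalisers
section Cartan

variable {F : Type*} [Field F]

/-- The subgroup of `GL₂(F)` of the elements that commute with `γ`. -/
def commutant (γ : Matrix (Fin 2) (Fin 2) F) : Subgroup (GL (Fin 2) F) where
  carrier := {x | x.val * γ = γ * x.val}
  one_mem' := by simp
  mul_mem' {x y} hx hy := by
    simp only [Set.mem_ofPred_eq, Units.val_mul] at *
    rw [mul_assoc, hy, ← mul_assoc, hx, mul_assoc]
  inv_mem' {x} hx := by
    simp only [Set.mem_ofPred_eq] at *
    calc x⁻¹.val * γ = x⁻¹.val * (γ * x.val) * x⁻¹.val := by rw [mul_assoc, mul_assoc]; simp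
      _ = γ * x⁻¹.val := by rw [← hx, ← mul_assoc]; simp

lemma mem_commutant {γ : Matrix (Fin 2) (Fin 2) F} {x : GL (Fin 2) F} :
    x ∈ commutant γ ↔ x.val * γ = γ * x.val := Iff.rfl

lemma mem_commutant_iff_of_conj {γ δ : Matrix (Fin 2) (Fin 2) F} {g : GL (Fin 2) F}
    (h : γ * g.val = g.val * δ) (x : GL (Fin 2) F) :
    x ∈ commutant γ ↔ g⁻¹ * x * g ∈ commutant δ := by
  have h' : δ * g⁻¹.val = g⁻¹.val * γ := by
    calc δ * g⁻¹.val = g⁻¹.val * (g.val * δ) * g⁻¹.val := by rw [Units.inv_mul_cancel_left]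
      _ = g⁻¹.val * γ := by rw [← h, mul_assoc, mul_assoc, Units.mul_inv, mul_one]
  have h₁ : (g⁻¹ * x * g).val * δ = g⁻¹.val * ((x.val * γ) * g.val) := by
    simp only [Units.val_mul, mul_assoc, h]
  have h₂ : δ * (g⁻¹ * x * g).val = g⁻¹.val * ((γ * x.val) * g.val) := by
    simp only [Units.val_mul, ← mul_assoc, h']
  rw [mem_commutant, mem_commutant, h₁, h₂, g⁻¹.isUnit.mul_right_inj, g.isUnit.mul_left_inj]

lemma mem_commutant_split (h2 : (2 : F) ≠ 0) {s : F} (hs : s ≠ 0) (y : GL (Fin 2) F) :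
    y ∈ commutant !![s, 0; 0, -s] ↔ y.val 0 1 = 0 ∧ y.val 1 0 = 0 := by
  simp only [mem_commutant, matrix_eq_iff, Matrix.mul_apply, Fin.sum_univ_two]
  simp
  constructor
  · rintro ⟨⟨-, h₁⟩, h₂, -⟩
    have hs' : s * 2 ≠ 0 := mul_ne_zero hs h2
    exact ⟨mul_left_cancel₀ hs' (by linear_combination -h₁),
      mul_left_cancel₀ hs' (by linear_combination h₂)⟩
  · rintro ⟨h₁, h₂⟩
    rw [h₁, h₂]
    refine ⟨⟨?_, ?_⟩, ?_, ?_⟩ <;> ring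

lemma mem_commutant_nonsplit (ε : F) (y : GL (Fin 2) F) :
    y ∈ commutant !![0, ε; 1, 0] ↔ y.val 0 0 = y.val 1 1 ∧ y.val 0 1 = ε * y.val 1 0 := by
  simp only [mem_commutant, matrix_eq_iff, Matrix.mul_apply, Fin.sum_univ_two]
  simp
  constructor
  · rintro ⟨⟨h₁, -⟩, h₂, -⟩
    exact ⟨h₂.symm, h₁⟩
  · rintro ⟨h₁, h₂⟩
    rw [h₁, h₂]
    refine ⟨⟨?_, ?_⟩, ?_, ?_⟩ <;> ring

namespace Traceless

variable {γ : Matrix (Fin 2) (Fin 2) F}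

lemma conj (hγ : Traceless γ) (g : GL (Fin 2) F) : Traceless (g.val * γ * g⁻¹.val) := by
  refine ⟨?_, ?_⟩
  · have h : (g.val * γ * g⁻¹.val).trace = γ.trace := Matrix.trace_units_conj g γ
    rw [Matrix.trace_fin_two, Matrix.trace_fin_two, hγ.1] at h
    linear_combination h
  · rw [show (g.val * γ * g⁻¹.val).det = γ.det from Matrix.det_units_conj g γ]
    exact hγ.2

/-- In a basis `(v, γv)` the matrix of `γ` is the companion matrix of `T² + det γ`. -/
lemma exists_cyclic (h2 : (2 : F) ≠ 0) (hγ : Traceless γ) : ∃ g : GL (Fin 2) F,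
    γ * g.val = g.val * !![0, -γ.det; 1, 0] := by
  -- The expression is `det(v, γv)` for `v = (x, y)`, a quadratic form whose values at `(1,0)`,
  -- `(0,1)`, `(1,1)` determine `γ`.
  obtain ⟨x, y, h⟩ : ∃ x y : F, x * (γ 1 0 * x - γ 0 0 * y) - (γ 0 0 * x + γ 0 1 * y) * y ≠ 0 := by
    by_contra! h
    have h₁ := h 1 0
    have h₃ := h 0 1
    have h₄ := h 1 1
    have : γ 1 0 = 0 := by linear_combination h₁
    have h' : γ 0 1 = 0 := by linear_combination -h₃
    have : γ 0 0 = 0 := by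
      apply mul_left_cancel₀ h2
      linear_combination -h₄ + h₁ + h₃
    exact hγ.2 (by rw [hγ.det_eq, this, h']; ring)
  refine ⟨Matrix.GeneralLinearGroup.mkOfDetNeZero
    !![x, γ 0 0 * x + γ 0 1 * y; y, γ 1 0 * x - γ 0 0 * y] (by
      rw [Matrix.det_fin_two_of]; exact h), ?_⟩
  have h11 := hγ.1
  have hd := hγ.det_eq
  change γ * !![x, γ 0 0 * x + γ 0 1 * y; y, γ 1 0 * x - γ 0 0 * y] =
    !![x, γ 0 0 * x + γ 0 1 * y; y, γ 1 0 * x - γ 0 0 * y] * _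
  simp only [matrix_eq_iff, Matrix.mul_apply, Fin.sum_univ_two]
  refine ⟨⟨?_, ?_⟩, ?_, ?_⟩ <;> simp [h11, hd] <;> ring

/-- A normalising `g` conjugates `γ` to some `a + bγ`; the trace gives `a = 0` and the determinant
gives `b² = 1`. Conversely `γ` and `-γ` have the same centraliser. -/
lemma signCommutes_iff (h2 : (2 : F) ≠ 0) (hγ : Traceless γ) (G : Subgroup (GL (Fin 2) F)) :
    G ≤ Subgroup.normalizer (commutant γ : Set (GL (Fin 2) F)) ↔ SignCommutes G γ := by
  obtain ⟨Γ, rfl⟩ := hγ.isUnit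
  have mem (x : GL (Fin 2) F) : x ∈ commutant Γ.val ↔ x * Γ = Γ * x := by
    rw [mem_commutant, ← Units.val_mul, ← Units.val_mul, Units.val_inj]
  constructor
  · intro h g hg
    have h' := (Subgroup.mem_normalizer_iff.mp (h hg) Γ).mp (mem_commutant.mpr rfl)
    rw [mem_commutant, hγ.commute_iff h2] at h'
    obtain ⟨a, b, hab⟩ := h'
    simp only [Units.val_mul] at hab
    have hc := hγ.conj g
    have ha : a = 0 := by
      have h1 := hc.1
      rw [hab] at h1
      simp only [Matrix.add_apply, Matrix.smul_apply, Matrix.one_apply_eq, smul_eq_mul, hγ.1] at h1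
      apply mul_left_cancel₀ h2
      linear_combination h1
    rw [ha, zero_smul, zero_add] at hab
    have hd : (g.val * Γ.val * g⁻¹.val).det = Γ.val.det := Matrix.det_units_conj g Γ.val
    rw [hab, Matrix.det_smul, Fintype.card_fin] at hd
    have hb : b ^ 2 = 1 ^ 2 := mul_right_cancel₀ hγ.2 (by rw [hd, one_pow, one_mul])
    have hg' : g.val * Γ.val = b • (Γ.val * g.val) := by
      rw [← smul_mul_assoc, ← hab, mul_assoc _ g⁻¹.val, Units.inv_mul, mul_one]
    rcases sq_eq_sq_iff_eq_or_eq_neg.mp hb with rfl | rfl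
    · exact Or.inl (by rw [hg', one_smul])
    · exact Or.inr (by rw [hg', neg_smul, one_smul])
  · intro h g hg
    rw [Subgroup.mem_normalizer_iff]
    intro x
    rw [mem, mem]
    have key : g * Γ = Γ * g ∨ g * Γ = (-Γ) * g := by
      rcases h g hg with h | h
      · exact Or.inl (Units.ext h)
      · exact Or.inr (Units.ext (by simpa using h))
    rcases key with h | h
    · have h' : Γ = g * Γ * g⁻¹ := by rw [h]; group
      constructor
      · intro hx
        rw [h']
        calc g * x * g⁻¹ * (g * Γ * g⁻¹) = g * (x * Γ) * g⁻¹ := by group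
          _ = _ := by rw [hx]; group
      · intro hx
        rw [h'] at hx
        have : g * (x * Γ) * g⁻¹ = g * (Γ * x) * g⁻¹ := by
          calc _ = g * x * g⁻¹ * (g * Γ * g⁻¹) := by group
            _ = _ := by rw [hx]; group
        exact mul_left_cancel (mul_right_cancel this)
    · have h' : -Γ = g * Γ * g⁻¹ := by rw [h]; group
      have h'' : g * x * g⁻¹ * Γ = Γ * (g * x * g⁻¹) ↔
          g * x * g⁻¹ * -Γ = -Γ * (g * x * g⁻¹) := by
        rw [mul_neg, neg_mul, neg_inj]
      rw [h'']
      constructor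
      · intro hx
        rw [h']
        calc g * x * g⁻¹ * (g * Γ * g⁻¹) = g * (x * Γ) * g⁻¹ := by group
          _ = _ := by rw [hx]; group
      · intro hx
        rw [h'] at hx
        have : g * (x * Γ) * g⁻¹ = g * (Γ * x) * g⁻¹ := by
          calc _ = g * x * g⁻¹ * (g * Γ * g⁻¹) := by group
            _ = _ := by rw [hx]; group
        exact mul_left_cancel (mul_right_cancel this)

end Traceless

end Cartan

/-! ### Comparison with the split and non-split Cartan subgroups over `𝔽_p` -/

section CartanZMod

variable {p : ℕ} [Fact p.Prime]

lemma two_ne_zero_of_ne_two (hp : p ≠ 2) : (2 : ZMod p) ≠ 0 := by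
  intro h
  have : (p : ℕ) ∣ 2 := (ZMod.natCast_eq_zero_iff 2 p).mp (by exact_mod_cast h)
  exact hp ((Nat.prime_dvd_prime_iff_eq Fact.out Nat.prime_two).mp this)

/-- Since `γ² = -det γ`, the type is split or non-split according to whether `-det γ` is a square.
-/
lemma isCartan_commutant (hp : p ≠ 2) {γ : Matrix (Fin 2) (Fin 2) (ZMod p)} (hγ : Traceless γ) :
    IsCartan (commutant γ) := by
  have h2 := two_ne_zero_of_ne_two hp
  obtain ⟨g, hg⟩ := hγ.exists_cyclic h2
  have hε : -γ.det ≠ 0 := neg_ne_zero.mpr hγ.2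
  by_cases hsq : IsSquare (-γ.det)
  · obtain ⟨s, hs⟩ := hsq
    have hs0 : s ≠ 0 := by
      rintro rfl
      exact hε (by rw [hs, mul_zero])
    left
    -- The columns are eigenvectors of the companion matrix for the eigenvalues `s` and `-s`.
    let Q : GL (Fin 2) (ZMod p) := Matrix.GeneralLinearGroup.mkOfDetNeZero !![s, -s; 1, 1] (by
      rw [Matrix.det_fin_two_of]
      intro h
      exact mul_ne_zero h2 hs0 (by linear_combination h))
    have hQ : !![0, -γ.det; 1, 0] * Q.val = Q.val * !![s, 0; 0, -s] := by
      change !![0, -γ.det; 1, 0] * !![s, -s; 1, 1] = !![s, -s; 1, 1] * _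
      rw [hs]
      simp
    refine ⟨g * Q, fun x => ?_⟩
    rw [← mem_commutant_split h2 hs0]
    refine mem_commutant_iff_of_conj ?_ x
    rw [Units.val_mul, ← mul_assoc, hg, mul_assoc, hQ, mul_assoc]
  · right
    exact ⟨g, -γ.det, hsq, fun x => by
      rw [← mem_commutant_nonsplit]; exact mem_commutant_iff_of_conj hg x⟩

lemma exists_eq_commutant_of_isCartan (hp : p ≠ 2) {C : Subgroup (GL (Fin 2) (ZMod p))}
    (hC : IsCartan C) : ∃ γ, Traceless γ ∧ C = commutant γ := by
  have h2 := two_ne_zero_of_ne_two hp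
  rcases hC with ⟨g, hg⟩ | ⟨g, ε, hε, hg⟩
  · have ht : Traceless (!![1, 0; 0, -1] : Matrix (Fin 2) (Fin 2) (ZMod p)) :=
      ⟨by simp, by simp⟩
    refine ⟨_, ht.conj g, ?_⟩
    ext x
    rw [hg, ← mem_commutant_split h2 one_ne_zero]
    refine (mem_commutant_iff_of_conj ?_ x).symm
    rw [mul_assoc, Units.inv_mul, mul_one]
  · have hε0 : ε ≠ 0 := by
      rintro rfl
      exact hε (IsSquare.zero)
    have ht : Traceless (!![0, ε; 1, 0] : Matrix (Fin 2) (Fin 2) (ZMod p)) :=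
      ⟨by simp, by simpa using hε0⟩
    refine ⟨_, ht.conj g, ?_⟩
    ext x
    rw [hg, ← mem_commutant_nonsplit]
    refine (mem_commutant_iff_of_conj ?_ x).symm
    rw [mul_assoc, Units.inv_mul, mul_one]

end CartanZMod
-- The rotations are the powers of `r`, indexed through `ZMod (orderOf r)`. Infinite order is
-- included: `orderOf r = 0` then gives the infinite dihedral group.
lemma nonempty_mulEquiv_dihedralGroup {P : Type*} [Group P] (r s : P)
    (hs : s * s = 1) (hsr : s * r * s = r⁻¹) (hns : s ∉ Subgroup.zpowers r)
    (hall : ∀ x, x ∈ Subgroup.zpowers r ∨ s * x ∈ Subgroup.zpowers r) :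
    Nonempty (P ≃* DihedralGroup (orderOf r)) := by
  set n := orderOf r with hn
  let ρ' : ZMod n →+ Additive P := ZMod.lift n ⟨zmultiplesHom (Additive P) (Additive.ofMul r), by
    simp [← ofMul_pow, hn, pow_orderOf_eq_one]⟩
  let ρ : ZMod n → P := fun i => (ρ' i).toMul
  have hρ (k : ℤ) : ρ k = r ^ k := by
    simp [ρ, ρ']
  have hadd (i j : ZMod n) : ρ (i + j) = ρ i * ρ j := by simp [ρ]
  have hneg (i : ZMod n) : ρ (-i) = (ρ i)⁻¹ := by simp [ρ]
  have hmem (i : ZMod n) : ρ i ∈ Subgroup.zpowers r := by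
    obtain ⟨k, rfl⟩ := ZMod.intCast_surjective i
    exact ⟨k, (hρ k).symm⟩
  have hinj (i : ZMod n) (h : ρ i = 1) : i = 0 := by
    obtain ⟨k, rfl⟩ := ZMod.intCast_surjective i
    rw [hρ] at h
    exact (ZMod.intCast_zmod_eq_zero_iff_dvd k n).mpr (orderOf_dvd_iff_zpow_eq_one.mpr h)
  have hsinv : s⁻¹ = s := inv_eq_of_mul_eq_one_left hs
  have hconj (i : ZMod n) : ρ i * s = s * ρ (-i) := by
    obtain ⟨k, rfl⟩ := ZMod.intCast_surjective i
    have h1 : s * r ^ k * s = r⁻¹ ^ k := by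
      have h2 : s * r * s⁻¹ = r⁻¹ := by rw [hsinv, hsr]
      rw [← h2, conj_zpow, hsinv]
    rw [hneg, hρ, ← inv_zpow, ← h1, ← mul_assoc, ← mul_assoc, hs, one_mul]
  let f : DihedralGroup n →* P :=
    { toFun := fun x => match x with
        | .r i => ρ i
        | .sr i => s * ρ i
      map_one' := by
        rw [DihedralGroup.one_def]
        simp [ρ]
      map_mul' := by
        rintro (i | i) (j | j)
        · exact hadd i j
        · change s * ρ (j - i) = ρ i * (s * ρ j)
          rw [← mul_assoc, hconj, mul_assoc, ← hadd, neg_add_eq_sub]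
        · change s * ρ (i + j) = s * ρ i * ρ j
          rw [hadd, mul_assoc]
        · change ρ (j - i) = s * ρ i * (s * ρ j)
          rw [mul_assoc, ← mul_assoc (ρ i), hconj, mul_assoc, ← mul_assoc, hs, one_mul, ← hadd,
            neg_add_eq_sub] }
  have hf : Function.Bijective f := by
    constructor
    · rw [injective_iff_map_eq_one]
      rintro (i | i) h
      · rw [hinj i h]; rfl
      · exfalso
        apply hns
        have h' : s * ρ i = 1 := h
        rw [eq_inv_of_mul_eq_one_left h']
        exact inv_mem (hmem i)
    · intro x
      rcases hall x with ⟨k, hk⟩ | ⟨k, hk⟩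
      · exact ⟨.r k, (hρ k).trans hk⟩
      · refine ⟨.sr k, ?_⟩
        change s * ρ k = x
        have hk' : r ^ k = s * x := hk
        rw [hρ, hk', ← mul_assoc, hs, one_mul]
  exact ⟨(MulEquiv.ofBijective f hf).symm⟩

/-! ### Projective images of subgroups of a Cartan subgroup are cyclic -/

section Field

variable {F : Type*} [Field F]

lemma proj_mk_eq_mk_iff {x y : GL (Fin 2) F} :
    Matrix.ProjGenLinGroup.mk x = Matrix.ProjGenLinGroup.mk y ↔
      ∃ c : F, c ≠ 0 ∧ y.val = c • x.val := by
  rw [Matrix.ProjGenLinGroup.mk_eq_mk_iff]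
  constructor
  · rintro ⟨u, rfl⟩
    refine ⟨u, u.ne_zero, ?_⟩
    rw [Units.val_mul, Matrix.GeneralLinearGroup.coe_scalar, Matrix.scalar_apply,
      ← Matrix.smul_one_eq_diagonal, mul_smul_comm, mul_one]
  · rintro ⟨c, hc, h⟩
    refine ⟨Units.mk0 c hc, ?_⟩
    ext1
    rw [Units.val_mul, Matrix.GeneralLinearGroup.coe_scalar, Matrix.scalar_apply,
      ← Matrix.smul_one_eq_diagonal, mul_smul_comm, mul_one, h, Units.val_mk0]

lemma proj_mk_eq_one_iff {x : GL (Fin 2) F} :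
    Matrix.ProjGenLinGroup.mk x = 1 ↔ ∃ c : F, x.val = c • 1 := by
  rw [← Matrix.ProjGenLinGroup.mk_one, eq_comm, proj_mk_eq_mk_iff]
  refine ⟨fun ⟨c, _, h⟩ => ⟨c, h⟩, fun ⟨c, h⟩ => ⟨c, ?_, h⟩⟩
  rintro rfl
  exact x.isUnit.ne_zero (by rw [h, zero_smul])

namespace Traceless

variable {γ : Matrix (Fin 2) (Fin 2) F}

lemma eq_of_smul_one_add_smul (h2 : (2 : F) ≠ 0) (hγ : Traceless γ) {a b a' b' : F}
    (h : a • (1 : Matrix (Fin 2) (Fin 2) F) + b • γ = a' • 1 + b' • γ) : a = a' ∧ b = b' := by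
  have h11 := hγ.1
  simp only [matrix_eq_iff, Matrix.add_apply, Matrix.smul_apply, smul_eq_mul, h11] at h
  simp at h
  obtain ⟨⟨h₁, h₂⟩, h₃, h₄⟩ := h
  refine ⟨mul_left_cancel₀ h2 (by linear_combination h₁ + h₄), ?_⟩
  by_contra hb
  have hb' := sub_ne_zero.mpr hb
  have e1 := h₂.resolve_left hb
  have e3 : γ 0 0 = 0 := by
    apply mul_left_cancel₀ (mul_ne_zero h2 hb')
    linear_combination h₁ - h₄
  exact hγ.2 (by rw [hγ.det_eq, e1, e3]; ring)

/-- Sending `γ` to a square root `θ` of `γ² = -det γ` respects products. The two choices `±θ` are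
the two eigenvalue characters. -/
lemma exists_hom (h2 : (2 : F) ≠ 0) (hγ : Traceless γ) {R : Type*} [Field R] [Algebra F R] {θ : R}
    (hθ : θ * θ = algebraMap F R (-γ.det)) : ∃ f : commutant γ →* Rˣ,
      ∀ (x : commutant γ) (a b : F), x.1.val = a • 1 + b • γ →
        (f x : R) = algebraMap F R a + algebraMap F R b * θ := by
  have hx (x : commutant γ) : ∃ a b : F, x.1.val = a • 1 + b • γ :=
    (hγ.commute_iff h2 _).mp x.2
  choose a b hab using hx
  have key (x : commutant γ) (a' b' : F) (h : x.1.val = a' • 1 + b' • γ) : a x = a' ∧ b x = b' :=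
    hγ.eq_of_smul_one_add_smul h2 ((hab x).symm.trans h)
  let f : commutant γ →* R :=
    { toFun := fun x => algebraMap F R (a x) + algebraMap F R (b x) * θ
      map_one' := by
        obtain ⟨h₁, h₃⟩ := key 1 1 0 (by simp)
        rw [h₁, h₃]; simp
      map_mul' := fun x y => by
        obtain ⟨h₁, h₃⟩ := key (x * y) (a x * a y - b x * b y * γ.det) (a x * b y + b x * a y) (by
          have : (x * y).1.val = x.1.val * y.1.val := rfl
          rw [this, hab x, hab y]
          simp only [add_mul, mul_add, smul_mul_assoc, mul_smul_comm, one_mul, mul_one,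
            hγ.mul_self]
          module)
        rw [h₁, h₃, map_sub, map_add, map_mul, map_mul, map_mul, map_mul, map_mul]
        rw [map_neg] at hθ
        linear_combination - algebraMap F R (b x) * algebraMap F R (b y) * hθ }
  refine ⟨f.toHomUnits, fun x a' b' h => ?_⟩
  obtain ⟨h₁, h₃⟩ := key x a' b' h
  rw [MonoidHom.coe_toHomUnits]
  change algebraMap F R (a x) + algebraMap F R (b x) * θ = _
  rw [h₁, h₃]

/-- The quotient of the two eigenvalue characters maps `H` to a finite, hence cyclic, group of units
of a field. Its kernel consists of scalars: `a + bθ = a - bθ` forces `b = 0`. -/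
lemma exists_proj_generator (h2 : (2 : F) ≠ 0) (hγ : Traceless γ) (H : Subgroup (GL (Fin 2) F))
    [Finite H] (hH : H ≤ commutant γ) : ∃ h ∈ H, ∀ x ∈ H, ∃ k : ℤ,
      Matrix.ProjGenLinGroup.mk x = Matrix.ProjGenLinGroup.mk h ^ k := by
  obtain ⟨θ, hθ⟩ := IsAlgClosed.exists_pow_nat_eq (k := AlgebraicClosure F)
    (algebraMap F _ (-γ.det)) (n := 2) (by norm_num)
  have hθ0 : θ ≠ 0 := by
    rintro rfl
    have : algebraMap F (AlgebraicClosure F) (-γ.det) = 0 := by rw [← hθ]; simp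
    exact neg_ne_zero.mpr hγ.2 ((map_eq_zero _).mp this)
  obtain ⟨f, hf⟩ := hγ.exists_hom h2 (θ := θ) (by rw [← hθ, sq])
  obtain ⟨f', hf'⟩ := hγ.exists_hom h2 (θ := -θ) (by rw [← hθ]; ring)
  let φ : H →* (AlgebraicClosure F)ˣ := (f / f').comp (Subgroup.inclusion hH)
  have : Finite φ.range := Set.finite_range φ
  obtain ⟨⟨_, h, rfl⟩, hgen⟩ := IsCyclic.exists_generator (α := φ.range)
  refine ⟨h.1, h.2, fun x hx => ?_⟩
  obtain ⟨k, hk⟩ := hgen ⟨φ ⟨x, hx⟩, _, rfl⟩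
  refine ⟨k, ?_⟩
  have hk' : φ (h ^ k) = φ ⟨x, hx⟩ := by
    rw [map_zpow]
    exact congrArg Subtype.val hk
  set y : H := (h ^ k)⁻¹ * ⟨x, hx⟩ with hy
  have hy1 : φ y = 1 := by rw [hy, map_mul, map_inv, hk', inv_mul_cancel]
  obtain ⟨a, b, hab⟩ := (hγ.commute_iff h2 y.1.val).mp (hH y.2)
  have hff : f (Subgroup.inclusion hH y) = f' (Subgroup.inclusion hH y) := by
    have : f (Subgroup.inclusion hH y) / f' (Subgroup.inclusion hH y) = 1 := hy1
    exact div_eq_one.mp this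
  have hff' := congrArg Units.val hff
  rw [hf _ a b hab, hf' _ a b hab] at hff'
  have h2' : (2 : AlgebraicClosure F) ≠ 0 := by
    have := (map_ne_zero (algebraMap F (AlgebraicClosure F))).mpr h2
    rwa [map_ofNat] at this
  have hb : b = 0 := by
    apply (map_eq_zero (algebraMap F (AlgebraicClosure F))).mp
    apply mul_left_cancel₀ (mul_ne_zero h2' hθ0)
    linear_combination hff'
  have hmk : Matrix.ProjGenLinGroup.mk y.1 = 1 := by
    rw [proj_mk_eq_one_iff]
    exact ⟨a, by rw [hab, hb, zero_smul, add_zero]⟩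
  have hyx : y.1 = (h.1 ^ k)⁻¹ * x := rfl
  rw [hyx, map_mul, map_inv, map_zpow, inv_mul_eq_one] at hmk
  exact hmk.symm

end Traceless

end Field

/-! ### Dihedral projective images and their sign characters -/

section ProjectiveImage

variable {p : ℕ} [Fact p.Prime] {G : Subgroup (GL (Fin 2) (ZMod p))}
  {γ γ' : Matrix (Fin 2) (Fin 2) (ZMod p)}

lemma ConditionS.not_le_commutant (hp : p ≠ 2) (hS : ConditionS G) (hγ : Traceless γ) :
    ¬ G ≤ commutant γ :=
  hS _ (isCartan_commutant hp hγ)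

lemma ConditionS.exists_anticommute (hp : p ≠ 2) (hS : ConditionS G) (hγ : Traceless γ)
    (hG : SignCommutes G γ) : ∃ g ∈ G, g.val * γ = -(γ * g.val) := by
  obtain ⟨g, hg, h⟩ := SetLike.not_le_iff_exists.mp (hS.not_le_commutant hp hγ)
  exact ⟨g, hg, (hG g hg).resolve_left h⟩

/-- The rotation is a generator `h` of the projective image of `G ⊓ commutant γ`, and the reflection
is an anticommuting element `B`, which has trace zero and hence scalar square. -/
lemma exists_dihedral_generators (hp : p ≠ 2) (hS : ConditionS G) (hγ : Traceless γ)
    (hG : SignCommutes G γ) : ∃ h ∈ G, ∃ B ∈ G, h ∈ commutant γ ∧ B.val * γ = -(γ * B.val) ∧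
      (∀ x ∈ G ⊓ commutant γ, ∃ k : ℤ,
        Matrix.ProjGenLinGroup.mk x = Matrix.ProjGenLinGroup.mk h ^ k) ∧
      2 ≤ orderOf (Matrix.ProjGenLinGroup.mk h) ∧
      Nonempty (projImage G ≃* DihedralGroup (orderOf (Matrix.ProjGenLinGroup.mk h))) := by
  have h2 := two_ne_zero_of_ne_two hp
  obtain ⟨B, hB, hBγ⟩ := hS.exists_anticommute hp hγ hG
  obtain ⟨h, hh, hgen⟩ := hγ.exists_proj_generator h2 (G ⊓ commutant γ) inf_le_right
  obtain ⟨hhG, hhγ⟩ := Subgroup.mem_inf.mp hh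
  have hBt := hγ.traceless_of_anticommute h2 hBγ
  have hanti (x : GL (Fin 2) (ZMod p)) (hx : x ∈ G) (hxγ : x ∉ commutant γ) :
      B * x ∈ G ⊓ commutant γ := by
    refine ⟨mul_mem hB hx, ?_⟩
    change B * x ∈ commutant γ
    rw [mem_commutant, Units.val_mul, mul_assoc, (hG x hx).resolve_left hxγ, mul_neg, ← mul_assoc,
      hBγ, neg_mul, neg_neg, mul_assoc]
  let r : projImage G := ⟨Matrix.ProjGenLinGroup.mk h, h, hhG, rfl⟩
  let s : projImage G := ⟨Matrix.ProjGenLinGroup.mk B, B, hB, rfl⟩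
  have hs : s * s = 1 := by
    apply Subtype.ext
    change Matrix.ProjGenLinGroup.mk B * Matrix.ProjGenLinGroup.mk B = 1
    rw [← map_mul, proj_mk_eq_one_iff]
    exact ⟨_, hBt.mul_self⟩
  obtain ⟨a, b, hab⟩ := (hγ.commute_iff h2 _).mp hhγ
  have hsr : s * r * s = r⁻¹ := by
    rw [eq_inv_iff_mul_eq_one]
    apply Subtype.ext
    change Matrix.ProjGenLinGroup.mk B * Matrix.ProjGenLinGroup.mk h *
      Matrix.ProjGenLinGroup.mk B * Matrix.ProjGenLinGroup.mk h = 1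
    rw [← map_mul, ← map_mul, ← map_mul, proj_mk_eq_one_iff]
    -- Moving `B` past `h = a + bγ` conjugates it to `a - bγ`, so `BhBh` is a product of the scalars
    -- `B²` and `a² - b²γ²`.
    have e1 : B.val * h.val = (a • 1 - b • γ) * B.val := by
      rw [hab, mul_add, sub_mul, mul_smul_comm, mul_smul_comm, hBγ, smul_mul_assoc, smul_mul_assoc,
        mul_one, one_mul, smul_neg, sub_eq_add_neg]
    refine ⟨-B.val.det * (a ^ 2 + b ^ 2 * γ.det), ?_⟩
    simp only [Units.val_mul]
    rw [e1, mul_assoc _ B.val B.val, hBt.mul_self, hab]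
    simp only [mul_smul_comm, smul_mul_assoc, mul_add, sub_mul, hγ.mul_self, mul_one, one_mul]
    module
  have hns : s ∉ Subgroup.zpowers r := by
    rintro ⟨k, hk⟩
    have hk' : Matrix.ProjGenLinGroup.mk (h ^ k) = Matrix.ProjGenLinGroup.mk B := by
      rw [map_zpow]
      exact congrArg Subtype.val hk
    obtain ⟨c, hc, hcB⟩ := proj_mk_eq_mk_iff.mp hk'
    refine hγ.not_commute_of_anticommute h2 hBγ ?_
    rw [hcB, smul_mul_assoc, mul_smul_comm, mem_commutant.mp (zpow_mem hhγ k)]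
  have hpow (x : GL (Fin 2) (ZMod p)) (hx : x ∈ G ⊓ commutant γ) (y : projImage G)
      (hy : y.1 = Matrix.ProjGenLinGroup.mk x) : y ∈ Subgroup.zpowers r := by
    obtain ⟨k, hk⟩ := hgen x hx
    exact ⟨k, Subtype.ext (hk.symm.trans hy.symm)⟩
  have hall (x : projImage G) : x ∈ Subgroup.zpowers r ∨ s * x ∈ Subgroup.zpowers r := by
    obtain ⟨_, x, hx, rfl⟩ := x
    by_cases hxγ : x ∈ commutant γ
    · exact Or.inl (hpow x ⟨hx, hxγ⟩ _ rfl)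
    · exact Or.inr (hpow (B * x) (hanti x hx hxγ) _ (map_mul _ _ _).symm)
  have hord : orderOf (Matrix.ProjGenLinGroup.mk h) = orderOf r :=
    Subgroup.orderOf_coe r
  refine ⟨h, hhG, B, hB, hhγ, hBγ, hgen, ?_, hord ▸ nonempty_mulEquiv_dihedralGroup r s hs hsr hns hall⟩
  rw [hord]
  have hpos : orderOf r ≠ 0 := by
    intro h0
    rw [← hord, orderOf_eq_zero_iff'] at h0
    refine h0 (orderOf h) (orderOf_pos h) ?_
    rw [← map_pow, pow_orderOf_eq_one, map_one]
  -- A trivial rotation would leave only the classes of `1` and `B`, placing `G` in the Cartan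
  -- subgroup `commutant B`, against (S).
  have hne : orderOf r ≠ 1 := by
    intro h1
    rw [orderOf_eq_one_iff] at h1
    rw [h1, Subgroup.zpowers_one_eq_bot] at hall
    refine hS.not_le_commutant hp hBt fun x hx => ?_
    rcases hall ⟨Matrix.ProjGenLinGroup.mk x, x, hx, rfl⟩ with h | h
    · have h' : Matrix.ProjGenLinGroup.mk x = 1 := congrArg Subtype.val (Subgroup.mem_bot.mp h)
      obtain ⟨c, hc⟩ := proj_mk_eq_one_iff.mp h'
      rw [mem_commutant, hc]; simp
    · have h' : Matrix.ProjGenLinGroup.mk B * Matrix.ProjGenLinGroup.mk x = 1 :=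
        congrArg Subtype.val (Subgroup.mem_bot.mp h)
      rw [← map_mul] at h'
      obtain ⟨c, hc⟩ := proj_mk_eq_one_iff.mp h'
      rw [mem_commutant, ← B.isUnit.mul_right_inj, ← mul_assoc, ← Units.val_mul, hc]
      simp
  omega

lemma exists_mulEquiv_dihedralGroup (hp : p ≠ 2) (hS : ConditionS G) (hγ : Traceless γ)
    (hG : SignCommutes G γ) :
    ∃ n : ℕ, 2 ≤ n ∧ Nonempty (projImage G ≃* DihedralGroup n) := by
  obtain ⟨h, -, B, -, -, -, -, hn, e⟩ := exists_dihedral_generators hp hS hγ hG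
  exact ⟨_, hn, e⟩

lemma commutant_eq_of_commute (hp : p ≠ 2) (hγ : Traceless γ) (hγ' : Traceless γ')
    (h : γ' * γ = γ * γ') : commutant γ' = commutant γ := by
  have h2 := two_ne_zero_of_ne_two hp
  have h' : ∃ c : ZMod p, γ' = c • γ := by
    obtain ⟨a, b, hab⟩ := (hγ.commute_iff h2 γ').mp h
    have h11 := hγ'.1
    rw [hab] at h11
    simp only [Matrix.add_apply, Matrix.smul_apply, Matrix.one_apply_eq, smul_eq_mul, hγ.1] at h11
    have ha : a = 0 := mul_left_cancel₀ h2 (by linear_combination h11)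
    exact ⟨b, by rw [hab, ha, zero_smul, zero_add]⟩
  obtain ⟨c, rfl⟩ := h'
  have hc : c ≠ 0 := by
    rintro rfl
    exact hγ'.isUnit.ne_zero (zero_smul _ _)
  ext x
  rw [mem_commutant, mem_commutant, mul_smul_comm, smul_mul_assoc,
    (smul_right_injective _ hc).eq_iff]

/-- The commutation sign with `γ` is multiplicative on `G`. -/
lemma mul_mem_commutant_iff (hG : SignCommutes G γ)
    {x y : GL (Fin 2) (ZMod p)} (hx : x ∈ G) (hy : y ∈ G) :
    x * y ∈ commutant γ ↔ (x ∈ commutant γ ↔ y ∈ commutant γ) := by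
  by_cases hxγ : x ∈ commutant γ
  · rw [mul_mem_cancel_left hxγ]
    simp [hxγ]
  · by_cases hyγ : y ∈ commutant γ
    · rw [mul_mem_cancel_right hyγ]
      simp [hyγ]
    · simp only [hxγ, hyγ, iff_true]
      rw [mem_commutant, Units.val_mul, mul_assoc, (hG y hy).resolve_left hyγ, mul_neg,
        ← mul_assoc, (hG x hx).resolve_left hxγ, neg_mul, neg_neg, mul_assoc]

/-- If `γ` and `γ'` do not commute, only scalars centralise both, so the pair of signs embeds the
projective image in a set with four elements. A dihedral group of order `2n` with `n ≥ 2` then has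
order exactly 4. -/
lemma commutant_inf_eq_of_card_ne_four (hp : p ≠ 2) (hS : ConditionS G) (hγ : Traceless γ)
    (hG : SignCommutes G γ) (hγ' : Traceless γ') (hG' : SignCommutes G γ')
    (hcard : Nat.card (projImage G) ≠ 4) : G ⊓ commutant γ = G ⊓ commutant γ' := by
  classical
  have h2 := two_ne_zero_of_ne_two hp
  by_contra hne
  have hcomm : γ' * γ ≠ γ * γ' := fun h => hne (by rw [commutant_eq_of_commute hp hγ hγ' h])
  have hscalar (x : GL (Fin 2) (ZMod p)) (h : x ∈ commutant γ) (h' : x ∈ commutant γ') :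
      Matrix.ProjGenLinGroup.mk x = 1 := by
    rw [proj_mk_eq_one_iff]
    obtain ⟨a, b, hab⟩ := (hγ.commute_iff h2 x.val).mp h
    by_cases hb : b = 0
    · exact ⟨a, by rw [hab, hb, zero_smul, add_zero]⟩
    · exfalso
      rw [mem_commutant, hab, add_mul, mul_add, smul_mul_assoc, smul_mul_assoc, mul_smul_comm,
        mul_smul_comm, one_mul, mul_one, add_right_inj, (smul_right_injective _ hb).eq_iff] at h'
      exact hcomm h'.symm
  choose rep hrepG hrep using fun x : projImage G => x.2
  let f : projImage G → Bool × Bool := fun x =>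
    (decide (rep x ∈ commutant γ), decide (rep x ∈ commutant γ'))
  have hquot {δ : Matrix (Fin 2) (Fin 2) (ZMod p)} (hδ : Traceless δ) (hGδ : SignCommutes G δ)
      {x y : GL (Fin 2) (ZMod p)} (hx : x ∈ G) (hy : y ∈ G)
      (h : x ∈ commutant δ ↔ y ∈ commutant δ) : x⁻¹ * y ∈ commutant δ :=
    (mul_mem_commutant_iff hGδ (inv_mem hx) hy).mpr (inv_mem_iff.trans h)
  have hf : Function.Injective f := by
    intro x y hxy
    have h1 := congrArg Prod.fst hxy
    have h3 := congrArg Prod.snd hxy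
    simp only [f, decide_eq_decide] at h1 h3
    have := hscalar _ (hquot hγ hG (hrepG x) (hrepG y) h1) (hquot hγ' hG' (hrepG x) (hrepG y) h3)
    rw [map_mul, map_inv, inv_mul_eq_one, hrep, hrep] at this
    exact Subtype.ext this
  have hle := Nat.card_le_card_of_injective f hf
  obtain ⟨n, hn, ⟨e⟩⟩ := exists_mulEquiv_dihedralGroup hp hS hγ hG
  rw [Nat.card_congr e.toEquiv, DihedralGroup.nat_card] at hle hcard
  have h4 : Nat.card (Bool × Bool) = 4 := by simp
  omega

lemma mem_commutant_iff_of_proj_eq {x y : GL (Fin 2) (ZMod p)}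
    (h : Matrix.ProjGenLinGroup.mk x = Matrix.ProjGenLinGroup.mk y) :
    x ∈ commutant γ ↔ y ∈ commutant γ := by
  obtain ⟨c, hc, h⟩ := proj_mk_eq_mk_iff.mp h
  rw [mem_commutant, mem_commutant, h, smul_mul_assoc, mul_smul_comm,
    (smul_right_injective _ hc).eq_iff]

lemma exists_generators_of_card_eq_four (hp : p ≠ 2) (hS : ConditionS G) (hγ : Traceless γ)
    (hG : SignCommutes G γ) (hcard : Nat.card (projImage G) = 4) :
    ∃ A ∈ G, ∃ B ∈ G, Traceless A.val ∧ Traceless B.val ∧ B.val * A.val = -(A.val * B.val) ∧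
      ∀ x ∈ G, ∃ y ∈ ({1, A, B, B * A} : Set (GL (Fin 2) (ZMod p))),
        Matrix.ProjGenLinGroup.mk x = Matrix.ProjGenLinGroup.mk y := by
  have h2 := two_ne_zero_of_ne_two hp
  obtain ⟨A, hA, B, hB, hAγ, hBγ, hgen, hn, ⟨e⟩⟩ := exists_dihedral_generators hp hS hγ hG
  have hBt := hγ.traceless_of_anticommute h2 hBγ
  rw [Nat.card_congr e.toEquiv, DihedralGroup.nat_card] at hcard
  have hord : orderOf (Matrix.ProjGenLinGroup.mk A) = 2 := by omega
  have hAA : Matrix.ProjGenLinGroup.mk A ^ 2 = 1 := by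
    have h := pow_orderOf_eq_one (Matrix.ProjGenLinGroup.mk A)
    rwa [hord] at h
  have hBB : Matrix.ProjGenLinGroup.mk B * Matrix.ProjGenLinGroup.mk B = 1 := by
    rw [← map_mul, proj_mk_eq_one_iff]
    exact ⟨_, hBt.mul_self⟩
  obtain ⟨a, b, hab⟩ := (hγ.commute_iff h2 _).mp hAγ
  have hb : b ≠ 0 := by
    rintro rfl
    have : Matrix.ProjGenLinGroup.mk A = 1 :=
      proj_mk_eq_one_iff.mpr ⟨a, by rw [hab, zero_smul, add_zero]⟩
    rw [this, orderOf_one] at hord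
    omega
  have ha : a = 0 := by
    rw [← map_pow, proj_mk_eq_one_iff] at hAA
    obtain ⟨c, hc⟩ := hAA
    -- The square of `A = a + bγ` is scalar, so `2ab = 0`; as `b ≠ 0`, `A` is a multiple of `γ`.
    have e1 : (a ^ 2 - b ^ 2 * γ.det) • (1 : Matrix (Fin 2) (Fin 2) (ZMod p)) + (2 * a * b) • γ =
        c • 1 + (0 : ZMod p) • γ := by
      rw [zero_smul, add_zero, ← hc, sq A, Units.val_mul, hab]
      simp only [mul_smul_comm, smul_mul_assoc, mul_add, add_mul, hγ.mul_self, mul_one, one_mul]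
      module
    have := (hγ.eq_of_smul_one_add_smul h2 e1).2
    have := (mul_eq_zero.mp this).resolve_right hb
    exact (mul_eq_zero.mp this).resolve_left h2
  rw [ha, zero_smul, zero_add] at hab
  refine ⟨A, hA, B, hB, hab ▸ hγ.smul hb, hBt, ?_, ?_⟩
  · rw [hab, mul_smul_comm, hBγ, smul_mul_assoc, smul_neg]
  · have hpow (k : ℤ) : Matrix.ProjGenLinGroup.mk A ^ k = 1 ∨
        Matrix.ProjGenLinGroup.mk A ^ k = Matrix.ProjGenLinGroup.mk A := by
      rcases Int.even_or_odd' k with ⟨m, rfl | rfl⟩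
      · left
        rw [zpow_mul, zpow_ofNat, hAA, one_zpow]
      · right
        rw [zpow_add, zpow_mul, zpow_ofNat, hAA, one_zpow, one_mul, zpow_one]
    intro x hx
    by_cases hxγ : x ∈ commutant γ
    · obtain ⟨k, hk⟩ := hgen x ⟨hx, hxγ⟩
      rw [hk]
      rcases hpow k with h | h <;> rw [h]
      · exact ⟨1, by simp, by simp⟩
      · exact ⟨A, by simp, rfl⟩
    · have hBγ' : B ∉ commutant γ := hγ.not_commute_of_anticommute h2 hBγ
      obtain ⟨k, hk⟩ := hgen (B * x) ⟨mul_mem hB hx,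
        (mul_mem_commutant_iff hG hB hx).mpr (by simp [hxγ, hBγ'])⟩
      have hx' : Matrix.ProjGenLinGroup.mk x =
          Matrix.ProjGenLinGroup.mk B * Matrix.ProjGenLinGroup.mk A ^ k := by
        rw [← hk, map_mul, ← mul_assoc, hBB, one_mul]
      rw [hx']
      rcases hpow k with h | h <;> rw [h]
      · exact ⟨B, by simp, by simp⟩
      · exact ⟨B * A, by simp, by simp⟩

/-- Modulo scalars `G` is a Klein four-group on the pairwise anticommuting `A`, `B`, `BA`, which
also serve as the `δ i`. Their signs are its three non-trivial characters, each the product of the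
other two, and (S) excludes the trivial one. -/
lemma exists_three_of_card_eq_four (hp : p ≠ 2) (hS : ConditionS G) (hγ : Traceless γ)
    (hG : SignCommutes G γ) (hcard : Nat.card (projImage G) = 4) :
    ∃ δ : Fin 3 → Matrix (Fin 2) (Fin 2) (ZMod p),
      (∀ i, Traceless (δ i) ∧ SignCommutes G (δ i)) ∧
      (∀ i j, i ≠ j → G ⊓ commutant (δ i) ≠ G ⊓ commutant (δ j)) ∧
      (∀ γ' : Matrix (Fin 2) (Fin 2) (ZMod p), Traceless γ' → SignCommutes G γ' →
        ∃ i, G ⊓ commutant γ' = G ⊓ commutant (δ i)) ∧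
      ∀ i j k, i ≠ j → i ≠ k → j ≠ k → ∀ x ∈ G,
        (x ∈ commutant (δ k) ↔ (x ∈ commutant (δ i) ↔ x ∈ commutant (δ j))) := by
  have h2 := two_ne_zero_of_ne_two hp
  obtain ⟨A, hA, B, hB, hAt, hBt, hBA, hgen⟩ := exists_generators_of_card_eq_four hp hS hγ hG hcard
  have hAB : A.val * B.val = -(B.val * A.val) := by rw [hBA, neg_neg]
  have hBAA : A.val * (B * A).val = -((B * A).val * A.val) := by
    rw [Units.val_mul, ← mul_assoc, hAB, neg_mul]
  have hBAB : B.val * (B * A).val = -((B * A).val * B.val) := by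
    rw [Units.val_mul, mul_assoc B.val A.val, hAB, mul_neg, neg_neg]
  have hBAt : Traceless (B * A).val :=
    hAt.traceless_of_anticommute h2 (by rw [hBAA, neg_neg])
  have hsc {δ : Matrix (Fin 2) (Fin 2) (ZMod p)}
      (h₁ : A.val * δ = δ * A.val ∨ A.val * δ = -(δ * A.val))
      (h₃ : B.val * δ = δ * B.val ∨ B.val * δ = -(δ * B.val)) : SignCommutes G δ := by
    have h₄ : (B * A).val * δ = δ * (B * A).val ∨ (B * A).val * δ = -(δ * (B * A).val) := by
      rw [Units.val_mul, ← mul_assoc, mul_assoc]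
      rcases h₁ with h₁ | h₁ <;> rcases h₃ with h₃ | h₃ <;> rw [h₁] <;>
        simp [← mul_assoc, h₃]
    intro x hx
    obtain ⟨y, hy, hxy⟩ := hgen x hx
    obtain ⟨c, -, hc⟩ := proj_mk_eq_mk_iff.mp hxy.symm
    rw [hc, smul_mul_assoc, mul_smul_comm, ← smul_neg]
    have : y.val * δ = δ * y.val ∨ y.val * δ = -(δ * y.val) := by
      rcases hy with rfl | rfl | rfl | rfl
      · left; simp
      · exact h₁
      · exact h₃
      · exact h₄
    exact this.imp (congrArg _) (congrArg _)
  have hmem {δ : Matrix (Fin 2) (Fin 2) (ZMod p)} (hGδ : SignCommutes G δ) :=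
    mul_mem_commutant_iff hGδ hB hA
  have hext {δ δ' : Matrix (Fin 2) (Fin 2) (ZMod p)} (hGδ : SignCommutes G δ)
      (hGδ' : SignCommutes G δ') (h₁ : A ∈ commutant δ ↔ A ∈ commutant δ')
      (h₃ : B ∈ commutant δ ↔ B ∈ commutant δ') : G ⊓ commutant δ = G ⊓ commutant δ' := by
    ext x
    rw [Subgroup.mem_inf, Subgroup.mem_inf, and_congr_right_iff]
    intro hx
    obtain ⟨y, hy, hxy⟩ := hgen x hx
    rw [mem_commutant_iff_of_proj_eq hxy, mem_commutant_iff_of_proj_eq hxy]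
    rcases hy with rfl | rfl | rfl | rfl
    · simp [one_mem]
    · exact h₁
    · exact h₃
    · rw [hmem hGδ, hmem hGδ', h₁, h₃]
  have sA := hsc (δ := A.val) (Or.inl rfl) (Or.inr hBA)
  have sB := hsc (δ := B.val) (Or.inr hAB) (Or.inl rfl)
  have sBA := hsc (δ := (B * A).val) (Or.inr hBAA) (Or.inr hBAB)
  have mAA : A ∈ commutant A.val := rfl
  have mBA : B ∉ commutant A.val := hAt.not_commute_of_anticommute h2 hBA
  have mAB : A ∉ commutant B.val := hBt.not_commute_of_anticommute h2 hAB
  have mBB : B ∈ commutant B.val := rfl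
  have mAC : A ∉ commutant (B * A).val := hBAt.not_commute_of_anticommute h2 hBAA
  have mBC : B ∉ commutant (B * A).val := hBAt.not_commute_of_anticommute h2 hBAB
  let δ : Fin 3 → Matrix (Fin 2) (Fin 2) (ZMod p) := ![A.val, B.val, (B * A).val]
  have hδA (i : Fin 3) : A ∈ commutant (δ i) ↔ i = 0 := by
    fin_cases i
    · exact iff_of_true mAA rfl
    · exact iff_of_false mAB (by decide)
    · exact iff_of_false mAC (by decide)
  have hδB (i : Fin 3) : B ∈ commutant (δ i) ↔ i = 1 := by
    fin_cases i
    · exact iff_of_false mBA (by decide)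
    · exact iff_of_true mBB rfl
    · exact iff_of_false mBC (by decide)
  have hδ (i : Fin 3) : Traceless (δ i) ∧ SignCommutes G (δ i) := by
    fin_cases i
    exacts [⟨hAt, sA⟩, ⟨hBt, sB⟩, ⟨hBAt, sBA⟩]
  refine ⟨δ, hδ, ?_, ?_, ?_⟩
  · intro i j hij h
    have h₁ : A ∈ commutant (δ i) ↔ A ∈ commutant (δ j) := by
      simpa [hA] using SetLike.ext_iff.mp h A
    have h₃ : B ∈ commutant (δ i) ↔ B ∈ commutant (δ j) := by
      simpa [hB] using SetLike.ext_iff.mp h B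
    rw [hδA, hδA] at h₁
    rw [hδB, hδB] at h₃
    clear h
    revert i j
    decide
  · intro γ' hγ' hG'
    by_cases h₁ : A ∈ commutant γ'
    · have h₃ : B ∉ commutant γ' := by
        intro h₃
        refine hS.not_le_commutant hp hγ' fun x hx => ?_
        obtain ⟨y, hy, hxy⟩ := hgen x hx
        rw [mem_commutant_iff_of_proj_eq hxy]
        rcases hy with rfl | rfl | rfl | rfl
        exacts [one_mem _, h₁, h₃, mul_mem h₃ h₁]
      exact ⟨0, hext hG' (hδ 0).2 (by simp [hδA, h₁]) (by simp [hδB, h₃])⟩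
    · by_cases h₃ : B ∈ commutant γ'
      · exact ⟨1, hext hG' (hδ 1).2 (by simp [hδA, h₁]) (by simp [hδB, h₃])⟩
      · exact ⟨2, hext hG' (hδ 2).2 (by simp [hδA, h₁]) (by simp [hδB, h₃])⟩
  · intro i j k hij hik hjk x hx
    obtain ⟨y, hy, hxy⟩ := hgen x hx
    simp only [mem_commutant_iff_of_proj_eq hxy]
    rcases hy with rfl | rfl | rfl | rfl
    · simp [one_mem]
    · rw [hδA, hδA, hδA]
      revert i j k
      decide
    · rw [hδB, hδB, hδB]
      revert i j k
      decide
    · rw [hmem (hδ i).2, hmem (hδ j).2, hmem (hδ k).2,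
        hδB, hδB, hδB, hδA, hδA, hδA]
      revert i j k
      decide

end ProjectiveImage

/-! ### Quadratic extensions, square roots and the field cut out by a Cartan subgroup -/

section QuadraticFields

variable {K : Type*} [Field K] [CharZero K]

local notation "Ω" => AlgebraicClosure K

omit [CharZero K] in
lemma exists_sqrt (d : K) : ∃ δ : Ω, δ ^ 2 = algebraMap K Ω d :=
  IsAlgClosed.exists_pow_nat_eq _ two_pos

omit [CharZero K] in
lemma galois_sqrt {d : K} {δ : AlgebraicClosure K} (hδ : δ ^ 2 = algebraMap K Ω d) (σ : Ω ≃ₐ[K] Ω) :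
    σ δ = δ ∨ σ δ = -δ := by
  rw [← sq_eq_sq_iff_eq_or_eq_neg, ← map_pow, hδ, AlgEquiv.commutes]

lemma exists_algebraMap_eq_of_fixed {x : AlgebraicClosure K} (h : ∀ σ : Ω ≃ₐ[K] Ω, σ x = x) :
    ∃ y : K, algebraMap K Ω y = x :=
  (InfiniteGalois.mem_range_algebraMap_iff_fixed x).mpr h

lemma fixingSubgroup_injective {L L' : IntermediateField K Ω}
    (h : L.fixingSubgroup = L'.fixingSubgroup) : L = L' := by
  rw [← InfiniteGalois.fixedField_fixingSubgroup L, h, InfiniteGalois.fixedField_fixingSubgroup]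

variable {d : K} {δ : AlgebraicClosure K}

omit [CharZero K] in
lemma mem_fixingSubgroup_adjoinSqrt (hδ : δ ^ 2 = algebraMap K Ω d) (σ : Ω ≃ₐ[K] Ω) :
    σ ∈ (adjoinSqrt d).fixingSubgroup ↔ σ δ = δ := by
  rw [IntermediateField.mem_fixingSubgroup_iff]
  constructor
  · exact fun h => h δ (IntermediateField.subset_adjoin _ _ hδ)
  · intro h x hx
    have hle : adjoinSqrt d ≤ IntermediateField.fixedField (Subgroup.zpowers σ) := by
      rw [adjoinSqrt, IntermediateField.adjoin_le_iff]
      intro y hy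
      have hy' : y ^ 2 = δ ^ 2 := hy.trans hδ.symm
      have hσy : σ y = y := by
        rcases sq_eq_sq_iff_eq_or_eq_neg.mp hy' with rfl | rfl
        · exact h
        · rw [map_neg, h]
      rw [SetLike.mem_coe, IntermediateField.mem_fixedField_iff]
      have : Subgroup.zpowers σ ≤ MulAction.stabilizer (Ω ≃ₐ[K] Ω) y := by
        rw [Subgroup.zpowers_le]
        exact hσy
      exact fun f hf => this hf
    exact (IntermediateField.mem_fixedField_iff _ x).mp (hle hx) σ (Subgroup.mem_zpowers σ)

lemma mem_adjoinSqrt_iff (hδ : δ ^ 2 = algebraMap K Ω d) (x : Ω) :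
    x ∈ adjoinSqrt d ↔ ∀ σ : Ω ≃ₐ[K] Ω, σ δ = δ → σ x = x := by
  rw [← InfiniteGalois.fixedField_fixingSubgroup (adjoinSqrt d),
    IntermediateField.mem_fixedField_iff]
  simp only [mem_fixingSubgroup_adjoinSqrt hδ]

lemma exists_galois_sqrt_eq_neg (hd : ¬ IsSquare d) (hδ : δ ^ 2 = algebraMap K Ω d) :
    ∃ σ : Ω ≃ₐ[K] Ω, σ δ = -δ := by
  by_contra! h
  obtain ⟨y, rfl⟩ := exists_algebraMap_eq_of_fixed fun σ => (galois_sqrt hδ σ).resolve_right (h σ)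
  apply hd
  rw [← map_pow] at hδ
  exact ⟨y, by rw [← sq]; exact ((algebraMap K Ω).injective hδ).symm⟩

omit [CharZero K] in
lemma sqrt_ne_zero (hd : ¬ IsSquare d) (hδ : δ ^ 2 = algebraMap K Ω d) : δ ≠ 0 := by
  rintro rfl
  apply hd
  rw [zero_pow two_ne_zero, eq_comm, map_eq_zero] at hδ
  rw [hδ]
  exact IsSquare.zero

lemma neg_sqrt_ne (hd : ¬ IsSquare d) (hδ : δ ^ 2 = algebraMap K Ω d) : -δ ≠ δ :=
  fun h => sqrt_ne_zero hd hδ (self_eq_neg.mp h.symm)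

/-- An element of `K(√d)` that is fixed by an automorphism moving `√d` lies in `K`. -/
lemma exists_algebraMap_eq_of_mem_adjoinSqrt (hδ : δ ^ 2 = algebraMap K Ω d)
    {σ : Ω ≃ₐ[K] Ω} (hσ : σ δ = -δ) {x : Ω} (hx : x ∈ adjoinSqrt d) (h : σ x = x) :
    ∃ y : K, algebraMap K Ω y = x := by
  rw [mem_adjoinSqrt_iff hδ] at hx
  refine exists_algebraMap_eq_of_fixed fun τ => ?_
  rcases galois_sqrt hδ τ with hτ | hτ
  · exact hx τ hτ
  · have := hx (σ * τ) (by rw [AlgEquiv.mul_apply, hτ, map_neg, hσ, neg_neg])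
    rw [AlgEquiv.mul_apply] at this
    exact σ.injective (this.trans h.symm)

lemma galois_mem_adjoinSqrt (hδ : δ ^ 2 = algebraMap K Ω d) (σ : Ω ≃ₐ[K] Ω) {x : Ω}
    (hx : x ∈ adjoinSqrt d) : σ x ∈ adjoinSqrt d := by
  rw [mem_adjoinSqrt_iff hδ] at hx ⊢
  intro τ hτ
  have := hx (σ⁻¹ * τ * σ) (by
    rcases galois_sqrt hδ σ with hσ | hσ
    · rw [AlgEquiv.mul_apply, AlgEquiv.mul_apply, hσ, hτ]
      exact (AlgEquiv.symm_apply_eq σ).mpr hσ.symm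
    · rw [AlgEquiv.mul_apply, AlgEquiv.mul_apply, hσ, map_neg, hτ]
      exact (AlgEquiv.symm_apply_eq σ).mpr hσ.symm)
  rw [AlgEquiv.mul_apply, AlgEquiv.mul_apply] at this
  exact (AlgEquiv.symm_apply_eq σ).mp this

/-- The two-fold application of an automorphism is trivial on `K(√d)`. -/
lemma galois_galois_eq (hδ : δ ^ 2 = algebraMap K Ω d) (σ : Ω ≃ₐ[K] Ω) {x : Ω}
    (hx : x ∈ adjoinSqrt d) : σ (σ x) = x := by
  rw [mem_adjoinSqrt_iff hδ] at hx
  refine hx (σ * σ) ?_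
  rw [AlgEquiv.mul_apply]
  rcases galois_sqrt hδ σ with hσ | hσ
  · rw [hσ, hσ]
  · rw [hσ, map_neg, hσ, neg_neg]

omit [CharZero K] in
lemma sqrt_mem_adjoinSqrt (hδ : δ ^ 2 = algebraMap K Ω d) : δ ∈ adjoinSqrt d :=
  IntermediateField.subset_adjoin _ _ hδ

lemma finrank_adjoinSqrt (hd : ¬ IsSquare d) : Module.finrank K (adjoinSqrt d) = 2 := by
  obtain ⟨δ, hδ⟩ := exists_sqrt d
  obtain ⟨σ, hσ⟩ := exists_galois_sqrt_eq_neg hd hδ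
  rw [IntermediateField.finrank_eq_fixingSubgroup_index,
    Subgroup.index_eq_two_iff_exists_notMem_and']
  refine ⟨σ, ?_, fun τ => ?_⟩
  · rw [mem_fixingSubgroup_adjoinSqrt hδ, hσ]
    exact neg_sqrt_ne hd hδ
  · simp only [mem_fixingSubgroup_adjoinSqrt hδ, AlgEquiv.mul_apply]
    rcases galois_sqrt hδ τ with hτ | hτ
    · exact Or.inr hτ
    · left
      rw [hτ, map_neg, hσ, neg_neg]

/-- For `x ∈ L` moved by `σ`, the element `x - σx` is fixed by the normal subgroup attached to `L`
and negated by its complement. Its square is the required `d`. -/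
lemma exists_eq_adjoinSqrt {L : IntermediateField K Ω} (hL : Module.finrank K L = 2) :
    ∃ d : K, ¬ IsSquare d ∧ L = adjoinSqrt d := by
  rw [IntermediateField.finrank_eq_fixingSubgroup_index] at hL
  have hN : L.fixingSubgroup.Normal := Subgroup.normal_of_index_eq_two hL
  obtain ⟨σ, hσ, hall⟩ := Subgroup.index_eq_two_iff_exists_notMem_and'.mp hL
  have hσ' := hσ
  rw [IntermediateField.mem_fixingSubgroup_iff] at hσ'
  push Not at hσ'
  obtain ⟨x, hx, hxσ⟩ := hσ'
  have hfix (τ : Ω ≃ₐ[K] Ω) (hτ : τ ∈ L.fixingSubgroup) : τ (x - σ x) = x - σ x := by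
    have h := hN.conj_mem τ hτ σ⁻¹
    rw [inv_inv] at h
    have h' := (IntermediateField.mem_fixingSubgroup_iff _ _).mp h x hx
    rw [AlgEquiv.mul_apply, AlgEquiv.mul_apply] at h'
    have h'' : τ (σ x) = σ x := (AlgEquiv.symm_apply_eq σ).mp h'
    rw [map_sub, h'', (IntermediateField.mem_fixingSubgroup_iff _ _).mp hτ x hx]
  have hσσ : σ (σ x) = x := by
    have h := (hall σ).resolve_right hσ
    exact (IntermediateField.mem_fixingSubgroup_iff _ _).mp h x hx
  have hneg : σ (x - σ x) = -(x - σ x) := by rw [map_sub, hσσ, neg_sub]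
  have hne : x - σ x ≠ 0 := sub_ne_zero.mpr (Ne.symm hxσ)
  have hne' : -(x - σ x) ≠ x - σ x := fun h => hne (self_eq_neg.mp h.symm)
  have hnot (τ : Ω ≃ₐ[K] Ω) (hτ : τ ∉ L.fixingSubgroup) : τ (x - σ x) = -(x - σ x) := by
    have h := hfix _ ((hall τ).resolve_right hτ)
    rw [AlgEquiv.mul_apply] at h
    apply σ.injective
    rw [h, map_neg, hneg, neg_neg]
  obtain ⟨d, hd⟩ : ∃ d : K, algebraMap K Ω d = (x - σ x) ^ 2 := by
    refine exists_algebraMap_eq_of_fixed fun τ => ?_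
    rw [map_pow]
    by_cases hτ : τ ∈ L.fixingSubgroup
    · rw [hfix τ hτ]
    · rw [hnot τ hτ, neg_sq]
  refine ⟨d, ?_, fixingSubgroup_injective ?_⟩
  · rintro ⟨y, rfl⟩
    rw [← sq, map_pow] at hd
    rcases sq_eq_sq_iff_eq_or_eq_neg.mp hd with h | h
    · rw [← h, AlgEquiv.commutes] at hneg
      rw [← h] at hne'
      exact hne' hneg.symm
    · rw [← neg_neg (x - σ x), ← h, map_neg, AlgEquiv.commutes, neg_neg] at hneg
      rw [← neg_neg (x - σ x), ← h, neg_neg] at hne'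
      exact hne' hneg.symm
  · ext τ
    rw [mem_fixingSubgroup_adjoinSqrt hd.symm]
    by_cases hτ : τ ∈ L.fixingSubgroup
    · exact iff_of_true hτ (hfix τ hτ)
    · exact iff_of_false hτ (by rw [hnot τ hτ]; exact hne')

variable {p : ℕ} [Fact p.Prime] {E : WeierstrassCurve K}
  (b : Module.Basis (Fin 2) (ZMod p) (Torsion E p))

include b in
omit [CharZero K] in
lemma finite_torsion : Finite (Torsion E p) := Finite.of_equiv _ b.equivFun.symm.toEquiv

-- The coordinates of the finitely many torsion points generate a finite extension, and whatever
-- fixes it acts trivially on `E[p]`.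
omit [CharZero K] in
lemma isOpen_ker_rhoBar : IsOpen ((rhoBar E p b).ker : Set (Ω ≃ₐ[K] Ω)) := by
  classical
  have := finite_torsion b
  let coords : Torsion E p → Set Ω := fun P => match P.1 with
    | .zero => ∅
    | .some x y _ => {x, y}
  have hfin : (⋃ P, coords P).Finite := by
    refine Set.finite_iUnion fun P => ?_
    rcases P with ⟨_ | ⟨x, y, h⟩, hP⟩
    · exact Set.finite_empty
    · exact Set.toFinite {x, y}
  have := hfin.to_subtype
  have hfd : FiniteDimensional K (IntermediateField.adjoin K (⋃ P, coords P)) :=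
    IntermediateField.finiteDimensional_adjoin
      fun x _ => (Algebra.IsAlgebraic.isAlgebraic x).isIntegral
  refine Subgroup.isOpen_mono (H₁ := (IntermediateField.adjoin K (⋃ P, coords P)).fixingSubgroup)
    (fun σ hσ => ?_) (IntermediateField.fixingSubgroup_isOpen _)
  rw [IntermediateField.mem_fixingSubgroup_iff] at hσ
  have hσ' (P : Torsion E p) (x : Ω) (hx : x ∈ coords P) : σ x = x :=
    hσ x (IntermediateField.subset_adjoin _ _ (Set.mem_iUnion.mpr ⟨P, hx⟩))
  rw [MonoidHom.mem_ker]
  ext1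
  rw [val_rhoBar, Units.val_one, ← map_one (LinearMap.toMatrixAlgEquiv b)]
  congr 1
  ext P : 1
  apply Subtype.ext
  have hP := hσ' P
  rcases P with ⟨_ | ⟨x, y, h⟩, hP'⟩
  · rfl
  · exact (Affine.Point.some.injEq ..).mpr ⟨hP x (Or.inl rfl), hP y (Or.inr rfl)⟩

/-- The sign character is continuous, and non-trivial by (S), so its kernel is a closed subgroup of
index 2. -/
lemma exists_quadratic_of_signCommutes (hp : p ≠ 2) (hS : ConditionS (rhoBar E p b).range)
    {γ : Matrix (Fin 2) (Fin 2) (ZMod p)} (hγ : Traceless γ)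
    (hG : SignCommutes (rhoBar E p b).range γ) : ∃ d : K, ¬ IsSquare d ∧
      (commutant γ).comap (rhoBar E p b) = (adjoinSqrt d).fixingSubgroup := by
  set H := (commutant γ).comap (rhoBar E p b) with hH
  have hopen : IsOpen (H : Set (Ω ≃ₐ[K] Ω)) :=
    Subgroup.isOpen_mono (Subgroup.ker_le_comap _ _) (isOpen_ker_rhoBar b)
  have hclosed : IsClosed (H : Set (Ω ≃ₐ[K] Ω)) := Subgroup.isClosed_of_isOpen _ hopen
  have hfix := InfiniteGalois.fixingSubgroup_fixedField (⟨H, hclosed⟩ : ClosedSubgroup (Ω ≃ₐ[K] Ω))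
  change (IntermediateField.fixedField H).fixingSubgroup = H at hfix
  have h2 : Module.finrank K (IntermediateField.fixedField H) = 2 := by
    rw [IntermediateField.finrank_eq_fixingSubgroup_index, hfix,
      Subgroup.index_eq_two_iff_exists_notMem_and']
    obtain ⟨_, ⟨σ, rfl⟩, hσ⟩ := hS.exists_anticommute hp hγ hG
    have hσ' : rhoBar E p b σ ∉ commutant γ :=
      hγ.not_commute_of_anticommute (two_ne_zero_of_ne_two hp) hσ
    refine ⟨σ, hσ', fun τ => ?_⟩
    rw [hH, Subgroup.mem_comap, Subgroup.mem_comap, map_mul,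
      mul_mem_commutant_iff hG ⟨σ, rfl⟩ ⟨τ, rfl⟩]
    simp [hσ', em']
  obtain ⟨d, hd, hL⟩ := exists_eq_adjoinSqrt h2
  exact ⟨d, hd, by rw [← hL, hfix]⟩

end QuadraticFields

/-! ### The unique non-trivial twist split by a quadratic extension -/

section AttachedTwist

variable {K : Type*} [Field K] [CharZero K]

local notation "Ω" => AlgebraicClosure K

variable {E E' : WeierstrassCurve K}

omit [CharZero K] in
lemma scaling_baseChange_iff {L : Type*} [Field L] [Algebra K L] {v : K} :
    Scaling (E.baseChange L) (E'.baseChange L) (algebraMap K L v) ↔ Scaling E E' v := by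
  constructor <;> rintro ⟨h₁, h₂, h₃⟩
  · rw [baseChange_c₄, baseChange_c₄, ← map_pow, ← map_mul] at h₂
    rw [baseChange_c₆, baseChange_c₆, ← map_pow, ← map_mul] at h₃
    exact ⟨(map_ne_zero _).mp h₁, (algebraMap K L).injective h₂, (algebraMap K L).injective h₃⟩
  · refine ⟨(map_ne_zero _).mpr h₁, ?_, ?_⟩
    · rw [baseChange_c₄, baseChange_c₄, h₂, map_mul, map_pow]
    · rw [baseChange_c₆, baseChange_c₆, h₃, map_mul, map_pow]

lemma isoOver_self_iff : IsoOver K E E' ↔ ∃ v : K, Scaling E E' v := by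
  refine (exists_smul_eq_iff_exists_scaling (E.baseChange K) (E'.baseChange K)).trans ?_
  exact exists_congr fun v => scaling_baseChange_iff (L := K) (v := v)

lemma isoOver_iff (L : IntermediateField K Ω) :
    IsoOver L E E' ↔ ∃ u ∈ L, Scaling (E.baseChange Ω) (E'.baseChange Ω) u := by
  refine (exists_smul_eq_iff_exists_scaling (E.baseChange L) (E'.baseChange L)).trans ?_
  have key (u : L) : Scaling (E.baseChange L) (E'.baseChange L) u ↔
      Scaling (E.baseChange Ω) (E'.baseChange Ω) u := by
    constructor <;> rintro ⟨h₁, h₂, h₃⟩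
    · refine ⟨fun h => h₁ (Subtype.ext h), ?_, ?_⟩
      · have := congrArg (algebraMap L Ω) h₂
        rwa [baseChange_c₄, baseChange_c₄, map_mul, map_pow, ← IsScalarTower.algebraMap_apply,
          ← IsScalarTower.algebraMap_apply, ← baseChange_c₄, ← baseChange_c₄] at this
      · have := congrArg (algebraMap L Ω) h₃
        rwa [baseChange_c₆, baseChange_c₆, map_mul, map_pow, ← IsScalarTower.algebraMap_apply,
          ← IsScalarTower.algebraMap_apply, ← baseChange_c₆, ← baseChange_c₆] at this
    · refine ⟨fun h => h₁ (by rw [h]; rfl), ?_, ?_⟩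
      · apply (algebraMap L Ω).injective
        rw [baseChange_c₄, baseChange_c₄, map_mul, map_pow, ← IsScalarTower.algebraMap_apply,
          ← IsScalarTower.algebraMap_apply, ← baseChange_c₄, ← baseChange_c₄]
        exact h₂
      · apply (algebraMap L Ω).injective
        rw [baseChange_c₆, baseChange_c₆, map_mul, map_pow, ← IsScalarTower.algebraMap_apply,
          ← IsScalarTower.algebraMap_apply, ← baseChange_c₆, ← baseChange_c₆]
        exact h₃
  constructor
  · rintro ⟨u, hu⟩
    exact ⟨u, u.2, (key u).mp hu⟩
  · rintro ⟨u, huL, hu⟩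
    exact ⟨⟨u, huL⟩, (key ⟨u, huL⟩).mpr hu⟩

lemma c₄_quadraticTwist (E : WeierstrassCurve K) (d : K) :
    (quadraticTwist E d).c₄ = d ^ 2 * E.c₄ := by
  simp only [quadraticTwist, c₄, c₆, b₂, b₄]
  ring

lemma c₆_quadraticTwist (E : WeierstrassCurve K) (d : K) :
    (quadraticTwist E d).c₆ = d ^ 3 * E.c₆ := by
  simp only [quadraticTwist, c₄, c₆, b₂, b₄, b₆]
  ring

lemma c₄_quarticTwist (E : WeierstrassCurve K) (u : K) :
    (quarticTwist E u).c₄ = u * E.c₄ := by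
  simp only [quarticTwist, c₄, b₂, b₄]
  ring

lemma c₆_quarticTwist (E : WeierstrassCurve K) (u : K) : (quarticTwist E u).c₆ = 0 := by
  simp only [quarticTwist, c₆, b₂, b₄, b₆]
  ring

omit [CharZero K] in
lemma j_eq_1728_iff [E.IsElliptic] : E.j = 1728 ↔ E.c₆ = 0 := by
  have hrel := E.c_relation
  have hΔ : E.Δ ≠ 0 := E.isUnit_Δ.ne_zero
  have hj : E.j * E.Δ = E.c₄ ^ 3 := by
    rw [j, ← coe_Δ', mul_comm, Units.mul_inv_cancel_left]
  constructor
  · intro h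
    rw [h] at hj
    exact pow_eq_zero_iff two_ne_zero |>.mp (by linear_combination hrel - hj)
  · intro h
    rw [h] at hrel
    exact mul_right_cancel₀ hΔ (by linear_combination hj - hrel)

lemma c₄_ne_zero_or_c₆_ne_zero [E.IsElliptic] : E.c₄ ≠ 0 ∨ E.c₆ ≠ 0 := by
  by_contra! h
  have hrel := E.c_relation
  rw [h.1, h.2] at hrel
  have hΔ : E.Δ ≠ 0 := E.isUnit_Δ.ne_zero
  have : (1728 : K) ≠ 0 := by norm_num
  exact mul_ne_zero this hΔ (by rw [hrel]; ring)

variable {d : K} {δ : AlgebraicClosure K}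

omit [CharZero K] in
lemma attachedTwist_cases (E : WeierstrassCurve K) [E.IsElliptic] (d : K) :
    (attachedTwist E d = quadraticTwist E d ∧ (E.c₆ = 0 → ¬ IsSquare (-d))) ∨
      (attachedTwist E d = quarticTwist E (-4) ∧ E.c₆ = 0 ∧ IsSquare (-d)) := by
  rw [attachedTwist]
  split_ifs with h
  · exact Or.inr ⟨rfl, j_eq_1728_iff.mp h.1, h.2⟩
  · exact Or.inl ⟨rfl, fun h₁ h₂ => h ⟨j_eq_1728_iff.mpr h₁, h₂⟩⟩

lemma scaling_quadraticTwist (E : WeierstrassCurve K) (hd : ¬ IsSquare d)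
    (hδ : δ ^ 2 = algebraMap K Ω d) :
    Scaling (E.baseChange Ω) ((quadraticTwist E d).baseChange Ω) δ := by
  refine ⟨sqrt_ne_zero hd hδ, ?_, ?_⟩
  · rw [baseChange_c₄, baseChange_c₄, c₄_quadraticTwist, map_mul, map_pow, ← hδ]
    ring
  · rw [baseChange_c₆, baseChange_c₆, c₆_quadraticTwist, map_mul, map_pow, ← hδ]
    ring

omit [CharZero K] in
/-- If `-d` is a square, then `K(√d)` contains a square root of `-1` on which the Galois group acts
as on `√d`. -/
lemma exists_sqrt_neg_one (hd : ¬ IsSquare d) (hδ : δ ^ 2 = algebraMap K Ω d)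
    (hd' : IsSquare (-d)) : ∃ (ι : Ω) (m : K), ι ^ 2 = -1 ∧ m ≠ 0 ∧ δ = algebraMap K Ω m * ι := by
  obtain ⟨m, hm⟩ := hd'
  have hm0 : m ≠ 0 := by
    rintro rfl
    apply hd
    rw [← neg_neg d, hm]
    simp
  have hm0' : algebraMap K Ω m ≠ 0 := (map_ne_zero _).mpr hm0
  refine ⟨(algebraMap K Ω m)⁻¹ * δ, m, ?_, hm0, by rw [mul_inv_cancel_left₀ hm0']⟩
  have : algebraMap K Ω d = -(algebraMap K Ω m * algebraMap K Ω m) := by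
    rw [← map_mul, ← hm, map_neg, neg_neg]
  rw [mul_pow, hδ, this]
  field_simp

lemma one_add_ne_zero_of_sq {ι : Ω} (hι : ι ^ 2 = -1) : 1 + ι ≠ 0 := by
  intro h
  have : (2 : Ω) = 0 := by linear_combination (1 - ι) * h + hι
  exact two_ne_zero this

lemma scaling_quarticTwist (hE : E.c₆ = 0) {ι : AlgebraicClosure K} (hι : ι ^ 2 = -1) :
    Scaling (E.baseChange Ω) ((quarticTwist E (-4)).baseChange Ω) (1 + ι) := by
  refine ⟨one_add_ne_zero_of_sq hι, ?_, ?_⟩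
  · rw [baseChange_c₄, baseChange_c₄, c₄_quarticTwist, map_mul, map_neg, map_ofNat]
    linear_combination -(ι ^ 2 + 4 * ι + 5) * (algebraMap K Ω E.c₄) * hι
  · rw [baseChange_c₆, baseChange_c₆, c₆_quarticTwist, hE, map_zero, mul_zero]

lemma isTwistOver_attachedTwist [E.IsElliptic] (hd : ¬ IsSquare d) :
    IsTwistOver (adjoinSqrt d) E (attachedTwist E d) := by
  obtain ⟨δ, hδ⟩ := exists_sqrt d
  have hd0 : d ≠ 0 := by
    rintro rfl
    exact hd IsSquare.zero
  rw [IsTwistOver, isoOver_iff, isoOver_self_iff]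
  rcases attachedTwist_cases E d with ⟨h, h'⟩ | ⟨h, hE, hd'⟩ <;> rw [h]
  · refine ⟨⟨δ, sqrt_mem_adjoinSqrt hδ, scaling_quadraticTwist E hd hδ⟩, ?_⟩
    rintro ⟨v, hv0, hv4, hv6⟩
    rw [c₄_quadraticTwist] at hv4
    rw [c₆_quadraticTwist] at hv6
    by_cases hE : E.c₆ = 0
    · have h4 := (c₄_ne_zero_or_c₆_ne_zero (E := E)).resolve_right (not_not.mpr hE)
      have : (v ^ 2) ^ 2 = d ^ 2 := by linear_combination -(mul_right_cancel₀ h4 hv4)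
      rcases sq_eq_sq_iff_eq_or_eq_neg.mp this with h | h
      · exact hd ⟨v, by rw [← h, sq]⟩
      · exact h' hE ⟨v, by rw [← sq, h]⟩
    · have := mul_right_cancel₀ hE hv6
      refine hd ⟨v ^ 3 / d, ?_⟩
      field_simp
      linear_combination this
  · obtain ⟨ι, m, hι, hm, hδι⟩ := exists_sqrt_neg_one hd hδ hd'
    refine ⟨⟨1 + ι, add_mem (one_mem _) ?_, scaling_quarticTwist hE hι⟩, ?_⟩
    · have : ι = algebraMap K Ω m⁻¹ * δ := by
        rw [hδι, ← mul_assoc, ← map_mul, inv_mul_cancel₀ hm, map_one, one_mul]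
      rw [this]
      exact mul_mem (IntermediateField.algebraMap_mem _ _) (sqrt_mem_adjoinSqrt hδ)
    · rintro ⟨v, hv0, hv4, -⟩
      rw [c₄_quarticTwist] at hv4
      have h4 := (c₄_ne_zero_or_c₆_ne_zero (E := E)).resolve_right (not_not.mpr hE)
      have h5 := mul_right_cancel₀ h4 hv4
      -- Factorisation of `v⁴ + 4`: a fourth root of `-4` in `K` would give a square root of `-1`,
      -- making `d` a square.
      have h6 : ((v + 1) ^ 2 + 1) * ((v - 1) ^ 2 + 1) = 0 := by linear_combination -h5
      have key (w : K) (hw : w ^ 2 + 1 = 0) : False := by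
        obtain ⟨m, hm⟩ := hd'
        exact hd ⟨w * m, by linear_combination -hm - m ^ 2 * hw⟩
      rcases mul_eq_zero.mp h6 with h | h
      exacts [key _ h, key _ h]

/-- The twists split by `K(√d)`. -/
lemma isoOver_attachedTwist_of_isTwistOver [E.IsElliptic] (hd : ¬ IsSquare d)
    (h : IsTwistOver (adjoinSqrt d) E E') : IsoOver K (attachedTwist E d) E' := by
  obtain ⟨δ, hδ⟩ := exists_sqrt d
  obtain ⟨σ, hσ⟩ := exists_galois_sqrt_eq_neg hd hδ
  have hd0 : d ≠ 0 := by
    rintro rfl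
    exact hd IsSquare.zero
  rw [IsTwistOver, isoOver_iff, isoOver_self_iff] at h
  obtain ⟨⟨u, huL, hu⟩, hK⟩ := h
  have hσu0 : σ u ≠ 0 := (map_ne_zero σ).mpr hu.1
  have hu0 := hu.1
  have hσσ := galois_galois_eq hδ σ huL
  have e4 := hu.2
  have e6 := hu.3
  have s4 := (hu.galois σ).2
  have s6 := (hu.galois σ).3
  rw [baseChange_c₄, baseChange_c₄] at e4 s4
  rw [baseChange_c₆, baseChange_c₆] at e6 s6
  have hfixed {w : Ω} (hw : Scaling (E.baseChange Ω) (E'.baseChange Ω) w) (hwL : w ∈ adjoinSqrt d) :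
      σ w ≠ w := by
    intro hσw
    obtain ⟨v, rfl⟩ := exists_algebraMap_eq_of_mem_adjoinSqrt hδ hσ hwL hσw
    exact hK ⟨v, scaling_baseChange_iff.mp hw⟩
  -- an antisymmetric scaling gives the quadratic twist
  have hquad {w : Ω} (hw : Scaling (E.baseChange Ω) (E'.baseChange Ω) w)
      (hwL : w ∈ adjoinSqrt d) (hσw : σ w = -w) :
      ∃ v, Scaling (quadraticTwist E d) E' v := by
    obtain ⟨v, hv⟩ := exists_algebraMap_eq_of_mem_adjoinSqrt (x := w * δ⁻¹) hδ hσ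
      (mul_mem hwL (inv_mem (sqrt_mem_adjoinSqrt hδ))) (by rw [map_mul, map_inv₀, hσ, hσw]; simp)
    refine ⟨v, (scaling_baseChange_iff (L := Ω)).mp ?_⟩
    rw [hv]
    exact (scaling_quadraticTwist E hd hδ).inv.mul hw
  have hquad' {w : Ω} (hw : Scaling (E.baseChange Ω) (E'.baseChange Ω) w)
      (hwL : w ∈ adjoinSqrt d) (hσw : σ w = -w) : IsoOver K (attachedTwist E d) E' := by
    obtain ⟨v, hv⟩ := hquad hw hwL hσw
    rw [isoOver_self_iff]
    rcases attachedTwist_cases E d with ⟨h, h'⟩ | ⟨h, hE, m, hm⟩ <;> rw [h]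
    · exact ⟨v, hv⟩
    · have hm0 : m ≠ 0 := by
        rintro rfl
        exact hd0 (by linear_combination -hm)
      -- Here `d = -m²` and `c₆ = 0`, so the quadratic twist by `d` is already isomorphic to `E`
      -- over `K`.
      refine absurd ⟨v * m, mul_ne_zero hv.1 hm0, ?_, ?_⟩ hK
      · rw [hv.2, c₄_quadraticTwist, ← neg_neg d, hm]
        ring
      · rw [hv.3, c₆_quadraticTwist, hE]
        ring
  by_cases h6 : E.c₆ = 0
  · have h4 := (c₄_ne_zero_or_c₆_ne_zero (E := E)).resolve_right (not_not.mpr h6)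
    have h4' : algebraMap K Ω E.c₄ ≠ 0 := (map_ne_zero _).mpr h4
    have : (σ u ^ 2) ^ 2 = (u ^ 2) ^ 2 := by
      linear_combination mul_right_cancel₀ h4' (s4.symm.trans e4)
    rcases sq_eq_sq_iff_eq_or_eq_neg.mp this with h | h
    · rcases sq_eq_sq_iff_eq_or_eq_neg.mp h with h | h
      · exact absurd h (hfixed hu huL)
      · exact hquad' hu huL h
    -- This ratio is a square root of `-1` negated by `σ`, so `K(√d) = K(√-1)`. Dividing `u` by `1 -
    -- ζ`, a fourth root of `-4`, makes it fixed by `σ`.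
    · set ζ := σ u / u with hζ
      have hζ2 : ζ ^ 2 = -1 := by rw [hζ, div_pow, h]; field_simp
      have hσζ : σ ζ = -ζ := by
        rw [hζ, map_div₀, hσσ]
        field_simp
        linear_combination h
      have hζL : ζ ∈ adjoinSqrt d := div_mem (galois_mem_adjoinSqrt hδ σ huL) huL
      have hσu : σ u = ζ * u := by rw [hζ]; field_simp
      have hd' : IsSquare (-d) := by
        obtain ⟨m, hm⟩ := exists_algebraMap_eq_of_mem_adjoinSqrt (x := ζ * δ) hδ hσ
          (mul_mem hζL (sqrt_mem_adjoinSqrt hδ)) (by rw [map_mul, hσζ, hσ]; ring)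
        refine ⟨m, (algebraMap K Ω).injective ?_⟩
        rw [map_mul, hm, map_neg, ← hδ]
        linear_combination -δ ^ 2 * hζ2
      have hat : attachedTwist E d = quarticTwist E (-4) := by
        rcases attachedTwist_cases E d with ⟨h, h'⟩ | ⟨h, -, -⟩
        · exact absurd hd' (h' h6)
        · exact h
      have hnζ2 : (-ζ) ^ 2 = -1 := by rw [neg_sq, hζ2]
      have hn0 := one_add_ne_zero_of_sq hnζ2
      have hn0' := one_add_ne_zero_of_sq hζ2
      obtain ⟨v, hv⟩ := exists_algebraMap_eq_of_mem_adjoinSqrt (x := u * (1 + -ζ)⁻¹) hδ hσ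
        (mul_mem huL (inv_mem (add_mem (one_mem _) (neg_mem hζL)))) (by
          rw [map_mul, map_inv₀, map_add, map_one, map_neg, hσζ, neg_neg, hσu]
          field_simp
          linear_combination -hζ2)
      rw [isoOver_self_iff, hat]
      refine ⟨v, (scaling_baseChange_iff (L := Ω)).mp ?_⟩
      rw [hv]
      exact (scaling_quarticTwist h6 hnζ2).inv.mul hu
  · have h6' : algebraMap K Ω E.c₆ ≠ 0 := (map_ne_zero _).mpr h6
    have hp6 : σ u ^ 6 = u ^ 6 := mul_right_cancel₀ h6' (s6.symm.trans e6)
    by_cases h4 : E.c₄ = 0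
    -- Here `j = 0`, and `u` may be changed by a sixth root of unity. With `ζ = σu/u`, the choice `w
    -- = ζ²u` gives `σw = ζ⁻³w = ±w`.
    · set w := σ u ^ 2 / u with hw
      have hwL : w ∈ adjoinSqrt d := div_mem (pow_mem (galois_mem_adjoinSqrt hδ σ huL) 2) huL
      have hsw : Scaling (E.baseChange Ω) (E'.baseChange Ω) w := by
        refine ⟨div_ne_zero (pow_ne_zero 2 hσu0) hu0, ?_, ?_⟩
        · rw [baseChange_c₄, baseChange_c₄, e4, h4, map_zero, mul_zero, mul_zero]
        · have : w ^ 6 = u ^ 6 := by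
            rw [hw, div_pow, ← pow_mul, mul_comm 2 6, pow_mul, hp6]
            field_simp
          rw [baseChange_c₆, baseChange_c₆, e6, this]
      have hσw : σ w = u ^ 2 / σ u := by rw [hw, map_div₀, map_pow, hσσ]
      have hcube : (σ u ^ 3) ^ 2 = (u ^ 3) ^ 2 := by linear_combination hp6
      rcases sq_eq_sq_iff_eq_or_eq_neg.mp hcube with h | h
      · refine absurd ?_ (hfixed hsw hwL)
        rw [hσw, hw]
        field_simp
        linear_combination -h
      · refine hquad' hsw hwL ?_
        rw [hσw, hw]
        field_simp
        linear_combination h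
    · have h4' : algebraMap K Ω E.c₄ ≠ 0 := (map_ne_zero _).mpr h4
      have hp4 : σ u ^ 4 = u ^ 4 := mul_right_cancel₀ h4' (s4.symm.trans e4)
      have : σ u ^ 2 = u ^ 2 := by
        apply mul_left_cancel₀ (pow_ne_zero 4 hu0)
        linear_combination hp6 - σ u ^ 2 * hp4
      rcases sq_eq_sq_iff_eq_or_eq_neg.mp this with h | h
      · exact absurd h (hfixed hu huL)
      · exact hquad' hu huL h

end AttachedTwist

/-! ### From trace-zero matrices to congruent twists and back -/

section CongruentTwists

variable {K : Type*} [Field K] [CharZero K]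

local notation "Ω" => AlgebraicClosure K

variable {E E' : WeierstrassCurve K} {p : ℕ} [Fact p.Prime]
  (b : Module.Basis (Fin 2) (ZMod p) (Torsion E p)) {d : K} {δ u : AlgebraicClosure K}

omit [CharZero K] in
lemma traceless_of_sqrt_signs (hp : p ≠ 2) (hδ : δ ^ 2 = algebraMap K Ω d)
    (hne : -δ ≠ δ) {σ₀ : Ω ≃ₐ[K] Ω} (hσ₀ : σ₀ δ = -δ) (A : GL (Fin 2) (ZMod p))
    (hpos : ∀ σ : Ω ≃ₐ[K] Ω, σ δ = δ → (rhoBar E p b σ).val * A.val = A.val * (rhoBar E p b σ).val)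
    (hneg : ∀ σ : Ω ≃ₐ[K] Ω, σ δ = -δ →
      (rhoBar E p b σ).val * A.val = -(A.val * (rhoBar E p b σ).val)) :
    Traceless A.val ∧ SignCommutes (rhoBar E p b).range A.val ∧
      (commutant A.val).comap (rhoBar E p b) = (adjoinSqrt d).fixingSubgroup := by
  have h2 := two_ne_zero_of_ne_two hp
  have hA : Traceless A.val := traceless_of_anticommute_right h2 (hneg σ₀ hσ₀)
  refine ⟨hA, ?_, ?_⟩
  · rintro _ ⟨σ, rfl⟩
    exact (galois_sqrt hδ σ).imp (hpos σ) (hneg σ)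
  · ext σ
    rw [Subgroup.mem_comap, mem_fixingSubgroup_adjoinSqrt hδ]
    rcases galois_sqrt hδ σ with h | h
    · exact iff_of_true (hpos σ h) h
    · exact iff_of_false (hA.not_commute_of_anticommute h2 (hneg σ h)) (by rwa [h])

lemma Scaling.of_sq_eq_neg_one (hE : E.c₆ = 0) {ι : AlgebraicClosure K} (hι : ι ^ 2 = -1) :
    Scaling (E.baseChange Ω) (E.baseChange Ω) ι := by
  refine ⟨?_, ?_, ?_⟩
  · rintro rfl
    have : (1 : Ω) = 0 := by linear_combination hι
    exact one_ne_zero this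
  · linear_combination -(ι ^ 2 - 1) * (E.baseChange Ω).c₄ * hι
  · rw [baseChange_c₆, hE, map_zero, mul_zero]

lemma autMatrix_mul_self_of_sq_eq_neg_one {ι : AlgebraicClosure K} (hι : ι ^ 2 = -1)
    (h : Scaling (E.baseChange Ω) (E.baseChange Ω) ι) :
    autMatrix b h * autMatrix b h = -1 := by
  rw [autMatrix_mul b h h (h.mul h) rfl]
  exact autMatrix_neg_one b _ (by rw [← sq, hι])

lemma autMatrix_neg {v : AlgebraicClosure K} (h : Scaling (E.baseChange Ω) (E.baseChange Ω) u)
    (h' : Scaling (E.baseChange Ω) (E.baseChange Ω) v) (hv : v = -u) :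
    autMatrix b h' = -autMatrix b h := by
  rw [← autMatrix_mul b h (Scaling.one _).neg h' (by rw [hv]; ring), autMatrix_neg_one b _ rfl,
    neg_mul, one_mul]

/-- For the quadratic twist `A = γ` works, the cocycle being the commutation sign. In the quartic
case the cocycle takes the values `1` and `(1 - ι)/(1 + ι) = -ι`. -/
lemma congruent_attachedTwist [E.IsElliptic] (hp : p ≠ 2) (hd : ¬ IsSquare d)
    {γ : Matrix (Fin 2) (Fin 2) (ZMod p)} (hγ : Traceless γ)
    (hG : SignCommutes (rhoBar E p b).range γ)
    (hC : (commutant γ).comap (rhoBar E p b) = (adjoinSqrt d).fixingSubgroup) :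
    Congruent p E (attachedTwist E d) := by
  have h2 := two_ne_zero_of_ne_two hp
  obtain ⟨δ, hδ⟩ := exists_sqrt d
  have hδ0 := sqrt_ne_zero hd hδ
  rcases attachedTwist_cases E d with ⟨h, -⟩ | ⟨h, hE, hd'⟩ <;> rw [h]
  · rw [congruent_iff_of_scaling b (scaling_quadraticTwist E hd hδ)]
    obtain ⟨A, rfl⟩ := hγ.isUnit
    refine ⟨A, fun σ => ?_⟩
    have hiff : rhoBar E p b σ ∈ commutant A.val ↔ σ δ = δ := by
      rw [← mem_fixingSubgroup_adjoinSqrt hδ, ← hC, Subgroup.mem_comap]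
    rcases galois_sqrt hδ σ with hσ | hσ
    · rw [autMatrix_one b _ (by rw [hσ, inv_mul_cancel₀ hδ0]), one_mul]
      exact (hiff.mpr hσ).symm
    · rw [autMatrix_neg_one b _ (by rw [hσ, mul_neg, inv_mul_cancel₀ hδ0]), neg_one_mul,
        (hG _ ⟨σ, rfl⟩).resolve_left fun h' => neg_sqrt_ne hd hδ (hσ.symm.trans (hiff.mp h')),
        neg_neg]
  · obtain ⟨ι, m, hι, hm, hδι⟩ := exists_sqrt_neg_one hd hδ hd'
    rw [congruent_iff_of_scaling b (scaling_quarticTwist hE hι)]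
    have hs := Scaling.of_sq_eq_neg_one hE hι
    set J := autMatrix b hs with hJ
    have hJJ : J * J = -1 := autMatrix_mul_self_of_sq_eq_neg_one b hι hs
    have hu := one_add_ne_zero_of_sq hι
    -- When `σ` moves `ι`, one has `ρJ = -Jρ`, and `-J(1 + J) = 1 - J` gives the congruence
    -- relation. Invertibility uses `(1 - J)(1 + J) = 2`.
    let A : GL (Fin 2) (ZMod p) := ⟨1 - J, (2 : ZMod p)⁻¹ • (1 + J), by
      rw [mul_smul_comm, show (1 - J) * (1 + J) = (2 : ZMod p) • 1 by
        rw [sub_mul, mul_add, mul_add, hJJ, two_smul, mul_one, mul_one, one_mul]; abel, inv_smul_smul₀ h2], by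
      rw [smul_mul_assoc, show (1 + J) * (1 - J) = (2 : ZMod p) • 1 by
        rw [add_mul, mul_sub, mul_sub, hJJ, two_smul, mul_one, mul_one, one_mul]; abel, inv_smul_smul₀ h2]⟩
    refine ⟨A, fun σ => ?_⟩
    have hισ : σ ι = ι ∨ σ ι = -ι := by
      rw [← sq_eq_sq_iff_eq_or_eq_neg, ← map_pow, hι, map_neg, map_one]
    change (1 - J) * _ = _ * (_ * (1 - J))
    rcases hισ with hσ | hσ
    · rw [autMatrix_one b _ (by rw [map_add, map_one, hσ, inv_mul_cancel₀ hu]), one_mul,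
        sub_mul, mul_sub, one_mul, mul_one, hJ, rhoBar_mul_autMatrix b hs hs σ hσ]
    · rw [autMatrix_neg b hs ((scaling_quarticTwist hE hι).cocycle σ) (by
        rw [map_add, map_one, hσ]
        field_simp
        linear_combination hι), ← hJ, mul_sub, mul_one, hJ,
        rhoBar_mul_autMatrix b hs hs.neg σ hσ, autMatrix_neg b hs hs.neg rfl, ← hJ, sub_mul,
        one_mul, mul_sub, ← mul_assoc, neg_mul_neg, hJJ]
      simp [sub_eq_add_neg, add_comm]

/-- For the quadratic twist the congruence matrix `A` itself has the required signs. For the quartic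
twist the matrix of the automorphism `ι` does, since Galois acts on `ι` as on `√d`. -/
lemma exists_traceless_of_congruent [E.IsElliptic] (hp : p ≠ 2) (hd : ¬ IsSquare d)
    (hE' : IsTwistOver (adjoinSqrt d) E E') (hc : Congruent p E E') :
    ∃ γ : Matrix (Fin 2) (Fin 2) (ZMod p), Traceless γ ∧
      SignCommutes (rhoBar E p b).range γ ∧
      (commutant γ).comap (rhoBar E p b) = (adjoinSqrt d).fixingSubgroup := by
  obtain ⟨δ, hδ⟩ := exists_sqrt d
  obtain ⟨σ₀, hσ₀⟩ := exists_galois_sqrt_eq_neg hd hδ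
  have hδ0 := sqrt_ne_zero hd hδ
  have hne := neg_sqrt_ne hd hδ
  have hiso := isoOver_attachedTwist_of_isTwistOver hd hE'
  rw [isoOver_self_iff] at hiso
  obtain ⟨v, hv⟩ := hiso
  rcases attachedTwist_cases E d with ⟨h, -⟩ | ⟨h, hE, hd'⟩
  · rw [h] at hv
    have hs := (scaling_quadraticTwist E hd hδ).mul ((scaling_baseChange_iff (L := Ω)).mpr hv)
    have hv0 : algebraMap K Ω v ≠ 0 := (map_ne_zero _).mpr hv.1
    rw [congruent_iff_of_scaling b hs] at hc
    obtain ⟨A, hA⟩ := hc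
    refine ⟨A.val, traceless_of_sqrt_signs b hp hδ hne hσ₀ A (fun σ hσ => ?_) (fun σ hσ => ?_)⟩
    · rw [hA, autMatrix_one b _ (by
        rw [map_mul, hσ, AlgEquiv.commutes, inv_mul_cancel₀ (mul_ne_zero hv0 hδ0)]), one_mul]
    · rw [hA, autMatrix_neg_one b _ (by
        rw [map_mul, hσ, AlgEquiv.commutes, mul_neg, mul_neg,
          inv_mul_cancel₀ (mul_ne_zero hv0 hδ0)]), neg_one_mul, neg_neg]
  · obtain ⟨ι, m, hι, hm, hδι⟩ := exists_sqrt_neg_one hd hδ hd'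
    have hm0 : algebraMap K Ω m ≠ 0 := (map_ne_zero _).mpr hm
    have hs := Scaling.of_sq_eq_neg_one hE hι
    have hJJ := autMatrix_mul_self_of_sq_eq_neg_one b hι hs
    let J : GL (Fin 2) (ZMod p) := ⟨autMatrix b hs, -autMatrix b hs,
      by rw [mul_neg, hJJ, neg_neg], by rw [neg_mul, hJJ, neg_neg]⟩
    refine ⟨J.val, traceless_of_sqrt_signs b hp hδ hne hσ₀ J (fun σ hσ => ?_) (fun σ hσ => ?_)⟩
    · refine rhoBar_mul_autMatrix b hs hs σ ?_
      rw [hδι, map_mul, AlgEquiv.commutes] at hσ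
      exact mul_left_cancel₀ hm0 hσ
    · have hσι : σ ι = -ι := by
        rw [hδι, map_mul, AlgEquiv.commutes, ← mul_neg] at hσ
        exact mul_left_cancel₀ hm0 hσ
      refine (rhoBar_mul_autMatrix b hs hs.neg σ hσι).trans ?_
      rw [autMatrix_neg b hs hs.neg rfl, neg_mul]

-- A non-zero fixed point has short `X`-coordinate zero, so non-zero fixed points agree up to sign.
-- Comparing `2P` with `P` gives `P = 0`, `2P = 0` or `3P = 0`.
open scoped Classical in
lemma torsion_eq_zero_of_fixed (hp : p ≠ 2) (hp3 : p ≠ 3)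
    (h : Scaling (E.baseChange Ω) (E.baseChange Ω) u) (hu : u ^ 2 ≠ 1) (P : Torsion E p)
    (hP : torsionHom p h P = P) : P = 0 := by
  have key (Q Q' : Torsion E p) (hQ : torsionHom p h Q = Q) (hQ' : torsionHom p h Q' = Q') :
      Q = 0 ∨ Q' = 0 ∨ Q = Q' ∨ Q = -Q' := by
    have hX {x y : Ω} (hxy : (E.baseChange Ω).toAffine.Nonsingular x y)
        (hfix : h.pointHom (.some _ _ hxy) = .some _ _ hxy) : shortX (E.baseChange Ω) x = 0 := by
      have e := ((Affine.Point.some.injEq ..).mp hfix).1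
      have e' := congrArg (shortX (E.baseChange Ω)) e
      rw [shortX_scaleX] at e'
      have : (u ^ 2 - 1) * shortX (E.baseChange Ω) x = 0 := by linear_combination e'
      exact (mul_eq_zero.mp this).resolve_left (sub_ne_zero.mpr hu)
    have e := congrArg Subtype.val hQ
    have e' := congrArg Subtype.val hQ'
    obtain ⟨_ | ⟨x, y, hxy⟩, hQt⟩ := Q
    · exact Or.inl (Subtype.ext rfl)
    obtain ⟨_ | ⟨x', y', hxy'⟩, hQt'⟩ := Q'
    · exact Or.inr (Or.inl (Subtype.ext rfl))
    right; right
    have hx : x = x' := shortX_injective _ ((hX hxy e).trans (hX hxy' e').symm)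
    exact (Affine.Point.X_eq_iff.mp hx).imp Subtype.ext Subtype.ext
  have h2 : (2 : ZMod p) ≠ 0 := two_ne_zero_of_ne_two hp
  have h3 : (3 : ZMod p) ≠ 0 := by
    intro h
    have : (p : ℕ) ∣ 3 := (ZMod.natCast_eq_zero_iff 3 p).mp (by exact_mod_cast h)
    exact hp3 ((Nat.prime_dvd_prime_iff_eq Fact.out Nat.prime_three).mp this)
  rcases key (P + P) P (by rw [map_add, hP]) hP with h' | h' | h' | h'
  · rw [← two_smul (ZMod p)] at h'
    exact (smul_eq_zero.mp h').resolve_left h2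
  · exact h'
  · simpa using h'
  · have : (3 : ZMod p) • P = 0 := by
      rw [show (3 : ZMod p) = 1 + 1 + 1 by norm_num, add_smul, add_smul, one_smul, h',
        neg_add_cancel]
    exact (smul_eq_zero.mp this).resolve_left h3

/-- The sum of the orbit of a point under an automorphism of order 3 is fixed by it, hence zero. -/
lemma autMatrix_of_pow_three_eq_one (hp : p ≠ 2) (hp3 : p ≠ 3)
    (h : Scaling (E.baseChange Ω) (E.baseChange Ω) u) (hu : u ^ 3 = 1) (hu1 : u ≠ 1) :
    autMatrix b h * autMatrix b h = -autMatrix b h - 1 := by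
  have hu2 : u ^ 2 ≠ 1 := by
    intro h2
    apply hu1
    linear_combination hu - u * h2
  have hT (P : Torsion E p) : torsionHom p h (torsionHom p h (torsionHom p h P)) = P := by
    rw [torsionHom_torsionHom h h (h.mul h) rfl, torsionHom_torsionHom h (h.mul h)
      ((h.mul (h.mul h))) rfl]
    exact torsionHom_one _ (by rw [← hu]; ring) P
  have hsum (P : Torsion E p) : torsionHom p h (torsionHom p h P) + torsionHom p h P + P = 0 := by
    apply torsion_eq_zero_of_fixed hp hp3 h hu2
    rw [map_add, map_add, hT]
    abel
  have hmat : autMatrix b h * autMatrix b h + autMatrix b h + 1 = 0 := by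
    rw [autMatrix, ← map_mul, ← map_add, ← map_one (LinearMap.toMatrixAlgEquiv b), ← map_add,
      ← map_zero (LinearMap.toMatrixAlgEquiv b)]
    congr 1
    ext P : 1
    exact hsum P
  rw [eq_sub_iff_add_eq, eq_neg_iff_add_eq_zero, add_right_comm]
  exact hmat

/-- Here `u` is a root of unity of order 4, 3 or 6, with `t = u + u⁻¹` equal to `0`, `-1` or `1`.
The discriminant `t² - 4` is `-4` or `-3`; it vanishes modulo `p` only for `p = 3` and `j = 0`. -/
lemma exists_autMatrix_quadratic_relation [E.IsElliptic] (hp : p ≠ 2) (h3 : p = 3 → E.c₄ ≠ 0)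
    (h : Scaling (E.baseChange Ω) (E.baseChange Ω) u) (hu : u ^ 2 ≠ 1) :
    ∃ t : ℤ, u ^ 2 = t * u - 1 ∧ autMatrix b h * autMatrix b h = (t : ZMod p) • autMatrix b h - 1 ∧
      (t : ZMod p) ^ 2 ≠ 4 := by
  have h2 : (2 : ZMod p) ≠ 0 := two_ne_zero_of_ne_two hp
  have e4 := h.2
  have e6 := h.3
  rw [baseChange_c₄] at e4
  rw [baseChange_c₆] at e6
  by_cases h6 : E.c₆ = 0
  · have h4 := (c₄_ne_zero_or_c₆_ne_zero (E := E)).resolve_right (not_not.mpr h6)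
    have h4' : algebraMap K Ω E.c₄ ≠ 0 := (map_ne_zero _).mpr h4
    have hu4 : (u ^ 2 - 1) * (u ^ 2 + 1) = 0 := by
      apply mul_right_cancel₀ h4'
      linear_combination -e4
    have hι : u ^ 2 = -1 := by
      linear_combination (mul_eq_zero.mp hu4).resolve_left (sub_ne_zero.mpr hu)
    refine ⟨0, by rw [hι]; simp, ?_, ?_⟩
    · rw [autMatrix_mul_self_of_sq_eq_neg_one b hι h]
      simp
    · intro h0
      apply mul_ne_zero h2 h2
      rw [Int.cast_zero] at h0
      linear_combination -h0
  · have h6' : algebraMap K Ω E.c₆ ≠ 0 := (map_ne_zero _).mpr h6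
    have hu6 : u ^ 6 = 1 := by
      apply mul_right_cancel₀ h6'
      linear_combination -e6
    have h4 : E.c₄ = 0 := by
      by_contra h4
      have h4' : algebraMap K Ω E.c₄ ≠ 0 := (map_ne_zero _).mpr h4
      have hu4 : u ^ 4 = 1 := by
        apply mul_right_cancel₀ h4'
        linear_combination -e4
      exact hu (by linear_combination hu6 - u ^ 2 * hu4)
    have hp3 : p ≠ 3 := fun hp3 => h3 hp3 h4
    have h3' : (3 : ZMod p) ≠ 0 := by
      intro h
      have : (p : ℕ) ∣ 3 := (ZMod.natCast_eq_zero_iff 3 p).mp (by exact_mod_cast h)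
      exact hp3 ((Nat.prime_dvd_prime_iff_eq Fact.out Nat.prime_three).mp this)
    have hu3 : (u ^ 3) ^ 2 = 1 ^ 2 := by linear_combination hu6
    rcases sq_eq_sq_iff_eq_or_eq_neg.mp hu3 with hc | hc
    · have hu1 : u ≠ 1 := fun h1 => hu (by rw [h1, one_pow])
      refine ⟨-1, ?_, ?_, ?_⟩
      · apply mul_left_cancel₀ (sub_ne_zero.mpr hu1)
        push_cast
        linear_combination hc
      · rw [autMatrix_of_pow_three_eq_one b hp hp3 h hc hu1]
        simp
      · intro h0
        apply h3'
        push_cast at h0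
        linear_combination -h0
    · have hu1 : -u ≠ 1 := fun h1 => hu (by rw [← neg_sq, h1, one_pow])
      refine ⟨1, ?_, ?_, ?_⟩
      · apply mul_left_cancel₀ (sub_ne_zero.mpr hu1)
        push_cast
        linear_combination -hc
      · have := autMatrix_of_pow_three_eq_one b hp hp3 h.neg
          (by linear_combination -hc) hu1
        rw [autMatrix_neg b h h.neg rfl, neg_mul_neg, neg_neg] at this
        rw [this]
        simp
      · intro h0
        apply h3'
        push_cast at h0
        linear_combination -h0

/-- The matrix is `γ = 2M - t`, with `γ² = t² - 4`. Galois sends `u` to `u` or `u⁻¹`, hence `M` to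
`M` or `t - M`, and `γ` to `±γ`. -/
lemma signCommutes_of_autMatrix [E.IsElliptic] (hp : p ≠ 2) (h3 : p = 3 → E.c₄ ≠ 0)
    (h : Scaling (E.baseChange Ω) (E.baseChange Ω) u)
    (hns : ∀ c : ZMod p, autMatrix b h ≠ c • 1) :
    ∃ γ : Matrix (Fin 2) (Fin 2) (ZMod p), Traceless γ ∧ SignCommutes (rhoBar E p b).range γ := by
  have hu2 : u ^ 2 ≠ 1 := by
    intro h0
    rcases sq_eq_sq_iff_eq_or_eq_neg.mp (h0.trans (one_pow 2).symm) with h1 | h1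
    · exact hns 1 (by rw [autMatrix_one b h h1, one_smul])
    · exact hns (-1) (by rw [autMatrix_neg_one b h h1, neg_smul, one_smul])
  obtain ⟨t, hut, hMt, ht⟩ := exists_autMatrix_quadratic_relation b hp h3 h hu2
  have hu0 := h.1
  set M := autMatrix b h with hM
  set τ : ZMod p := (t : ZMod p) with hτ
  have hinv : (t : Ω) - u = u⁻¹ := by
    field_simp
    linear_combination -hut
  have hMinv : autMatrix b h.inv = τ • 1 - M := by
    have h1 : autMatrix b h.inv * M = 1 := by
      rw [hM, autMatrix_mul b h h.inv (Scaling.one _) (inv_mul_cancel₀ hu0)]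
      exact autMatrix_one b _ rfl
    have h5 : M * (τ • 1 - M) = 1 := by
      rw [mul_sub, hMt, mul_smul_comm, mul_one]
      abel
    calc autMatrix b h.inv = autMatrix b h.inv * (M * (τ • 1 - M)) := by rw [h5, mul_one]
      _ = τ • 1 - M := by rw [← mul_assoc, h1, one_mul]
  -- If the trace differed from `τ`, subtracting Cayley–Hamilton from the quadratic relation would
  -- make `M` scalar.
  have htr : M 0 0 + M 1 1 = τ := by
    by_contra hne
    have hCH := matrix_mul_self M
    rw [hMt] at hCH
    have hsub : τ - (M 0 0 + M 1 1) ≠ 0 := sub_ne_zero.mpr (Ne.symm hne)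
    have h5 : (τ - (M 0 0 + M 1 1)) • M = (1 - M.det) • (1 : Matrix (Fin 2) (Fin 2) (ZMod p)) := by
      rw [sub_smul, sub_smul, one_smul, sub_eq_sub_iff_add_eq_add, ← sub_eq_sub_iff_add_eq_add,
        sub_eq_sub_iff_add_eq_add, add_comm (1 : Matrix (Fin 2) (Fin 2) (ZMod p)),
        ← sub_eq_sub_iff_add_eq_add]
      exact hCH
    refine hns ((τ - (M 0 0 + M 1 1))⁻¹ * (1 - M.det)) ?_
    rw [mul_smul, ← h5, inv_smul_smul₀ hsub]
  set γ := (2 : ZMod p) • M - τ • (1 : Matrix (Fin 2) (Fin 2) (ZMod p)) with hγ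
  have hγ00 : γ 0 0 = 2 * M 0 0 - τ := by simp [hγ]
  have hγ11 : γ 1 1 = 2 * M 1 1 - τ := by simp [hγ]
  have hγtr : γ 1 1 = -γ 0 0 := by
    rw [hγ00, hγ11]
    linear_combination 2 * htr
  have hγγ : γ * γ = (τ ^ 2 - 4) • (1 : Matrix (Fin 2) (Fin 2) (ZMod p)) := by
    rw [hγ]
    simp only [sub_mul, mul_sub, smul_mul_assoc, mul_smul_comm, mul_one, one_mul, hMt]
    module
  refine ⟨γ, ⟨hγtr, fun hdet => ?_⟩, ?_⟩
  · rw [matrix_mul_self, hγtr, hdet, add_neg_cancel, zero_smul, zero_smul, sub_zero] at hγγ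
    have := congrFun (congrFun hγγ 0) 0
    simp at this
    exact ht (by linear_combination -this)
  · rintro _ ⟨σ, rfl⟩
    have hσ : σ u = u ∨ σ u = u⁻¹ := by
      have e := congrArg σ hut
      rw [map_sub, map_mul, map_pow, map_intCast, map_one] at e
      have : (σ u - u) * (σ u - (t - u)) = 0 := by linear_combination e - hut
      rcases mul_eq_zero.mp this with h | h
      · exact Or.inl (sub_eq_zero.mp h)
      · exact Or.inr ((sub_eq_zero.mp h).trans hinv)
    rw [hγ, mul_sub, sub_mul, mul_smul_comm, mul_smul_comm, smul_mul_assoc, smul_mul_assoc,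
      mul_one, one_mul]
    rcases hσ with hσ | hσ
    · left
      rw [hM, rhoBar_mul_autMatrix b h h σ hσ]
    · right
      rw [hM, rhoBar_mul_autMatrix b h h.inv σ hσ, hMinv, ← hM, sub_mul, smul_mul_assoc, one_mul]
      module

lemma exists_traceless_of_isTwist [E.IsElliptic] (hp : p ≠ 2) (h3 : p = 3 → E.c₄ ≠ 0)
    (hE' : IsTwist E E') (hc : Congruent p E E') :
    ∃ γ : Matrix (Fin 2) (Fin 2) (ZMod p), Traceless γ ∧ SignCommutes (rhoBar E p b).range γ := by
  have h2 : (2 : ZMod p) ≠ 0 := two_ne_zero_of_ne_two hp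
  obtain ⟨u, hu⟩ := (exists_smul_eq_iff_exists_scaling _ _).mp hE'.1
  have hu0 := hu.1
  have hK := hE'.2
  rw [isoOver_self_iff] at hK
  by_cases hns : ∃ σ : Ω ≃ₐ[K] Ω, ∀ c : ZMod p, autMatrix b (hu.cocycle σ) ≠ c • 1
  · obtain ⟨σ, hσ⟩ := hns
    exact signCommutes_of_autMatrix b hp h3 _ hσ
  push Not at hns
  obtain ⟨A, hA⟩ := (congruent_iff_of_scaling b hu).mp hc
  -- Determinants in `A ρ(σ) = c ρ(σ) A` give `c² = 1`.
  have hsign (σ : Ω ≃ₐ[K] Ω) : autMatrix b (hu.cocycle σ) = 1 ∨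
      autMatrix b (hu.cocycle σ) = -1 := by
    obtain ⟨c, hc⟩ := hns σ
    have h5 := congrArg Matrix.det (hA σ)
    rw [hc, smul_mul_assoc, one_mul, Matrix.det_smul, Matrix.det_mul, Matrix.det_mul,
      Fintype.card_fin, mul_comm A.val.det] at h5
    have hne : (rhoBar E p b σ).val.det * A.val.det ≠ 0 :=
      mul_ne_zero ((Matrix.isUnit_iff_isUnit_det _).mp (rhoBar E p b σ).isUnit).ne_zero
        ((Matrix.isUnit_iff_isUnit_det _).mp A.isUnit).ne_zero
    have hc2 : c ^ 2 = 1 ^ 2 := mul_right_cancel₀ hne (by rw [← h5]; ring)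
    rcases sq_eq_sq_iff_eq_or_eq_neg.mp hc2 with rfl | rfl
    · exact Or.inl (by rw [hc, one_smul])
    · exact Or.inr (by rw [hc, neg_smul, one_smul])
  obtain ⟨σ, hσ⟩ : ∃ σ : Ω ≃ₐ[K] Ω, σ u ≠ u := by
    by_contra! hall
    obtain ⟨v, rfl⟩ := exists_algebraMap_eq_of_fixed hall
    exact hK ⟨v, scaling_baseChange_iff.mp hu⟩
  have hσ1 : autMatrix b (hu.cocycle σ) ≠ 1 := by
    intro h1
    have hζ : u⁻¹ * σ u ≠ 1 := by
      intro h0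
      apply hσ
      rw [inv_mul_eq_one₀ hu0] at h0
      exact h0.symm
    by_cases hζ2 : (u⁻¹ * σ u) ^ 2 = 1
    · rcases sq_eq_sq_iff_eq_or_eq_neg.mp (hζ2.trans (one_pow 2).symm) with h0 | h0
      · exact hζ h0
      · rw [autMatrix_neg_one b _ h0] at h1
        have := congrFun (congrFun h1 0) 0
        simp at this
        exact h2 (by linear_combination -this)
    -- If this automorphism acted trivially, the relation would read `1 = t - 1`, contradicting `t²
    -- ≠ 4`.
    · obtain ⟨t, -, hMt, ht⟩ := exists_autMatrix_quadratic_relation b hp h3 (hu.cocycle σ) hζ2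
      rw [h1] at hMt
      have := congrFun (congrFun hMt 0) 0
      simp at this
      apply ht
      have ht2 : (t : ZMod p) = 2 := by linear_combination -this
      rw [ht2]
      norm_num
  refine ⟨A.val, traceless_of_anticommute_right h2 (g := rhoBar E p b σ) ?_, ?_⟩
  · rw [hA, (hsign σ).resolve_left hσ1, neg_one_mul, neg_neg]
  · rintro _ ⟨τ, rfl⟩
    rw [hA τ]
    rcases hsign τ with h | h <;> rw [h]
    · left
      rw [one_mul]
    · right
      rw [neg_one_mul, neg_neg]

end CongruentTwists

/-! ### The case `j = 1728`, and comparison of twists from different fields -/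

section ThreeTwists

variable {K : Type*} [Field K]

local notation "Ω" => AlgebraicClosure K

lemma exists_rat_galois_eq_neg [NumberField K] {ι : AlgebraicClosure K} (hι : ι ^ 2 = -1) :
    ∃ τ : Ω ≃ₐ[ℚ] Ω, τ ι = -ι := by
  have : Algebra.IsAlgebraic ℚ Ω := Algebra.IsAlgebraic.trans ℚ K Ω
  have : IsAlgClosure ℚ Ω := ⟨inferInstance, inferInstance⟩
  have : Normal ℚ Ω := IsAlgClosure.normal ℚ Ω
  have : IsGalois ℚ Ω := ⟨⟩
  by_contra! h
  have hfix (τ : Ω ≃ₐ[ℚ] Ω) : τ ι = ι := by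
    have : τ ι = ι ∨ τ ι = -ι := by
      rw [← sq_eq_sq_iff_eq_or_eq_neg, ← map_pow, hι, map_neg, map_one]
    exact this.resolve_right (h τ)
  obtain ⟨q, rfl⟩ := (InfiniteGalois.mem_range_algebraMap_iff_fixed ι).mpr hfix
  rw [← map_pow, ← map_one (algebraMap ℚ Ω), ← map_neg] at hι
  have := (algebraMap ℚ Ω).injective hι
  nlinarith [sq_nonneg q]

variable {E E' : WeierstrassCurve K} {p : ℕ} [Fact p.Prime]

open scoped Classical in
/-- The automorphism of order four of a curve with `j = 1728` is not a homothety on `E[p]`: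
the curve has a model over `ℚ`, and there are automorphisms that move the square root of `-1`. -/
lemma autMatrix_ne_smul_one_of_sq_eq_neg_one [NumberField K] [E.IsElliptic] (hp : p ≠ 2)
    (b : Module.Basis (Fin 2) (ZMod p) (Torsion E p)) (hE : E.c₆ = 0)
    {ι : AlgebraicClosure K} (hι : ι ^ 2 = -1)
    (h : Scaling (E.baseChange Ω) (E.baseChange Ω) ι) (c : ZMod p) : autMatrix b h ≠ c • 1 := by
  intro hc
  have h2 : (2 : ZMod p) ≠ 0 := two_ne_zero_of_ne_two hp
  obtain ⟨τ, hτ⟩ := exists_rat_galois_eq_neg hι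
  let E₀ : WeierstrassCurve ℚ := ⟨0, 0, 0, 1, 0⟩
  have h4 := (c₄_ne_zero_or_c₆_ne_zero (E := E)).resolve_right (not_not.mpr hE)
  have h4' : algebraMap K Ω E.c₄ ≠ 0 := (map_ne_zero _).mpr h4
  have e4 : E₀.c₄ = -48 := by simp only [E₀, c₄, b₂, b₄]; norm_num
  have e6 : E₀.c₆ = 0 := by simp only [E₀, c₆, b₂, b₄, b₆]; norm_num
  have e4' : (E₀.baseChange Ω).c₄ = -48 := by rw [baseChange_c₄, e4, map_neg, map_ofNat]
  have e6' : (E₀.baseChange Ω).c₆ = 0 := by rw [baseChange_c₆, e6, map_zero]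
  have hι0 : ι ≠ 0 := h.1
  have hs₀ : Scaling (E₀.baseChange Ω) (E₀.baseChange Ω) ι := by
    refine ⟨hι0, ?_, by rw [e6', mul_zero]⟩
    linear_combination -(ι ^ 2 - 1) * (E₀.baseChange Ω).c₄ * hι
  -- This `w` scales `E` to the rational model `Y² = X³ + X`, for which `c₄ = -48`.
  obtain ⟨w, hw⟩ := IsAlgClosed.exists_pow_nat_eq (-48 / algebraMap K Ω E.c₄) (n := 4) (by norm_num)
  have hw0 : w ≠ 0 := by
    rintro rfl
    rw [zero_pow four_ne_zero, eq_comm, div_eq_zero_iff] at hw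
    exact hw.elim (by norm_num) h4'
  have hs : Scaling (E.baseChange Ω) (E₀.baseChange Ω) w := by
    refine ⟨hw0, ?_, ?_⟩
    · rw [e4', baseChange_c₄, hw, div_mul_cancel₀ _ h4']
    · rw [e6', baseChange_c₆, hE, map_zero, mul_zero]
  have hc' (P : Torsion E p) : torsionHom p h P = c.val • P := by
    have h5 : (torsionHom p h).toZModLinearMap p = c • LinearMap.id := by
      apply (LinearMap.toMatrixAlgEquiv b).injective
      rw [map_smul]
      refine hc.trans ?_
      congr 1
      exact (map_one (LinearMap.toMatrixAlgEquiv b)).symm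
    have h6 : torsionHom p h P = c • P := LinearMap.congr_fun h5 P
    rw [h6, ← Nat.cast_smul_eq_nsmul (ZMod p), ZMod.natCast_zmod_val]
  have hQ (Q : (E₀.baseChange Ω).toAffine.Point) (hpQ : p • Q = 0) :
      hs₀.pointHom Q = c.val • Q := by
    let P : Torsion E p := ⟨hs.inv.pointHom Q, AddSubgroup.torsionBy.nsmul_iff.mpr (by
      rw [← map_nsmul, hpQ, map_zero])⟩
    have hP : hs.pointHom P.1 = Q :=
      (hs.inv.pointHom_pointHom hs (Scaling.one _) (mul_inv_cancel₀ hw0) Q).trans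
        (Scaling.pointHom_one _ _)
    have h5 : h.pointHom P.1 = c.val • P.1 := congrArg Subtype.val (hc' P)
    have h6 := congrArg hs.pointHom h5
    rw [map_nsmul, hP, h.pointHom_pointHom hs (h.mul hs) rfl] at h6
    rw [← h6, ← hs.pointHom_pointHom hs₀ (h.mul hs) (mul_comm _ _), hP]
  let P := b 0
  have hpP : p • P.1 = 0 := AddSubgroup.torsionBy.nsmul_iff.mp P.2
  set Q := hs.pointHom P.1 with hQdef
  have hpQ : p • Q = 0 := by rw [hQdef, ← map_nsmul, hpP, map_zero]
  let T := Affine.Point.map (W' := E₀.toAffine) (τ : Ω →ₐ[ℚ] Ω)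
  -- Over `ℚ`, `τ` conjugates the automorphism `ι` to `-ι`. If `ι` acted as the homothety `c`, this
  -- would give `2c = 0` on `p`-torsion.
  have h7 : T (hs₀.pointHom Q) = hs₀.neg.pointHom (T Q) :=
    hs₀.map_pointHom τ hs₀.neg hτ Q
  have h8 : hs₀.neg.pointHom (T Q) = -(hs₀.pointHom (T Q)) := by
    rw [← hs₀.pointHom_pointHom (Scaling.one _).neg hs₀.neg (by ring), Scaling.pointHom_neg_one]
  have hpTQ : p • T Q = 0 := by rw [← map_nsmul, hpQ, map_zero]
  rw [h8, hQ Q hpQ, hQ _ hpTQ, map_nsmul, eq_neg_iff_add_eq_zero, ← map_nsmul, ← map_add,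
    ← map_zero T] at h7
  have h9 := Affine.Point.map_injective (τ : Ω →ₐ[ℚ] Ω) h7
  rw [hQdef, ← map_nsmul, ← map_add] at h9
  have h10 := congrArg hs.inv.pointHom h9
  rw [map_zero, hs.pointHom_pointHom hs.inv (Scaling.one _) (inv_mul_cancel₀ hw0),
    Scaling.pointHom_one] at h10
  have h11 : c.val • P + c.val • P = 0 := Subtype.ext h10
  rw [← Nat.cast_smul_eq_nsmul (ZMod p), ZMod.natCast_zmod_val, ← two_smul (ZMod p)] at h11
  have h12 := ((smul_eq_zero.mp h11).resolve_left h2)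
  have hc0 : c ≠ 0 := by
    rintro rfl
    have h13 := autMatrix_mul_self_of_sq_eq_neg_one b hι h
    rw [hc, zero_smul, zero_mul] at h13
    have := congrFun (congrFun h13 0) 0
    simp at this
  exact b.ne_zero 0 ((smul_eq_zero.mp h12).resolve_left hc0)

/-- The matrix `J` of the automorphism `ι` satisfies `J² = -1` and is not scalar, so it has trace
zero. It commutes with `ρ(σ)` when `σ` fixes `ι` and anticommutes otherwise; were `-1` a square in
`K`, the image would lie in the Cartan subgroup of `J`, against (S). -/
lemma comap_commutant_of_j_eq_1728 [NumberField K] [E.IsElliptic] (hp : p ≠ 2)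
    (b : Module.Basis (Fin 2) (ZMod p) (Torsion E p)) (hS : ConditionS (rhoBar E p b).range)
    (hE : E.c₆ = 0) : ¬ IsSquare (-1 : K) ∧
      ∃ γ : Matrix (Fin 2) (Fin 2) (ZMod p), Traceless γ ∧
      SignCommutes (rhoBar E p b).range γ ∧
      (commutant γ).comap (rhoBar E p b) = (adjoinSqrt (-1 : K)).fixingSubgroup := by
  obtain ⟨ι, hι'⟩ := exists_sqrt (-1 : K)
  have hι : ι ^ 2 = -1 := by rw [hι', map_neg, map_one]
  have hs := Scaling.of_sq_eq_neg_one hE hι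
  have hJJ := autMatrix_mul_self_of_sq_eq_neg_one b hι hs
  let J : GL (Fin 2) (ZMod p) := ⟨autMatrix b hs, -autMatrix b hs,
    by rw [mul_neg, hJJ, neg_neg], by rw [neg_mul, hJJ, neg_neg]⟩
  have hpos (σ : Ω ≃ₐ[K] Ω) (hσ : σ ι = ι) :
      (rhoBar E p b σ).val * J.val = J.val * (rhoBar E p b σ).val :=
    rhoBar_mul_autMatrix b hs hs σ hσ
  have hneg (σ : Ω ≃ₐ[K] Ω) (hσ : σ ι = -ι) :
      (rhoBar E p b σ).val * J.val = -(J.val * (rhoBar E p b σ).val) := by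
    refine (rhoBar_mul_autMatrix b hs hs.neg σ hσ).trans ?_
    rw [autMatrix_neg b hs hs.neg rfl, neg_mul]
  have hJ : Traceless J.val := by
    refine ⟨?_, ((Matrix.isUnit_iff_isUnit_det _).mp J.isUnit).ne_zero⟩
    by_contra hne
    have htr : J.val 0 0 + J.val 1 1 ≠ 0 := fun h0 => hne (by linear_combination h0)
    have hCH := matrix_mul_self J.val
    have hJJ' : J.val * J.val = -1 := hJJ
    rw [hJJ', eq_sub_iff_add_eq] at hCH
    refine autMatrix_ne_smul_one_of_sq_eq_neg_one hp b hE hι hs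
      ((J.val 0 0 + J.val 1 1)⁻¹ * (J.val.det - 1)) ?_
    rw [mul_smul, sub_smul, one_smul, sub_eq_neg_add, hCH, inv_smul_smul₀ htr]
  have hsq : ¬ IsSquare (-1 : K) := by
    rintro ⟨m, hm⟩
    refine hS.not_le_commutant hp hJ ?_
    rintro _ ⟨σ, rfl⟩
    refine hpos σ ?_
    have : ι ^ 2 = (algebraMap K Ω m) ^ 2 := by rw [hι', hm, map_mul, sq]
    rcases sq_eq_sq_iff_eq_or_eq_neg.mp this with h | h
    · rw [h, AlgEquiv.commutes]
    · rw [h, map_neg, AlgEquiv.commutes]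
  obtain ⟨σ₀, hσ₀⟩ := exists_galois_sqrt_eq_neg hsq hι'
  exact ⟨hsq, J.val, traceless_of_sqrt_signs b hp hι' (neg_sqrt_ne hsq hι') hσ₀ J hpos hneg⟩

variable [CharZero K]

lemma isoOver_iff_mk_eq : IsoOver K E E' ↔
    (Quotient.mk _ E : MulAction.orbitRel.Quotient (VariableChange K) (WeierstrassCurve K)) =
      Quotient.mk _ E' := by
  rw [Quotient.eq, MulAction.orbitRel_apply, isoOver_self_iff]
  have h (F : WeierstrassCurve K) : F ∈ MulAction.orbit (VariableChange K) E' ↔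
      ∃ c : VariableChange K, c • E' = F := Iff.rfl
  rw [h, exists_smul_eq_iff_exists_scaling]
  exact ⟨fun ⟨u, hu⟩ => ⟨_, hu.inv⟩, fun ⟨u, hu⟩ => ⟨_, hu.inv⟩⟩

lemma adjoinSqrt_eq_of_isSquare_mul {d d' : K} (hd : d ≠ 0) (hd' : d' ≠ 0)
    (h : IsSquare (d * d')) : adjoinSqrt d = adjoinSqrt d' := by
  obtain ⟨δ, hδ⟩ := exists_sqrt d
  obtain ⟨m, hm⟩ := h
  have hm0 : m ≠ 0 := by
    rintro rfl
    exact mul_ne_zero hd hd' (by rw [hm, mul_zero])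
  have hδ' : (algebraMap K Ω (m / d) * δ) ^ 2 = algebraMap K Ω d' := by
    rw [mul_pow, hδ, ← map_pow, ← map_mul]
    congr 1
    field_simp
    linear_combination -hm
  apply fixingSubgroup_injective
  ext σ
  rw [mem_fixingSubgroup_adjoinSqrt hδ, mem_fixingSubgroup_adjoinSqrt hδ', map_mul,
    AlgEquiv.commutes, (mul_right_injective₀ _).eq_iff]
  exact (map_ne_zero _).mpr (div_ne_zero hm0 hd)

lemma isSquare_mul_of_isoOver_quadraticTwist {d d' : K} (hd : d ≠ 0) (hd' : d' ≠ 0)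
    (hE : E.c₆ ≠ 0) (h : IsoOver K (quadraticTwist E d) (quadraticTwist E d')) :
    IsSquare (d * d') := by
  obtain ⟨v, hv0, -, hv⟩ := isoOver_self_iff.mp h
  rw [c₆_quadraticTwist, c₆_quadraticTwist, ← mul_assoc] at hv
  have := mul_right_cancel₀ hE hv
  refine ⟨v ^ 3 * d ^ 2 / d', ?_⟩
  field_simp
  linear_combination this

omit [CharZero K] in
lemma comap_eq_comap_iff {b : Module.Basis (Fin 2) (ZMod p) (Torsion E p)}
    {C C' : Subgroup (GL (Fin 2) (ZMod p))} :
    C.comap (rhoBar E p b) = C'.comap (rhoBar E p b) ↔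
      (rhoBar E p b).range ⊓ C = (rhoBar E p b).range ⊓ C' := by
  constructor
  · intro h
    rw [← Subgroup.map_comap_eq, h, Subgroup.map_comap_eq]
  · intro h
    ext σ
    simpa [Subgroup.mem_inf] using SetLike.ext_iff.mp h (rhoBar E p b σ)

end ThreeTwists

/-! ### Counting fields and twists -/

section Classification

variable {K : Type*} [Field K] [CharZero K]

local notation "Ω" => AlgebraicClosure K

lemma isSquare_mul_of_adjoinSqrt_eq {d d' : K} (h : adjoinSqrt d = adjoinSqrt d') :
    IsSquare (d * d') := by
  obtain ⟨δ, hδ⟩ := exists_sqrt d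
  obtain ⟨δ', hδ'⟩ := exists_sqrt d'
  obtain ⟨m, hm⟩ := exists_algebraMap_eq_of_fixed (x := δ * δ') fun σ => by
    have hσ : σ δ = δ ↔ σ δ' = δ' := by
      rw [← mem_fixingSubgroup_adjoinSqrt hδ, h, mem_fixingSubgroup_adjoinSqrt hδ']
    rw [map_mul]
    rcases galois_sqrt hδ σ with h₁ | h₁ <;> rcases galois_sqrt hδ' σ with h₂ | h₂
    · rw [h₁, h₂]
    · rw [hσ.mp h₁, h₁]
    · rw [hσ.mpr h₂, h₂]
    · rw [h₁, h₂, neg_mul_neg]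
  refine ⟨m, (algebraMap K Ω).injective ?_⟩
  rw [map_mul, map_mul, hm, ← hδ, ← hδ']
  ring

lemma isSquare_mul_mul_of_fixingSubgroup {d d' d'' : K}
    (h : ∀ σ : Ω ≃ₐ[K] Ω, σ ∈ (adjoinSqrt d'').fixingSubgroup ↔
      (σ ∈ (adjoinSqrt d).fixingSubgroup ↔ σ ∈ (adjoinSqrt d').fixingSubgroup)) :
    IsSquare (d * d' * d'') := by
  obtain ⟨δ, hδ⟩ := exists_sqrt d
  obtain ⟨δ', hδ'⟩ := exists_sqrt d'
  obtain ⟨δ'', hδ''⟩ := exists_sqrt d''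
  obtain ⟨m, hm⟩ := exists_algebraMap_eq_of_fixed (x := δ * δ' * δ'') fun σ => by
    have hσ := h σ
    rw [mem_fixingSubgroup_adjoinSqrt hδ, mem_fixingSubgroup_adjoinSqrt hδ',
      mem_fixingSubgroup_adjoinSqrt hδ''] at hσ
    rw [map_mul, map_mul]
    rcases galois_sqrt hδ σ with h₁ | h₁ <;> rcases galois_sqrt hδ' σ with h₂ | h₂
    · rw [hσ.mpr (iff_of_true h₁ h₂), h₁, h₂]
    · rcases galois_sqrt hδ'' σ with h₃ | h₃
      · rw [(hσ.mp h₃).mp h₁, h₁, h₃]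
      · rw [h₁, h₂, h₃]
        ring
    · rcases galois_sqrt hδ'' σ with h₃ | h₃
      · rw [(hσ.mp h₃).mpr h₂, h₂, h₃]
      · rw [h₁, h₂, h₃]
        ring
    · by_cases h₄ : σ δ = δ ↔ σ δ' = δ'
      · rw [hσ.mpr h₄, h₁, h₂, neg_mul_neg]
      · have h₅ : (-δ = δ ↔ -δ' = δ') ↔ (δ = 0 ↔ δ' = 0) := by
          rw [neg_eq_self, neg_eq_self]
        rw [h₁, h₂, h₅] at h₄
        by_cases h₆ : δ = 0
        · simp [h₆]
        · have : δ' = 0 := by tauto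
          simp [this]
  refine ⟨m, (algebraMap K Ω).injective ?_⟩
  rw [map_mul, map_mul, map_mul, hm, ← hδ, ← hδ', ← hδ'']
  ring

variable {E E' : WeierstrassCurve K} [E.IsElliptic] {p : ℕ} [Fact p.Prime]
  {b : Module.Basis (Fin 2) (ZMod p) (Torsion E p)} {I : Type*} {d : I → K}
  {γ : I → Matrix (Fin 2) (Fin 2) (ZMod p)}

/-- The family `γ` lists all the sign characters of the image, and `d` their quadratic fields. It is
indexed by `Unit` when the character is unique and by `Fin 3` when the projective image has order 4.
-/
lemma exists_adjoinSqrt_eq (hp : p ≠ 2)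
    (hC : ∀ i, (commutant (γ i)).comap (rhoBar E p b) = (adjoinSqrt (d i)).fixingSubgroup)
    (hall : ∀ γ', Traceless γ' → SignCommutes (rhoBar E p b).range γ' →
      ∃ i, (rhoBar E p b).range ⊓ commutant γ' = (rhoBar E p b).range ⊓ commutant (γ i))
    {L : IntermediateField K Ω} (hL : Module.finrank K L = 2) (hE' : IsTwistOver L E E')
    (hc : Congruent p E E') : ∃ i, L = adjoinSqrt (d i) := by
  obtain ⟨d', hd', rfl⟩ := exists_eq_adjoinSqrt hL
  obtain ⟨γ', hγ', hG', hC'⟩ := exists_traceless_of_congruent b hp hd' hE' hc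
  obtain ⟨i, hi⟩ := hall γ' hγ' hG'
  refine ⟨i, fixingSubgroup_injective ?_⟩
  rw [← hC', ← hC, comap_eq_comap_iff, hi]

lemma congruenceFields_eq_range (hp : p ≠ 2) (hd : ∀ i, ¬ IsSquare (d i))
    (hγ : ∀ i, Traceless (γ i)) (hG : ∀ i, SignCommutes (rhoBar E p b).range (γ i))
    (hC : ∀ i, (commutant (γ i)).comap (rhoBar E p b) = (adjoinSqrt (d i)).fixingSubgroup)
    (hall : ∀ γ', Traceless γ' → SignCommutes (rhoBar E p b).range γ' →
      ∃ i, (rhoBar E p b).range ⊓ commutant γ' = (rhoBar E p b).range ⊓ commutant (γ i)) :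
    congruenceFields p E = Set.range fun i => adjoinSqrt (d i) := by
  ext L
  constructor
  · rintro ⟨hL, E', hE', hc⟩
    obtain ⟨i, rfl⟩ := exists_adjoinSqrt_eq hp hC hall hL hE' hc
    exact ⟨i, rfl⟩
  · rintro ⟨i, rfl⟩
    exact ⟨finrank_adjoinSqrt (hd i), _, isTwistOver_attachedTwist (hd i),
      congruent_attachedTwist b hp (hd i) (hγ i) (hG i) (hC i)⟩

lemma exists_isoOver_attachedTwist (hp : p ≠ 2) (hd : ∀ i, ¬ IsSquare (d i))
    (hC : ∀ i, (commutant (γ i)).comap (rhoBar E p b) = (adjoinSqrt (d i)).fixingSubgroup)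
    (hall : ∀ γ', Traceless γ' → SignCommutes (rhoBar E p b).range γ' →
      ∃ i, (rhoBar E p b).range ⊓ commutant γ' = (rhoBar E p b).range ⊓ commutant (γ i))
    (hE' : E' ∈ congruentTwists p E) : ∃ i, IsoOver K (attachedTwist E (d i)) E' := by
  obtain ⟨⟨L, hL, hE'⟩, hc⟩ := hE'
  obtain ⟨i, rfl⟩ := exists_adjoinSqrt_eq hp hC hall hL hE' hc
  exact ⟨i, isoOver_attachedTwist_of_isTwistOver (hd i) hE'⟩

lemma congruentTwistClasses_eq_range (hp : p ≠ 2) (hd : ∀ i, ¬ IsSquare (d i))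
    (hγ : ∀ i, Traceless (γ i)) (hG : ∀ i, SignCommutes (rhoBar E p b).range (γ i))
    (hC : ∀ i, (commutant (γ i)).comap (rhoBar E p b) = (adjoinSqrt (d i)).fixingSubgroup)
    (hall : ∀ γ', Traceless γ' → SignCommutes (rhoBar E p b).range γ' →
      ∃ i, (rhoBar E p b).range ⊓ commutant γ' = (rhoBar E p b).range ⊓ commutant (γ i)) :
    congruentTwistClasses p E = Set.range fun i => Quotient.mk _ (attachedTwist E (d i)) := by
  ext x
  constructor
  · rintro ⟨E', hE', rfl⟩
    obtain ⟨i, hi⟩ := exists_isoOver_attachedTwist hp hd hC hall hE'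
    exact ⟨i, isoOver_iff_mk_eq.mp hi⟩
  · rintro ⟨i, rfl⟩
    exact ⟨_, ⟨⟨_, finrank_adjoinSqrt (hd i), isTwistOver_attachedTwist (hd i)⟩,
      congruent_attachedTwist b hp (hd i) (hγ i) (hG i) (hC i)⟩, rfl⟩

omit [CharZero K] in
lemma ne_zero_of_not_isSquare {d : K} (hd : ¬ IsSquare d) : d ≠ 0 := by
  rintro rfl
  exact hd IsSquare.zero

lemma attachedTwist_mk_injective (hd : ∀ i, ¬ IsSquare (d i))
    (hinj : Function.Injective fun i => adjoinSqrt (d i)) (hE : E.c₆ ≠ 0) :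
    Function.Injective fun i =>
      (Quotient.mk _ (attachedTwist E (d i)) :
        MulAction.orbitRel.Quotient (VariableChange K) (WeierstrassCurve K)) := by
  intro i j hij
  have hq (i : I) : attachedTwist E (d i) = quadraticTwist E (d i) := by
    rcases attachedTwist_cases E (d i) with ⟨h, -⟩ | ⟨-, h, -⟩
    · exact h
    · exact absurd h hE
  have h := isoOver_iff_mk_eq.mpr hij
  rw [hq, hq] at h
  have hi := ne_zero_of_not_isSquare (hd i)
  have hj := ne_zero_of_not_isSquare (hd j)
  exact hinj (adjoinSqrt_eq_of_isSquare_mul hi hj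
    (isSquare_mul_of_isoOver_quadraticTwist hi hj hE h))

/-- Three quadratic extensions, one of them `K(√-1)`, with compositum of degree four, are attached
to only two twists of a curve with `j = 1728`. -/
lemma ncard_range_attachedTwist_of_c₆_eq_zero {d : Fin 3 → K} (hd : ∀ i, ¬ IsSquare (d i))
    (hinj : Function.Injective fun i => adjoinSqrt (d i)) (hE : E.c₆ = 0)
    (h1 : ¬ IsSquare (-1 : K)) (hk : ∃ k, adjoinSqrt (-1 : K) = adjoinSqrt (d k))
    (hmul : ∀ i j k, i ≠ j → i ≠ k → j ≠ k → IsSquare (d i * d j * d k)) :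
    (Set.range fun i => (Quotient.mk _ (attachedTwist E (d i)) :
      MulAction.orbitRel.Quotient (VariableChange K) (WeierstrassCurve K))).ncard = 2 := by
  obtain ⟨k, hk⟩ := hk
  have hd0 (i : Fin 3) : d i ≠ 0 := ne_zero_of_not_isSquare (hd i)
  have hE4 := (c₄_ne_zero_or_c₆_ne_zero (E := E)).resolve_right (not_not.mpr hE)
  have hsq : IsSquare (-d k) := by simpa using isSquare_mul_of_adjoinSqrt_eq hk
  have hnsq {i : Fin 3} (hi : i ≠ k) : ¬ IsSquare (-d i) := fun h => hi (hinj (by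
    change adjoinSqrt (d i) = adjoinSqrt (d k)
    rw [← hk]
    exact (adjoinSqrt_eq_of_isSquare_mul (by simp) (hd0 i) (by simpa using h)).symm))
  have hquartic : attachedTwist E (d k) = quarticTwist E (-4) := by
    rcases attachedTwist_cases E (d k) with ⟨-, h⟩ | ⟨h, -, -⟩
    · exact absurd hsq (h hE)
    · exact h
  have hquad {i : Fin 3} (hi : i ≠ k) : attachedTwist E (d i) = quadraticTwist E (d i) := by
    rcases attachedTwist_cases E (d i) with ⟨h, -⟩ | ⟨-, -, h⟩
    · exact h
    · exact absurd h (hnsq hi)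
  obtain ⟨i, j, hij, hik, hjk, hcover⟩ :
      ∃ i j : Fin 3, i ≠ j ∧ i ≠ k ∧ j ≠ k ∧ ∀ l, l = i ∨ l = j ∨ l = k := by
    clear! d
    decide +revert
  have hiso : IsoOver K (attachedTwist E (d i)) (attachedTwist E (d j)) := by
    rw [hquad hik, hquad hjk, isoOver_self_iff]
    obtain ⟨m, hm⟩ := hsq
    obtain ⟨n, hn⟩ := hmul i j k hij hik hjk
    have hm0 : m ≠ 0 := by
      rintro rfl
      exact hd0 k (by linear_combination -hm)
    have hn0 : n ≠ 0 := by
      rintro rfl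
      exact mul_ne_zero (mul_ne_zero (hd0 i) (hd0 j)) (hd0 k) (by rw [hn, mul_zero])
    have hv : d i * d j * m ^ 2 = - n ^ 2 := by linear_combination -hn - d i * d j * hm
    -- From `d k = -m²` and `d i * d j * d k = n²`, this element has square `-d j / d i`; its fourth
    -- power is the ratio of the `c₄`, and both `c₆` vanish.
    refine ⟨n / (m * d i), div_ne_zero hn0 (mul_ne_zero hm0 (hd0 i)), ?_, ?_⟩
    · rw [c₄_quadraticTwist, c₄_quadraticTwist]
      have hi0 := hd0 i
      field_simp
      linear_combination (d i * d j * m ^ 2 - n ^ 2) * hv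
    · rw [c₆_quadraticTwist, c₆_quadraticTwist, hE]
      ring
  have hnot : ¬ IsoOver K (attachedTwist E (d i)) (attachedTwist E (d k)) := by
    rw [hquad hik, hquartic, isoOver_self_iff]
    rintro ⟨v, hv0, hv, -⟩
    rw [c₄_quadraticTwist, c₄_quarticTwist, ← mul_assoc] at hv
    have h4 := mul_right_cancel₀ hE4 hv
    -- An isomorphism would give `-4 = v⁴ (d i)²`.
    refine h1 ⟨v ^ 2 * d i / 2, ?_⟩
    linear_combination h4 / 4
  have hrange : (Set.range fun i => (Quotient.mk _ (attachedTwist E (d i)) :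
      MulAction.orbitRel.Quotient (VariableChange K) (WeierstrassCurve K))) =
      {Quotient.mk _ (attachedTwist E (d i)), Quotient.mk _ (attachedTwist E (d k))} := by
    ext x
    constructor
    · rintro ⟨l, rfl⟩
      rcases hcover l with rfl | rfl | rfl
      · exact Or.inl rfl
      · exact Or.inl (isoOver_iff_mk_eq.mp hiso).symm
      · exact Or.inr rfl
    · rintro (rfl | rfl)
      exacts [⟨i, rfl⟩, ⟨k, rfl⟩]
  rw [hrange, Set.ncard_pair fun h => hnot (isoOver_iff_mk_eq.mpr h)]

lemma ncard_of_card_projImage_eq_four {K : Type*} [Field K] [NumberField K]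
    {E : WeierstrassCurve K} [E.IsElliptic] (hp : p ≠ 2)
    (b : Module.Basis (Fin 2) (ZMod p) (Torsion E p)) (hS : ConditionS (rhoBar E p b).range)
    {γ : Matrix (Fin 2) (Fin 2) (ZMod p)} (hγ : Traceless γ)
    (hG : SignCommutes (rhoBar E p b).range γ)
    (hcard : Nat.card (projImage (rhoBar E p b).range) = 4) :
    (congruenceFields p E).ncard = 3 ∧
      (E.j ≠ 1728 → (congruentTwistClasses p E).ncard = 3) ∧
      (E.j = 1728 → (congruentTwistClasses p E).ncard = 2) := by
  obtain ⟨γ, hγG, hne, hall, hrel⟩ := exists_three_of_card_eq_four hp hS hγ hG hcard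
  choose hγ hG using hγG
  choose d hd hC using fun i => exists_quadratic_of_signCommutes b hp hS (hγ i) (hG i)
  have hinj : Function.Injective fun i => adjoinSqrt (d i) := by
    intro i j hij
    by_contra h
    apply hne i j h
    rw [← comap_eq_comap_iff, hC, hC]
    exact congrArg IntermediateField.fixingSubgroup hij
  rw [congruenceFields_eq_range hp hd hγ hG hC hall,
    congruentTwistClasses_eq_range hp hd hγ hG hC hall]
  refine ⟨?_, fun hj => ?_, fun hj => ?_⟩
  · rw [← Set.image_univ, Set.ncard_image_of_injective _ hinj, Set.ncard_univ, Nat.card_fin]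
  · rw [← Set.image_univ, Set.ncard_image_of_injective _
      (attachedTwist_mk_injective hd hinj (j_eq_1728_iff.not.mp hj)), Set.ncard_univ, Nat.card_fin]
  · have hE := j_eq_1728_iff.mp hj
    obtain ⟨h1, γ', hγ', hG', hC'⟩ := comap_commutant_of_j_eq_1728 hp b hS hE
    refine ncard_range_attachedTwist_of_c₆_eq_zero hd hinj hE h1 ?_ fun i j k hij hik hjk => ?_
    · obtain ⟨k, hk⟩ := hall γ' hγ' hG'
      refine ⟨k, fixingSubgroup_injective ?_⟩
      rw [← hC', ← hC, comap_eq_comap_iff, hk]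
    · refine isSquare_mul_mul_of_fixingSubgroup fun σ => ?_
      rw [← hC, ← hC, ← hC]
      exact hrel i j k hij hik hjk _ ⟨σ, rfl⟩

end Classification

end TwistCongruence

/-! ### The theorem -/

open TwistCongruence in
theorem theorem2p3 {K : Type*} [Field K] [NumberField K]
    (E : WeierstrassCurve K) [E.IsElliptic] (p : ℕ) [Fact p.Prime] (hp : p ≠ 2)
    (b : Module.Basis (Fin 2) (ZMod p) (Torsion E p))
    (hS : ConditionS (rhoBar E p b).range) :
    -- the first part
    ((p = 3 → E.j ≠ 0) →
      (∃ E' : WeierstrassCurve K, IsTwist E E' ∧ Congruent p E E') →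
      (∃ C : Subgroup (GL (Fin 2) (ZMod p)), IsCartan C ∧
        (rhoBar E p b).range ≤ Subgroup.normalizer (C : Set (GL (Fin 2) (ZMod p))) ∧
        ¬ (rhoBar E p b).range ≤ C) ∧
      ∃ n : ℕ, 2 ≤ n ∧ Nonempty (projImage (rhoBar E p b).range ≃* DihedralGroup n)) ∧
    -- the converse
    (AbsolutelyIrreducible (rhoBar E p b).range →
      ∀ C : Subgroup (GL (Fin 2) (ZMod p)), IsCartan C →
        (rhoBar E p b).range ≤ Subgroup.normalizer (C : Set (GL (Fin 2) (ZMod p))) →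
        ¬ (rhoBar E p b).range ≤ C →
        (∃ d : K, CutsOut E p b C d) ∧
        (∀ d : K, CutsOut E p b C d →
          -- the attached twist is the non-trivial twist of `E` that is split by `K(√d)`
          IsTwistOver (adjoinSqrt d) E (attachedTwist E d) ∧
          (∀ E' : WeierstrassCurve K, IsTwistOver (adjoinSqrt d) E E' →
            IsoOver K (attachedTwist E d) E') ∧
          Congruent p E (attachedTwist E d) ∧
          -- uniqueness
          (Nat.card (projImage (rhoBar E p b).range) ≠ 4 →
            congruenceFields p E = {adjoinSqrt d} ∧
            ∀ E' ∈ congruentTwists p E, IsoOver K (attachedTwist E d) E')) ∧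
        -- the three twists
        (Nat.card (projImage (rhoBar E p b).range) = 4 →
          (congruenceFields p E).ncard = 3 ∧
          (E.j ≠ 1728 → (congruentTwistClasses p E).ncard = 3) ∧
          (E.j = 1728 → (congruentTwistClasses p E).ncard = 2))) := by
  refine ⟨fun h3 ⟨E', hE', hc⟩ => ?_, fun _ C hC hN _ => ?_⟩
  · have h3' : p = 3 → E.c₄ ≠ 0 := fun h => E.j_eq_zero_iff.not.mp (h3 h)
    obtain ⟨γ, hγ, hG⟩ := exists_traceless_of_isTwist b hp h3' hE' hc
    exact ⟨⟨commutant γ, isCartan_commutant hp hγ,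
      (hγ.signCommutes_iff (two_ne_zero_of_ne_two hp) _).mpr hG, hS _ (isCartan_commutant hp hγ)⟩,
      exists_mulEquiv_dihedralGroup hp hS hγ hG⟩
  · obtain ⟨γ, hγ, rfl⟩ := exists_eq_commutant_of_isCartan hp hC
    have hG := (hγ.signCommutes_iff (two_ne_zero_of_ne_two hp) _).mp hN
    refine ⟨exists_quadratic_of_signCommutes b hp hS hγ hG, ?_,
      ncard_of_card_projImage_eq_four hp b hS hγ hG⟩
    rintro d ⟨hd, hd'⟩
    refine ⟨isTwistOver_attachedTwist hd, fun _ => isoOver_attachedTwist_of_isTwistOver hd,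
      congruent_attachedTwist b hp hd hγ hG hd', fun hcard => ?_⟩
    -- Outside order 4 every admissible `γ'` meets the image in the same subgroup, so the list of
    -- characters has one entry.
    have hall (γ') (hγ' : Traceless γ') (hG' : SignCommutes (rhoBar E p b).range γ') :
        ∃ _ : Unit, (rhoBar E p b).range ⊓ commutant γ' = (rhoBar E p b).range ⊓ commutant γ :=
      ⟨(), (commutant_inf_eq_of_card_ne_four hp hS hγ hG hγ' hG' hcard).symm⟩
    constructor
    · rw [congruenceFields_eq_range (d := fun _ : Unit => d) hp (fun _ => hd) (fun _ => hγ)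
        (fun _ => hG) (fun _ => hd') hall, Set.range_const]
    · intro E' hE'
      exact (exists_isoOver_attachedTwist (d := fun _ : Unit => d) hp (fun _ => hd)
        (fun _ => hd') hall hE').elim fun _ => id
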